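/- Lemma 4.3 (pullback_of_forms). Let $k$ be an algebraically closed field of arbitrary characteristic. A variety is an integral separated $k$-scheme of finite type. An orbifold $(X,\Delta)$ is a variety $X$ with a $\mathbb{Q}$-Weil divisor $\Delta=\sum_i\nu_i\Delta_i$ with coefficients $\nu_i\in[0,1]$ such that for every prime divisor $D$ of $X$, with coefficient $\nu_D$ in $\Delta$, the multiplicity $m(D):=(1-\nu_D)^{-1}$ lies in $\mathbb{Z}\cup\{\infty\}$. It is smooth if $X$ is smooth over $k$, every component of $\operatorname{supp}\Delta$ is smooth over $k$, and étale-locally around every point of $X$ there are local coordinates $x_1,\dots,x_d$ (functions defining an étale morphism to $\mathbb{A}^d_k$, $d=\dim X$) such that $\operatorname{supp}\Delta$ is given by $x_1\cdots x_\ell=0$ for some $\ell\le d$; such coordinates are said to exhibit $\Delta$ in normal crossing form. A morphism of smooth orbifolds $f:(X,\Delta_X)\to(Y,\Delta_Y)$ is a morphism $f:X\to Y$ of varieties over $k$ with $f(X)\not\subseteq\operatorname{supp}\Delta_Y$ such that for every prime divisor $E\subseteq\operatorname{supp}\Delta_Y$ and every prime divisor $D\subseteq\operatorname{supp}f^*E$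 one has $t\,m(D)\ge m(E)$, where $t$ is the coefficient of $D$ in $f^*E$. For a smooth orbifold $(X,\Delta)$ and integers $n,p\ge 0$, let $S^n\Omega^p_{(X,\Delta)}$ be the $\mathcal{O}_X$-submodule of $\operatorname{Sym}^n\Omega^p_X(\log\lceil\Delta\rceil)$ (hence of the constant sheaf of rational sections of $\operatorname{Sym}^n\Omega^p_X$) that is étale-locally generated by the elements $$x^{\lceil k/m\rceil}\bigotimes_{i=1}^n\frac{dx_{J_i}}{x_{J_i}},\qquad J_1,\dots,J_n\subseteq\{1,\dots,d\},\ |J_i|=p,$$ where $x_1,\dots,x_d$ are local coordinates exhibiting $\Delta$ in normal crossing form, $dx_J=\bigwedge_{j\in J}dx_j$, $x_J=\prod_{j\in J}x_j$, $k_j$ is the number of $i$ with $j\in J_i$, $m_j$ is the multiplicity of the coordinate $x_j$ in $\Delta$, and $x^{\lceil k/m\rceil}=\prod_j x_j^{\lceil k_j/m_j\rceil}$ (with $k_j/\infty=0$). Let $f:(X,\Delta_X)\to(Y,\Delta_Y)$ be a morphism of smooth orbifolds and let $n,p\ge 0$ be integers. Then pullback of differential forms induces a morphism of $\mathcal{O}_X$-modules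 $$f^*S^n\Omega^p_{(Y,\Delta_Y)}\to S^n\Omega^p_{(X,\Delta_X)}.$$ That is, there is a unique morphism of $\mathcal{O}_X$-modules $f^*S^n\Omega^p_{(Y,\Delta_Y)}\to S^n\Omega^p_{(X,\Delta_X)}$ which, for every local section $\omega$ of $S^n\Omega^p_{(Y,\Delta_Y)}$, sends $f^*\omega$ to the pullback of the symmetric form $\omega$ along $f$. This pullback is a rational symmetric form on $X$; it is defined because $\omega$ is regular at the image of the generic point of $X$, which does not lie in $\operatorname{supp}\Delta_Y$. -/

import Mathlib

open CategoryTheory AlgebraicGeometry TopologicalSpace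
open scoped KaehlerDifferential

universe u

noncomputable section

/-! ### Symmetric products of differential forms on a `k`-algebra -/

/-- The symmetric algebra, over `A`, of the module of `p`-forms `Ω^p_{A/k} = ⋀^p Ω_{A/k}`. Its
degree `n` part is `Sym^n Ω^p_{A/k}`, spanned by the products of `n` forms. -/
def SymForms (k A : Type u) [CommRing k] [CommRing A] [Algebra k A] (p : ℕ) : Type u :=
  SymmetricAlgebra A (⋀[A]^p (Ω[A⁄k]))

namespace SymForms

instance instCommRing (k A : Type u) [CommRing k] [CommRing A] [Algebra k A] (p : ℕ) :
    CommRing (SymForms k A p) :=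
  inferInstanceAs (CommRing (SymmetricAlgebra A (⋀[A]^p (Ω[A⁄k]))))

instance instAlgebra (k A : Type u) [CommRing k] [CommRing A] [Algebra k A] (p : ℕ) :
    Algebra A (SymForms k A p) :=
  inferInstanceAs (Algebra A (SymmetricAlgebra A (⋀[A]^p (Ω[A⁄k]))))

/-- The inclusion of `Ω^p_{A/k}` as the degree one part. -/
def ι (k A : Type u) [CommRing k] [CommRing A] [Algebra k A] (p : ℕ) :
    (⋀[A]^p (Ω[A⁄k])) →ₗ[A] SymForms k A p :=
  SymmetricAlgebra.ι A (⋀[A]^p (Ω[A⁄k]))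

end SymForms

/-- The `φ`-semilinear map `Ω^p_{A/k} → Ω^p_{B/k}`,
`da₁ ∧ ⋯ ∧ da_p ↦ dφ(a₁) ∧ ⋯ ∧ dφ(a_p)`, of a morphism `φ : A → B` of `k`-algebras. -/
def formsMap {k A B : Type u} [CommRing k] [CommRing A] [CommRing B] [Algebra k A] [Algebra k B]
    (p : ℕ) (φ : A →ₐ[k] B) : (⋀[A]^p (Ω[A⁄k])) →ₛₗ[φ.toRingHom] (⋀[B]^p (Ω[B⁄k])) :=
  letI : Algebra A B := φ.toRingHom.toAlgebra
  haveI : IsScalarTower k A B := IsScalarTower.of_algebraMap_eq' φ.comp_algebraMap.symm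
  let ψ : (Ω[A⁄k]) [⋀^Fin p]→ₗ[A] (⋀[B]^p (Ω[B⁄k])) :=
    { toFun := fun v ↦ exteriorPower.ιMulti B p fun i ↦ KaehlerDifferential.map k k A B (v i)
      map_update_add' := by
        intro _ v i x y
        have h (z : Ω[A⁄k]) : (fun j ↦ KaehlerDifferential.map k k A B (Function.update v i z j)) =
            Function.update (fun j ↦ KaehlerDifferential.map k k A B (v j)) i
              (KaehlerDifferential.map k k A B z) :=
          funext fun j ↦ Function.apply_update (fun _ ↦ KaehlerDifferential.map k k A B) v i z j
        simp only [h, map_add, AlternatingMap.map_update_add]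
      map_update_smul' := by
        intro _ v i c x
        have h (z : Ω[A⁄k]) : (fun j ↦ KaehlerDifferential.map k k A B (Function.update v i z j)) =
            Function.update (fun j ↦ KaehlerDifferential.map k k A B (v j)) i
              (KaehlerDifferential.map k k A B z) :=
          funext fun j ↦ Function.apply_update (fun _ ↦ KaehlerDifferential.map k k A B) v i z j
        simp only [h, map_smul]
        rw [← algebraMap_smul B c, AlternatingMap.map_update_smul, algebraMap_smul]
      map_eq_zero_of_eq' := by
        intro v i j hij hne
        exact AlternatingMap.map_eq_zero_of_eq _ _ (by simp only [hij]) hne }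
  { toFun := exteriorPower.alternatingMapLinearEquiv ψ
    map_add' := map_add _
    map_smul' := fun c x ↦ by
      rw [map_smul, ← algebraMap_smul B c]
      rfl }

/-- The ring homomorphism `Sym Ω^p_{A/k} → Sym Ω^p_{B/k}` of a morphism `φ : A → B` of
`k`-algebras: it is `φ` in degree zero and `formsMap p φ` in degree one. -/
def symFormsMap {k A B : Type u} [CommRing k] [CommRing A] [CommRing B] [Algebra k A] [Algebra k B]
    (p : ℕ) (φ : A →ₐ[k] B) : SymForms k A p →+* SymForms k B p :=
  letI : Algebra A (SymForms k B p) :=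
    ((algebraMap B (SymForms k B p)).comp φ.toRingHom).toAlgebra
  (SymmetricAlgebra.lift (R := A) (A := SymForms k B p)
    { toFun := fun v : (⋀[A]^p (Ω[A⁄k])) ↦ SymForms.ι k B p (formsMap p φ v)
      map_add' := fun v w ↦ by rw [map_add, map_add]
      map_smul' := fun c v ↦ by
        rw [LinearMap.map_smulₛₗ, map_smul, Algebra.smul_def, Algebra.smul_def]
        rfl }).toRingHom

lemma symFormsMap_algebraMap {k A B : Type u} [CommRing k] [CommRing A] [CommRing B] [Algebra k A]
    [Algebra k B] (p : ℕ) (φ : A →ₐ[k] B) (a : A) :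
    symFormsMap p φ (algebraMap A _ a) = algebraMap B _ (φ a) := by
  let _ : Algebra A (SymForms k B p) :=
    ((algebraMap B (SymForms k B p)).comp φ.toRingHom).toAlgebra
  exact AlgHom.commutes (SymmetricAlgebra.lift (R := A) (A := SymForms k B p) _) a

lemma symFormsMap_smul {k A B : Type u} [CommRing k] [CommRing A] [CommRing B] [Algebra k A]
    [Algebra k B] (p : ℕ) (φ : A →ₐ[k] B) (a : A) (ω : SymForms k A p) :
    symFormsMap p φ (a • ω) = φ a • symFormsMap p φ ω := by
  rw [Algebra.smul_def, map_mul, symFormsMap_algebraMap, ← Algebra.smul_def]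

/-! ### Local rings of schemes over `k` -/

/-- The `k`-algebra structure on the local rings of a `k`-scheme. -/
instance stalkAlgebraOver (k : Type u) [Field k] (X : Scheme.{u}) [X.Over (Spec (.of k))] (x : X) :
    Algebra k (X.presheaf.stalk x) :=
  ((X.presheaf.germ ⊤ x (Opens.mem_top _)).hom.comp ((X ↘ Spec (.of k)).appTop.hom.comp
    (Scheme.ΓSpecIso (.of k)).inv.hom)).toAlgebra

/-- If `y` is a specialization of `x`: the localization map `𝒪_{X,y} → 𝒪_{X,x}`. -/
def stalkSpecAlgHom (k : Type u) [Field k] (X : Scheme.{u}) [X.Over (Spec (.of k))] {x y : X}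
    (h : x ⤳ y) : X.presheaf.stalk y →ₐ[k] X.presheaf.stalk x where
  __ := (X.presheaf.stalkSpecializes h).hom
  commutes' a := by
    change ((X.presheaf.germ ⊤ y (Opens.mem_top _) ≫ X.presheaf.stalkSpecializes h).hom) _ = _
    rw [TopCat.Presheaf.germ_stalkSpecializes]
    rfl

/-- The map `𝒪_{Y,f(x)} → 𝒪_{X,x}` induced by a morphism `f : X → Y` of `k`-schemes. -/
def stalkMapAlgHom (k : Type u) [Field k] {X Y : Scheme.{u}} [X.Over (Spec (.of k))]
    [Y.Over (Spec (.of k))] (f : X ⟶ Y) [f.IsOver (Spec (.of k))] (x : X) :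
    Y.presheaf.stalk (f x) →ₐ[k] X.presheaf.stalk x where
  __ := (f.stalkMap x).hom
  commutes' a := by
    have h : (Y ↘ Spec (.of k)).appTop ≫ Y.presheaf.germ ⊤ (f x) (Opens.mem_top _) ≫ f.stalkMap x =
        (X ↘ Spec (.of k)).appTop ≫ X.presheaf.germ ⊤ x (Opens.mem_top _) := by
      rw [Scheme.Hom.germ_stalkMap, ← comp_over f (Spec (.of k)), Scheme.Hom.comp_appTop,
        Category.assoc]
      rfl
    exact congr($(h).hom ((Scheme.ΓSpecIso (.of k)).inv.hom a))

lemma specializes_of_isOpenMap {W X : Scheme.{u}} [IsIntegral W] [IsIntegral X] (g : W ⟶ X)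
    (hg : IsOpenMap g) : g (genericPoint W) ⤳ genericPoint X := by
  obtain ⟨w, hw⟩ : genericPoint X ∈ Set.range g :=
    ((genericPoint_spec X).mem_open_set_iff hg.isOpen_range).2
      ⟨_, trivial, Set.mem_range_self (genericPoint W)⟩
  rw [← hw]
  exact ((genericPoint_spec W).specializes trivial).map g.continuous

/-- The extension `k(X) → k(W)` of function fields induced by an étale morphism `g : W → X` of
integral `k`-schemes. -/
def functionFieldMap (k : Type u) [Field k] {W X : Scheme.{u}} [W.Over (Spec (.of k))]
    [X.Over (Spec (.of k))] [IsIntegral W] [IsIntegral X] (g : W ⟶ X) [g.IsOver (Spec (.of k))]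
    [Etale g] : X.functionField →ₐ[k] W.functionField :=
  (stalkMapAlgHom k g (genericPoint W)).comp
    (stalkSpecAlgHom k X (specializes_of_isOpenMap g g.isOpenMap))

/-- The local ring `𝒪_{X,x}` of an integral scheme as a subring of the function field. -/
def localSubring (X : Scheme.{u}) [IsIntegral X] (x : X) : Subring X.functionField :=
  (algebraMap (X.presheaf.stalk x) X.functionField).range

lemma functionFieldMap_mem (k : Type u) [Field k] {W X : Scheme.{u}} [W.Over (Spec (.of k))]
    [X.Over (Spec (.of k))] [IsIntegral W] [IsIntegral X] (g : W ⟶ X) [g.IsOver (Spec (.of k))]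
    [Etale g] (w : W) {r : X.functionField} (hr : r ∈ localSubring X (g w)) :
    functionFieldMap k g r ∈ localSubring W w := by
  obtain ⟨a, rfl⟩ := hr
  have hη := (genericPoint_spec W).specializes (Set.mem_univ w)
  refine ⟨(g.stalkMap w).hom a, ?_⟩
  change (g.stalkMap w ≫ W.presheaf.stalkSpecializes hη).hom a =
    ((X.presheaf.stalkSpecializes _ ≫ X.presheaf.stalkSpecializes _) ≫ g.stalkMap _).hom a
  rw [← Scheme.Hom.stalkSpecializes_stalkMap, TopCat.Presheaf.stalkSpecializes_comp]

/-! ### Orbifolds -/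

/-- An orbifold `(X, Δ)` over `k`: a variety `X` (an integral separated `k`-scheme of finite type)
and a `ℚ`-Weil divisor `Δ` on `X` with coefficients in `[0, 1]` such that all multiplicities
`(1 - ν)⁻¹` are integers or infinite. A prime divisor is given by its generic point, which is a
point of codimension one. -/
structure Orbifold (k : Type u) [Field k] where
  X : Scheme.{u}
  [overSpec : X.Over (Spec (.of k))]
  [isIntegral : IsIntegral X]
  [isSeparated : IsSeparated (X ↘ Spec (.of k))]
  [locallyOfFiniteType : LocallyOfFiniteType (X ↘ Spec (.of k))]
  [quasiCompact : QuasiCompact (X ↘ Spec (.of k))]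
  Δ : AlgebraicCycle X ℚ
  coheight_eq_one : ∀ E, Δ E ≠ 0 → Order.coheight E = 1
  coeff_nonneg : ∀ E, 0 ≤ Δ E
  coeff_le_one : ∀ E, Δ E ≤ 1
  mult_integral : ∀ E, Δ E ≠ 1 → ∃ m : ℕ, (1 - Δ E)⁻¹ = m

attribute [instance] Orbifold.overSpec Orbifold.isIntegral Orbifold.isSeparated
  Orbifold.locallyOfFiniteType Orbifold.quasiCompact

namespace Orbifold

open Opposite

/-- The multiplicity `(1 - ν)⁻¹ ∈ {1, 2, …, ∞}` of a prime divisor, where `ν` is its coefficient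
in `Δ`. -/
def mult {k : Type u} [Field k] (𝒳 : Orbifold k) (E : 𝒳.X) : ℕ∞ :=
  if 𝒳.Δ E = 1 then ⊤ else (⌊(1 - 𝒳.Δ E)⁻¹⌋₊ : ℕ)

/-- The support of the orbifold divisor. -/
def supp {k : Type u} [Field k] (𝒳 : Orbifold k) : Set 𝒳.X :=
  {x | ∃ E, 𝒳.Δ E ≠ 0 ∧ E ⤳ x}

/-- Local coordinates, on an étale open `g : W → X`, which exhibit `Δ` in normal crossing form:
functions `x₁, …, x_d` on `W` which define an étale morphism `W → 𝔸^d_k`, such that on `W` the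
support of `Δ` is given by the equation `∏_{i ∈ I} x_i = 0` for some `I ⊆ {1, …, d}`. -/
structure Chart {k : Type u} [Field k] (𝒳 : Orbifold k) where
  W : Scheme.{u}
  [overSpec : W.Over (Spec (.of k))]
  [isIntegral : IsIntegral W]
  g : W ⟶ 𝒳.X
  [isOver : g.IsOver (Spec (.of k))]
  [etale : Etale g]
  d : ℕ
  coord : Fin d → Γ(W, ⊤)
  etale_coord : Etale (AffineSpace.homOfVector (n := ULift.{u} (Fin d)) (W ↘ Spec (.of k))
    fun j ↦ coord j.down)
  I : Finset (Fin d)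
  mem_supp_iff : ∀ w : W, g w ∈ 𝒳.supp ↔ w ∉ W.basicOpen (∏ i ∈ I, coord i)

attribute [instance] Chart.overSpec Chart.isIntegral Chart.isOver Chart.etale

/-- An orbifold `(X, Δ)` is smooth if `X` is smooth over `k` and `supp Δ` is a divisor with strict
normal crossings: every component of `supp Δ` (with its reduced structure) is smooth over `k`, and
étale-locally around every point `supp Δ` is given by an equation `x₁ ⋯ x_n = 0` in local
coordinates. -/
structure IsSmooth {k : Type u} [Field k] (𝒳 : Orbifold k) : Prop where
  smooth : Smooth (𝒳.X ↘ Spec (.of k))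
  smooth_component : ∀ E, 𝒳.Δ E ≠ 0 →
    Smooth ((Scheme.IdealSheafData.vanishingIdeal (Closeds.closure {E})).subschemeι ≫
      𝒳.X ↘ Spec (.of k))
  exists_chart : ∀ x : 𝒳.X, ∃ c : 𝒳.Chart, x ∈ Set.range c.g

/-! ### Orbifold symmetric differentials -/

namespace Chart

/-- The coordinate `x_j` as a rational function on `W`. -/
def coordK {k : Type u} [Field k] {𝒳 : Orbifold k} (c : 𝒳.Chart) (j : Fin c.d) :
    c.W.functionField :=
  (c.W.presheaf.germ ⊤ (genericPoint c.W) (Opens.mem_top _)).hom (c.coord j)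

/-- The multiplicity in `Δ` of the coordinate `x_j` near the point `w`: the multiplicity of the
image in `X` of the component of `{x_j = 0}` through `w`, or `1` if `x_j` does not vanish at `w`.
As `{x_j = 0}` is smooth over `k`, it has at most one component through `w`, so that the supremum
runs over at most one prime divisor. -/
def coordMult {k : Type u} [Field k] {𝒳 : Orbifold k} (c : 𝒳.Chart) (w : c.W) (j : Fin c.d) :
    ℕ∞ :=
  max 1 (⨆ D ∈ {D : c.W | D ⤳ w ∧ Order.coheight D = 1 ∧ D ∉ c.W.basicOpen (c.coord j)},
    𝒳.mult (c.g D))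

/-- The rounded-up quotient `⌈a / m⌉`, where `a / ∞ = 0`. -/
def ceilQuot (a : ℕ) (m : ℕ∞) : ℕ :=
  if m = ⊤ then 0 else ⌈(a : ℚ) / (m.toNat : ℚ)⌉₊

/-- The element `x^⌈k/m⌉ ⊗_{i=1}^n dx_{J_i} / x_{J_i}` for `p`-element subsets `J₁, …, J_n` of
`{1, …, d}` (given by their increasing enumerations), where `k_j` is the number of indices `i` with
`j ∈ J_i`, and `m_j` is the multiplicity of `x_j` in `Δ` near `w`. -/
def generator {k : Type u} [Field k] {𝒳 : Orbifold k} (c : 𝒳.Chart) (n p : ℕ) (w : c.W)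
    (J : Fin n → (Fin p ↪o Fin c.d)) : SymForms k c.W.functionField p :=
  (∏ j, c.coordK j ^ ceilQuot (Nat.card {i : Fin n // j ∈ Set.range (J i)}) (c.coordMult w j)) •
    ∏ i, SymForms.ι k c.W.functionField p
      ((∏ a, c.coordK (J i a))⁻¹ • exteriorPower.ιMulti c.W.functionField p
        fun a ↦ KaehlerDifferential.D k c.W.functionField (c.coordK (J i a)))

/-- The `𝒪_{W,w}`-module spanned by these elements, inside the rational symmetric forms on `W`. -/
def localModule {k : Type u} [Field k] {𝒳 : Orbifold k} (c : 𝒳.Chart) (n p : ℕ) (w : c.W) :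
    Submodule (localSubring c.W w) (SymForms k c.W.functionField p) :=
  Submodule.span _ (Set.range (c.generator n p w))

/-- Pullback of rational symmetric forms from `X` to `W`. -/
def pull {k : Type u} [Field k] {𝒳 : Orbifold k} (c : 𝒳.Chart) (p : ℕ) :
    SymForms k 𝒳.X.functionField p →+* SymForms k c.W.functionField p :=
  symFormsMap p (functionFieldMap k c.g)

end Chart

/-- The stalk at `x` of the sheaf `S^n Ω^p_{(X,Δ)}` of a smooth orbifold, which is étale-locally
generated by the elements `x^⌈k/m⌉ ⊗ dx_{J_i} / x_{J_i}`: it consists of those rational symmetric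
forms on `X` whose pullback to any étale open with coordinates exhibiting `Δ` in normal crossing
form lies, at any point over `x`, in the module spanned by these elements. -/
def stalkForms {k : Type u} [Field k] (𝒳 : Orbifold k) (n p : ℕ) (x : 𝒳.X) :
    Submodule (localSubring 𝒳.X x) (SymForms k 𝒳.X.functionField p) where
  carrier := {ω | ∀ (c : 𝒳.Chart) (w : c.W), c.g w = x → c.pull p ω ∈ c.localModule n p w}
  add_mem' ha hb c w hw := by
    rw [map_add]
    exact add_mem (ha c w hw) (hb c w hw)
  zero_mem' c w _ := by
    rw [map_zero]
    exact zero_mem _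
  smul_mem' r ω hω c w hw := by
    subst hw
    have h : c.pull p (r • ω) = functionFieldMap k c.g (r : 𝒳.X.functionField) • c.pull p ω :=
      symFormsMap_smul p _ _ _
    rw [h]
    exact (c.localModule n p w).smul_mem ⟨_, functionFieldMap_mem k c.g w r.2⟩ (hω c w rfl)

/-- Sections of `S^n Ω^p_{(X,Δ)}` are (constant families of) rational symmetric forms which lie in
the stalk at every point. -/
def formsPredicate {k : Type u} [Field k] (𝒳 : Orbifold k) (n p : ℕ) :
    TopCat.LocalPredicate (X := (𝒳.X : TopCat)) fun _ ↦ SymForms k 𝒳.X.functionField p where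
  pred s := (∀ x y, s x = s y) ∧ ∀ x, s x ∈ 𝒳.stalkForms n p x.1
  res i s hs := ⟨fun _ _ ↦ hs.1 _ _, fun x ↦ hs.2 (i x)⟩
  locality {U} s hs := by
    refine ⟨fun x y ↦ ?_, fun x ↦ ?_⟩
    · obtain ⟨V, hxV, i, hV⟩ := hs x
      obtain ⟨V', hyV', i', hV'⟩ := hs y
      obtain ⟨z, hz, hz'⟩ := nonempty_preirreducible_inter V.2 V'.2 ⟨_, hxV⟩ ⟨_, hyV'⟩
      exact (hV.1 ⟨_, hxV⟩ ⟨z, hz⟩).trans (hV'.1 ⟨z, hz'⟩ ⟨_, hyV'⟩)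
    · obtain ⟨V, hxV, i, hV⟩ := hs x
      exact hV.2 ⟨_, hxV⟩

/-- The group of sections of `S^n Ω^p_{(X,Δ)}` over an open subset. -/
def formsSections {k : Type u} [Field k] (𝒳 : Orbifold k) (n p : ℕ) (U : 𝒳.X.Opens) :
    AddSubgroup (U → SymForms k 𝒳.X.functionField p) where
  carrier := {s | (𝒳.formsPredicate n p).pred s}
  add_mem' ha hb := ⟨fun x y ↦ congr_arg₂ (· + ·) (ha.1 x y) (hb.1 x y),
    fun x ↦ add_mem (ha.2 x) (hb.2 x)⟩
  zero_mem' := ⟨fun _ _ ↦ rfl, fun _ ↦ zero_mem _⟩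
  neg_mem' ha := ⟨fun x y ↦ congr_arg (- ·) (ha.1 x y), fun x ↦ neg_mem (ha.2 x)⟩

/-- A function on `U` acts on a section through its germs, viewed in the function field. -/
instance formsSectionsSMul {k : Type u} [Field k] (𝒳 : Orbifold k) (n p : ℕ) (U : 𝒳.X.Opens) :
    SMul Γ(𝒳.X, U) (𝒳.formsSections n p U) where
  smul r s := ⟨fun x ↦ algebraMap (𝒳.X.presheaf.stalk x.1) 𝒳.X.functionField
      ((𝒳.X.presheaf.germ U x.1 x.2).hom r) • s.1 x, by
    refine ⟨fun x y ↦ ?_, fun x ↦ (𝒳.stalkForms n p x.1).smul_mem ⟨_, _, rfl⟩ (s.2.2 x)⟩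
    have : Nonempty U := ⟨x⟩
    exact congr_arg₂ (· • ·)
      ((Scheme.algebraMap_germ_eq_germToFunctionField _ x.2 r).trans
        (Scheme.algebraMap_germ_eq_germToFunctionField _ y.2 r).symm) (s.2.1 x y)⟩

lemma formsSections_add_apply {k : Type u} [Field k] (𝒳 : Orbifold k) (n p : ℕ) (U : 𝒳.X.Opens)
    (s t : 𝒳.formsSections n p U) (x : U) : (s + t).1 x = s.1 x + t.1 x := rfl

lemma formsSections_zero_apply {k : Type u} [Field k] (𝒳 : Orbifold k) (n p : ℕ) (U : 𝒳.X.Opens)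
    (x : U) : (0 : 𝒳.formsSections n p U).1 x = 0 := rfl

lemma formsSections_smul_apply {k : Type u} [Field k] (𝒳 : Orbifold k) (n p : ℕ) (U : 𝒳.X.Opens)
    (r : Γ(𝒳.X, U)) (s : 𝒳.formsSections n p U) (x : U) :
    (r • s).1 x = algebraMap (𝒳.X.presheaf.stalk x.1) 𝒳.X.functionField
      ((𝒳.X.presheaf.germ U x.1 x.2).hom r) • s.1 x := rfl

instance formsSectionsModule {k : Type u} [Field k] (𝒳 : Orbifold k) (n p : ℕ) (U : 𝒳.X.Opens) :
    Module Γ(𝒳.X, U) (𝒳.formsSections n p U) where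
  one_smul s := Subtype.ext <| funext fun x ↦ by
    rw [formsSections_smul_apply, map_one, map_one, one_smul]
  mul_smul a b s := Subtype.ext <| funext fun x ↦ by
    simp only [formsSections_smul_apply, map_mul, mul_smul]
  smul_zero a := Subtype.ext <| funext fun x ↦ by
    rw [formsSections_smul_apply, formsSections_zero_apply]
    exact Algebra.smul_def (A := SymForms k 𝒳.X.functionField p) _ 0 |>.trans (mul_zero _)
  smul_add a s t := Subtype.ext <| funext fun x ↦ by
    rw [formsSections_add_apply, formsSections_smul_apply, formsSections_smul_apply,
      formsSections_smul_apply, formsSections_add_apply, smul_add]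
  add_smul a b s := Subtype.ext <| funext fun x ↦ by
    rw [formsSections_smul_apply, formsSections_add_apply, formsSections_smul_apply,
      formsSections_smul_apply, map_add, map_add, add_smul]
  zero_smul s := Subtype.ext <| funext fun x ↦ by
    rw [formsSections_smul_apply, formsSections_zero_apply, map_zero, map_zero, zero_smul]

/-- The abelian presheaf underlying `S^n Ω^p_{(X,Δ)}`. -/
def formsPresheaf {k : Type u} [Field k] (𝒳 : Orbifold k) (n p : ℕ) : 𝒳.X.Opensᵒᵖ ⥤ Ab.{u} where
  obj U := AddCommGrpCat.of (𝒳.formsSections n p U.unop)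
  map {U V} i := AddCommGrpCat.ofHom
    { toFun := fun s ↦ ⟨fun x ↦ s.1 (i.unop x), (𝒳.formsPredicate n p).res i.unop s.1 s.2⟩
      map_zero' := rfl
      map_add' := fun _ _ ↦ rfl }

instance formsPresheafModule {k : Type u} [Field k] (𝒳 : Orbifold k) (n p : ℕ)
    (U : 𝒳.X.Opensᵒᵖ) : Module (𝒳.X.ringCatSheaf.obj.obj U) ((𝒳.formsPresheaf n p).obj U) :=
  inferInstanceAs (Module Γ(𝒳.X, U.unop) (𝒳.formsSections n p U.unop))

/-- The sheaf `S^n Ω^p_{(X,Δ)}` of orbifold symmetric differentials, as an `𝒪_X`-module. -/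
def symDiff {k : Type u} [Field k] (𝒳 : Orbifold k) (n p : ℕ) : 𝒳.X.Modules where
  val := PresheafOfModules.ofPresheaf (𝒳.formsPresheaf n p) fun U V i r s ↦ by
    refine Subtype.ext <| funext fun x ↦ ?_
    exact congr_arg (fun a : 𝒳.X.presheaf.stalk x.1 ↦
      algebraMap (𝒳.X.presheaf.stalk x.1) 𝒳.X.functionField a • s.1 (i.unop x))
      (TopCat.Presheaf.germ_res_apply 𝒳.X.presheaf i.unop x.1 x.2 r).symm
  isSheaf := by
    change TopCat.Presheaf.IsSheaf (C := Ab) (X := 𝒳.X.toTopCat) (𝒳.formsPresheaf n p)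
    refine (TopCat.Presheaf.isSheaf_iff_isSheaf_comp (forget Ab) (𝒳.formsPresheaf n p)).2 ?_
    exact (TopCat.subsheafToTypes (𝒳.formsPredicate n p)).2

/-- The value at a point of a section of `S^n Ω^p_{(X,Δ)}`, as a rational symmetric form. -/
def evalForm {k : Type u} [Field k] (𝒳 : Orbifold k) {n p : ℕ} {U : 𝒳.X.Opens}
    (s : Γ(𝒳.symDiff n p, U)) (x : U) : SymForms k 𝒳.X.functionField p :=
  (show 𝒳.formsSections n p U from s).1 x

/-! ### Morphisms of orbifolds and pullback of forms -/

/-- The coefficient of `D` in `f^* E` for a prime divisor `E` of `Y` and a prime divisor `D` of `X`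
with `f(D) ⊆ E`, i.e. the length of `𝒪_{X,D} / I_E 𝒪_{X,D}` where `I_E ⊆ 𝒪_{Y,f(D)}` is the ideal of
`E`. When `I_E` is generated by a local equation `h` of `E`, this is the order of vanishing of
`h ∘ f` along `D`. -/
def pullbackCoeff {X Y : Scheme.{u}} (f : X ⟶ Y) {E : Y} {D : X} (h : E ⤳ f D) : ℕ∞ :=
  Module.length (X.presheaf.stalk D) (X.presheaf.stalk D ⧸
    ((IsLocalRing.maximalIdeal (Y.presheaf.stalk E)).comap
      (Y.presheaf.stalkSpecializes h).hom).map (f.stalkMap D).hom)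

/-- A morphism `f : (X, Δ_X) → (Y, Δ_Y)` of orbifolds, for `X` normal and `Y` locally factorial: a
morphism of varieties over `k` with `f(X) ⊄ supp Δ_Y` such that `t ⬝ m(D) ≥ m(E)` for all prime divisors
`E ⊆ supp Δ_Y` and `D ⊆ supp f^* E`, where `t` is the coefficient of `D` in `f^* E`. -/
structure IsMorphism {k : Type u} [Field k] (𝒳 𝒴 : Orbifold k) (f : 𝒳.X ⟶ 𝒴.X)
    [f.IsOver (Spec (.of k))] : Prop where
  not_subset : ¬ Set.range f ⊆ 𝒴.supp
  mult_le : ∀ (E : 𝒴.X) (D : 𝒳.X) (h : E ⤳ f D), 𝒴.Δ E ≠ 0 → Order.coheight D = 1 →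
    𝒴.mult E ≤ pullbackCoeff f h * 𝒳.mult D

/-- `ω'` is the pullback along `f : X → Y` of the rational symmetric form `ω` on `Y`: the form `ω`
comes from a symmetric form which is regular at the image `ξ` of the generic point of `X` (an
element of `Sym Ω^p_{𝒪_{Y,ξ}/k}`), and `ω'` is the image of the latter under the map induced by
`𝒪_{Y,ξ} → k(X)`. -/
def IsPullback (k : Type u) [Field k] {X Y : Scheme.{u}} [X.Over (Spec (.of k))]
    [Y.Over (Spec (.of k))] [IsIntegral X] [IsIntegral Y] (f : X ⟶ Y) [f.IsOver (Spec (.of k))]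
    (p : ℕ) (ω : SymForms k Y.functionField p) (ω' : SymForms k X.functionField p) : Prop :=
  ∃ τ : SymForms k (Y.presheaf.stalk (f (genericPoint X))) p,
    symFormsMap p (stalkSpecAlgHom k Y ((genericPoint_spec Y).specializes trivial)) τ = ω ∧
      symFormsMap p (stalkMapAlgHom k f (genericPoint X)) τ = ω'

/-- The morphism `φ : f^* S^n Ω^p_{(Y,Δ_Y)} → S^n Ω^p_{(X,Δ_X)}` is induced by pullback of
differential forms: for every local section `ω` of `S^n Ω^p_{(Y,Δ_Y)}`, the section `φ(f^* ω)` is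
the pullback of `ω` along `f`. -/
def IsInducedByPullback {k : Type u} [Field k] {𝒳 𝒴 : Orbifold k} (f : 𝒳.X ⟶ 𝒴.X)
    [f.IsOver (Spec (.of k))] (n p : ℕ)
    (φ : (Scheme.Modules.pullback f).obj (𝒴.symDiff n p) ⟶ 𝒳.symDiff n p) : Prop :=
  ∀ (V : 𝒴.X.Opens) (ω : Γ(𝒴.symDiff n p, V)) (x : (f ⁻¹ᵁ V : 𝒳.X.Opens)),
    IsPullback k f p (𝒴.evalForm ω ⟨f x, x.2⟩) (𝒳.evalForm
      ((((Scheme.Modules.pullbackPushforwardAdjunction f).homEquiv _ _ φ).app V).hom ω) x)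

end Orbifold

end

/-! By adjunction, a morphism out of `f^*` is a morphism `S^n Ω^p_Y → f_* S^n Ω^p_X`. Uniqueness is
formal: differentials are free over the local ring of `Y` at `ξ = f(η_X)`, so symmetric forms there
inject into rational ones and a rational form has at most one pullback. Existence needs two facts: a
section is regular at `ξ`, and its pullback lies in the module of logarithmic generators at every
point of every chart of `X`.

Regularity (`exists_symFormsMap_eq_of_notMem_supp`): off `supp Δ_Y` all multiplicities are `1`, so
the generators are regular forms on the chart, and regularity descends along an étale map.

For the second fact, expand the pullback in the basis `dx_i / x_i` of a chart `W` of `X`. Symmetric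
forms become polynomials in the symbols `dx_J / x_J`, each generator becomes a monomial times
`x^⌈k/m⌉`, and membership in the module becomes divisibility of each coefficient
(`mem_span_logGenerator`). The ring `𝒪_{W,w}` is normal and noetherian, being a localization of an
étale algebra over a polynomial ring, so divisibility may be tested at the codimension one points
`D` (`exists_algebraMap_eq_of_forall_dvr`).

At such a `D`, the discrete valuation ring `O = 𝒪_{W,D}` and a chart of `Y` both map to a local ring
`R`, formally étale and faithfully flat over `O`, with the same uniformizer `ϖ`
(`exists_etale_domination`). In `R` a coordinate of multiplicity `m_l ≠ 1` becomes `y_l = ϖ^{t_l}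
u_l` with `u_l` a unit, and `dy_l/y_l = du_l/u_l + t_l dϖ/ϖ`. So each factor `dy_J/y_J`, after
cancelling the coordinates of multiplicity `1`, has at most a simple logarithmic pole, and only if
`J` contains some `l` with `m_l ≠ 1` and `t_l > 0`. If `K` factors have a pole, then `K ≤ ∑ k_l`
over these `l`. The prefactor supplies `ϖ` to the power `∑ t_l ⌈k_l/m_l⌉`, and `m_l ≤ t_l m(D)`
gives `∑ t_l ⌈k_l/m_l⌉ ≥ ∑ ⌈k_l/m(D)⌉ ≥ ⌈K/m(D)⌉`, which is the vanishing required
(`coeffLattice_orbGenerator`). The divisibility then descends from `R` to `O` by faithful flatness.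

The exponent `t_l` has to be compared with the coefficient of a prime divisor in `f^* E`. For this,
`y_l` must generate the ideal of `E` in the local ring of the chart (`Chart.map_generizationIdeal`);
this is where smoothness of the components enters, through the Jacobian criterion and Nakayama's
lemma. -/

noncomputable section

/-! ### Functoriality of symmetric forms -/

section Functoriality

variable {k A B C : Type u} [CommRing k] [CommRing A] [CommRing B] [CommRing C]
  [Algebra k A] [Algebra k B] [Algebra k C]

/-- The `φ`-semilinear map `Ω_{A/k} → Ω_{B/k}`, `da ↦ dφ(a)`. -/
def diffMap (φ : A →ₐ[k] B) : (Ω[A⁄k]) →ₛₗ[φ.toRingHom] (Ω[B⁄k]) :=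
  letI : Algebra A B := φ.toRingHom.toAlgebra
  haveI : IsScalarTower k A B := IsScalarTower.of_algebraMap_eq' φ.comp_algebraMap.symm
  { toFun := KaehlerDifferential.map k k A B
    map_add' := map_add _
    map_smul' := fun c x ↦ by
      rw [map_smul, ← algebraMap_smul B c]
      rfl }

@[simp]
lemma diffMap_D (φ : A →ₐ[k] B) (a : A) :
    diffMap φ (KaehlerDifferential.D k A a) = KaehlerDifferential.D k B (φ a) := by
  let _ : Algebra A B := φ.toRingHom.toAlgebra
  have : IsScalarTower k A B := IsScalarTower.of_algebraMap_eq' φ.comp_algebraMap.symm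
  exact KaehlerDifferential.map_D k k A B a

lemma diffMap_smul (φ : A →ₐ[k] B) (a : A) (x : Ω[A⁄k]) :
    diffMap φ (a • x) = φ a • diffMap φ x :=
  LinearMap.map_smulₛₗ _ _ _

lemma formsMap_ιMulti (p : ℕ) (φ : A →ₐ[k] B) (v : Fin p → Ω[A⁄k]) :
    formsMap p φ (exteriorPower.ιMulti A p v) =
      exteriorPower.ιMulti B p fun i ↦ diffMap φ (v i) := by
  let _ : Algebra A B := φ.toRingHom.toAlgebra
  have : IsScalarTower k A B := IsScalarTower.of_algebraMap_eq' φ.comp_algebraMap.symm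
  exact exteriorPower.alternatingMapLinearEquiv_apply_ιMulti _ v

lemma symFormsMap_ι (p : ℕ) (φ : A →ₐ[k] B) (v : ⋀[A]^p (Ω[A⁄k])) :
    symFormsMap p φ (SymForms.ι k A p v) = SymForms.ι k B p (formsMap p φ v) := by
  let _ : Algebra A (SymForms k B p) :=
    ((algebraMap B (SymForms k B p)).comp φ.toRingHom).toAlgebra
  exact SymmetricAlgebra.lift_ι_apply _ v

lemma SymForms.induction {p : ℕ} {motive : SymForms k A p → Prop}
    (scalar : ∀ a, motive (algebraMap A _ a))
    (ι : ∀ v : Fin p → Ω[A⁄k], motive (SymForms.ι k A p (exteriorPower.ιMulti A p v)))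
    (add : ∀ x y, motive x → motive y → motive (x + y))
    (mul : ∀ x y, motive x → motive y → motive (x * y)) (x : SymForms k A p) : motive x := by
  refine SymmetricAlgebra.induction _ _ (motive := motive) scalar (fun v ↦ ?_) mul add x
  change motive (SymForms.ι k A p v)
  have hv : v ∈ Submodule.span A (Set.range (exteriorPower.ιMulti A p (M := Ω[A⁄k]))) := by
    rw [exteriorPower.ιMulti_span]; trivial
  induction hv using Submodule.span_induction with
  | mem x hx => obtain ⟨w, rfl⟩ := hx; exact ι w
  | zero => simpa using scalar 0
  | add x y _ _ hx hy => rw [map_add]; exact add _ _ hx hy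
  | smul a x _ hx => rw [map_smul, Algebra.smul_def]; exact mul _ _ (scalar a) hx

lemma diffMap_comp (φ : A →ₐ[k] B) (ψ : B →ₐ[k] C) (x : Ω[A⁄k]) :
    diffMap (ψ.comp φ) x = diffMap ψ (diffMap φ x) := by
  have hx : x ∈ Submodule.span A (Set.range (KaehlerDifferential.D k A)) := by
    rw [KaehlerDifferential.span_range_derivation]; trivial
  induction hx using Submodule.span_induction with
  | mem x hx => obtain ⟨a, rfl⟩ := hx; rw [diffMap_D, diffMap_D, diffMap_D]; rfl
  | zero => rw [map_zero, map_zero, map_zero]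
  | add x y _ _ hx hy => rw [map_add, map_add, map_add, hx, hy]
  | smul a x _ hx => rw [diffMap_smul, diffMap_smul, diffMap_smul, hx]; rfl

lemma symFormsMap_comp (p : ℕ) (φ : A →ₐ[k] B) (ψ : B →ₐ[k] C) (x : SymForms k A p) :
    symFormsMap p (ψ.comp φ) x = symFormsMap p ψ (symFormsMap p φ x) := by
  induction x using SymForms.induction with
  | scalar a => simp [symFormsMap_algebraMap]
  | ι v =>
    rw [symFormsMap_ι, symFormsMap_ι, symFormsMap_ι, formsMap_ιMulti, formsMap_ιMulti,
      formsMap_ιMulti]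
    simp only [diffMap_comp]
  | add x y hx hy => simp [hx, hy]
  | mul x y hx hy => simp [hx, hy]

end Functoriality

/-! ### Coordinates on symmetric forms -/

section Coordinates

open MvPolynomial

variable {k A B : Type u} [CommRing k] [CommRing A] [CommRing B] [Algebra k A] [Algebra k B]

/-- The basis of `p`-forms attached to a basis of differentials. -/
def formsBasis {d : ℕ} (b : Module.Basis (Fin d) A (Ω[A⁄k])) (p : ℕ) :
    Module.Basis (Fin p ↪o Fin d) A (⋀[A]^p (Ω[A⁄k])) :=
  (b.exteriorPower p).reindex Set.powersetCard.ofFinEmbEquiv.symm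

lemma formsBasis_apply {d : ℕ} (b : Module.Basis (Fin d) A (Ω[A⁄k])) (p : ℕ)
    (J : Fin p ↪o Fin d) : formsBasis b p J = exteriorPower.ιMulti A p (b ∘ J) := by
  rw [formsBasis, Module.Basis.reindex_apply, exteriorPower.basis_apply]
  simp [exteriorPower.ιMulti_family]

lemma formsBasis_repr_ιMulti {d : ℕ} (b : Module.Basis (Fin d) A (Ω[A⁄k])) (p : ℕ)
    (J : Fin p ↪o Fin d) (v : Fin p → Ω[A⁄k]) :
    (formsBasis b p).repr (exteriorPower.ιMulti A p v) J =
      (Matrix.of fun i j ↦ b.repr (v i) (J j)).det := by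
  rw [formsBasis, Module.Basis.repr_reindex_apply, exteriorPower.basis_repr_apply,
    exteriorPower.ιMultiDual_apply_ιMulti]
  simp

/-- The polynomial ring coordinates on symmetric forms attached to a basis of differentials. -/
def symCoord {d : ℕ} (b : Module.Basis (Fin d) A (Ω[A⁄k])) (p : ℕ) :
    SymForms k A p ≃ₐ[A] MvPolynomial (Fin p ↪o Fin d) A :=
  SymmetricAlgebra.equivMvPolynomial (formsBasis b p)

lemma symCoord_ι_basis {d : ℕ} (b : Module.Basis (Fin d) A (Ω[A⁄k])) (p : ℕ)
    (J : Fin p ↪o Fin d) :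
    symCoord b p (SymForms.ι k A p (exteriorPower.ιMulti A p (b ∘ J))) = X J := by
  rw [← formsBasis_apply]
  exact SymmetricAlgebra.equivMvPolynomial_ι_apply (formsBasis b p) J

lemma symCoord_ι {d : ℕ} (b : Module.Basis (Fin d) A (Ω[A⁄k])) (p : ℕ)
    (x : ⋀[A]^p (Ω[A⁄k])) :
    symCoord b p (SymForms.ι k A p x) = ∑ J, C ((formsBasis b p).repr x J) * X J := by
  conv_lhs => rw [← (formsBasis b p).sum_repr x]
  simp only [map_sum, map_smul, formsBasis_apply, symCoord_ι_basis, smul_eq_C_mul]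

lemma repr_diffMap {d : ℕ} (φ : A →ₐ[k] B) (b : Module.Basis (Fin d) A (Ω[A⁄k]))
    (b' : Module.Basis (Fin d) B (Ω[B⁄k])) (h : ∀ i, b' i = diffMap φ (b i)) (x : Ω[A⁄k])
    (i : Fin d) : b'.repr (diffMap φ x) i = φ (b.repr x i) := by
  classical
  conv_lhs => rw [← b.sum_repr x]
  simp only [map_sum, diffMap_smul, ← h, map_smul, Finsupp.coe_finsetSum, Finset.sum_apply,
    Finsupp.smul_apply, Module.Basis.repr_self, Finsupp.single_apply, smul_eq_mul]
  simp

lemma symCoord_symFormsMap {d : ℕ} (p : ℕ) (φ : A →ₐ[k] B)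
    (b : Module.Basis (Fin d) A (Ω[A⁄k])) (b' : Module.Basis (Fin d) B (Ω[B⁄k]))
    (h : ∀ i, b' i = diffMap φ (b i)) (x : SymForms k A p) :
    symCoord b' p (symFormsMap p φ x) = MvPolynomial.map φ.toRingHom (symCoord b p x) := by
  induction x using SymForms.induction with
  | scalar a =>
    rw [symFormsMap_algebraMap]
    simp only [AlgEquiv.commutes, algebraMap_eq, map_C]
    rfl
  | ι v =>
    rw [symFormsMap_ι, formsMap_ιMulti, symCoord_ι, symCoord_ι, map_sum]
    refine Finset.sum_congr rfl fun J _ ↦ ?_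
    rw [map_mul, map_C, map_X, formsBasis_repr_ιMulti, formsBasis_repr_ιMulti, RingHom.map_det φ.toRingHom]
    congr 3
    refine Matrix.ext fun i j ↦ ?_
    exact repr_diffMap φ b b' h (v i) (J j)
  | add x y hx hy => simp [hx, hy]
  | mul x y hx hy => simp [hx, hy]

/-- When a basis of differentials goes to a basis, the map is, in coordinates, the change of
coefficients of a polynomial ring along `φ`. -/
lemma symFormsMap_injective {d : ℕ} (p : ℕ) (φ : A →ₐ[k] B)
    (b : Module.Basis (Fin d) A (Ω[A⁄k])) (b' : Module.Basis (Fin d) B (Ω[B⁄k]))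
    (h : ∀ i, b' i = diffMap φ (b i)) (hφ : Function.Injective φ) :
    Function.Injective (symFormsMap p φ) := by
  intro x y hxy
  apply (symCoord b p).injective
  apply MvPolynomial.map_injective φ.toRingHom hφ
  rw [← symCoord_symFormsMap p φ b b' h, ← symCoord_symFormsMap p φ b b' h, hxy]

/-- Descent of regularity of a symmetric form along `A → B`, if `A` is the intersection of `B` and
`K` in `L`. -/
lemma mem_range_symFormsMap_of_descent {K L : Type u} [CommRing K] [CommRing L] [Algebra k K]
    [Algebra k L] {d : ℕ} (p : ℕ) (φ : A →ₐ[k] B) (i : A →ₐ[k] K) (j : B →ₐ[k] L) (ψ : K →ₐ[k] L)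
    (hcomm : ∀ a, ψ (i a) = j (φ a))
    (hdesc : ∀ (c : K) (r : B), ψ c = j r → c ∈ Set.range i)
    (b : Module.Basis (Fin d) A (Ω[A⁄k])) (bK : Module.Basis (Fin d) K (Ω[K⁄k]))
    (bB : Module.Basis (Fin d) B (Ω[B⁄k])) (bL : Module.Basis (Fin d) L (Ω[L⁄k]))
    (hK : ∀ l, bK l = diffMap i (b l)) (hB : ∀ l, bB l = diffMap φ (b l))
    (hL : ∀ l, bL l = diffMap j (bB l)) (ω : SymForms k K p) (σ : SymForms k B p)
    (h : symFormsMap p ψ ω = symFormsMap p j σ) : ω ∈ Set.range (symFormsMap p i) := by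
  have hψ : ∀ l, bL l = diffMap ψ (bK l) := fun l ↦ by
    have e : j.comp φ = ψ.comp i := AlgHom.ext fun a ↦ (hcomm a).symm
    rw [hL, hB, hK, ← diffMap_comp, ← diffMap_comp, e]
  have key := congr_arg (symCoord bL p) h
  rw [symCoord_symFormsMap p ψ bK bL hψ, symCoord_symFormsMap p j bB bL hL] at key
  -- In compatible bases the equation is one between polynomials over `L`, so each coefficient comes
  -- both from `K` and from `B`, hence from `A`.
  have hc : ∀ μ, coeff μ (symCoord bK p ω) ∈ Set.range i := fun μ ↦ by
    apply hdesc _ (coeff μ (symCoord bB p σ))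
    have := congr_arg (coeff μ) key
    rw [coeff_map, coeff_map] at this
    exact this
  have hmem : symCoord bK p ω ∈ Set.range (MvPolynomial.map i.toRingHom) := by
    rw [MvPolynomial.mem_range_map_iff_coeffs_subset]
    intro c hc'
    obtain ⟨μ, -, rfl⟩ := MvPolynomial.mem_coeffs_iff.1 hc'
    exact hc μ
  obtain ⟨P, hP⟩ := hmem
  refine ⟨(symCoord b p).symm P, (symCoord bK p).injective ?_⟩
  rw [symCoord_symFormsMap p i b bK hK, AlgEquiv.apply_symm_apply, ← hP]

end Coordinates

/-! ### Normality of étale algebras over normal domains -/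

section Normality

open TensorProduct

/-- A reduced artinian ring is a finite product of fields. The indicator of the support of `x` is an
idempotent multiple of `x`; it is nonzero if `x` is, hence equal to `1`. -/
lemma isField_of_isReduced_of_idempotent (C : Type*) [CommRing C] [Nontrivial C]
    [IsArtinianRing C] [IsReduced C] (h : ∀ e : C, IsIdempotentElem e → e = 0 ∨ e = 1) :
    IsField C := by
  classical
  refine ⟨exists_pair_ne C, mul_comm, fun {x} hx ↦ ?_⟩
  let φ := IsArtinianRing.equivPi C
  let _ (m : MaximalSpectrum C) : Field (C ⧸ m.asIdeal) := Ideal.Quotient.field m.asIdeal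
  let e : ∀ m : MaximalSpectrum C, C ⧸ m.asIdeal := fun m ↦ if φ x m = 0 then 0 else 1
  let y : ∀ m : MaximalSpectrum C, C ⧸ m.asIdeal := fun m ↦ (φ x m)⁻¹
  have hxy : φ x * y = e := by
    ext m
    by_cases hm : φ x m = 0
    · simp [e, hm]
    · simp [e, hm, y]
  have he : IsIdempotentElem (φ.symm e) := by
    rw [IsIdempotentElem, ← map_mul]
    congr 1
    ext m
    by_cases hm : φ x m = 0 <;> simp [e, hm]
  rcases h _ he with h0 | h1
  · refine (hx (φ.injective ?_)).elim
    rw [map_zero]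
    have h0 : e = 0 := by simpa using h0
    ext m
    by_contra hm
    have h1 : e m = 1 := if_neg hm
    exact one_ne_zero (h1.symm.trans (congr_fun h0 m))
  · refine ⟨φ.symm y, ?_⟩
    rw [← h1, ← hxy, map_mul, AlgEquiv.symm_apply_apply]

/-- Formation of the integral closure commutes with étale base change and localization, so `Bq` is
integrally closed in `Bq ⊗ K` with `K = Frac A`. That ring is reduced and artinian. Its idempotents
are integral over `Bq`, so they lie in the local ring `Bq` and are trivial; hence `Bq ⊗ K` is a
field, and it is the fraction field of `Bq`. -/
theorem isDomain_and_isIntegrallyClosed_of_etale (A B Bq : Type u) [CommRing A] [CommRing B]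
    [CommRing Bq] [IsDomain A] [IsIntegrallyClosed A] [Algebra A B] [Algebra.Etale A B]
    [Algebra B Bq] [Algebra A Bq] [IsScalarTower A B Bq] (M : Submonoid B)
    [IsLocalization M Bq] [IsLocalRing Bq] : IsDomain Bq ∧ IsIntegrallyClosed Bq := by
  let K := FractionRing A
  have hflat : Module.Flat A Bq := by
    have : Module.Flat B Bq := IsLocalization.flat Bq M
    exact Module.Flat.trans A B Bq
  have : Algebra.FormallyEtale B Bq := Algebra.FormallyEtale.of_isLocalization M
  have : Algebra.FormallyEtale A Bq := Algebra.FormallyEtale.comp A B Bq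
  have : Algebra.EssFiniteType B Bq := Algebra.EssFiniteType.of_isLocalization Bq M
  have : Algebra.EssFiniteType A Bq := Algebra.EssFiniteType.comp A B Bq
  have hinj : Function.Injective (algebraMap Bq (Bq ⊗[A] K)) :=
    Algebra.TensorProduct.includeLeft_injective (S := A) (IsFractionRing.injective A K)
  have hred : IsReduced (K ⊗[A] Bq) := Algebra.FormallyUnramified.isReduced_of_field K _
  have hfin : Module.Finite K (K ⊗[A] Bq) := Algebra.FormallyUnramified.finite_of_free K _
  have hart : IsArtinianRing (K ⊗[A] Bq) := .of_finite K _
  let e := (Algebra.TensorProduct.comm A K Bq).toRingEquiv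
  have hred' : IsReduced (Bq ⊗[A] K) := isReduced_of_injective e.symm e.symm.injective
  have hart' : IsArtinianRing (Bq ⊗[A] K) := e.surjective.isArtinianRing
  have : Nontrivial (Bq ⊗[A] K) := hinj.nontrivial
  have hic : IsIntegrallyClosedIn Bq (Bq ⊗[A] K) := by
    have h1 : Function.Bijective (TensorProduct.toIntegralClosure A Bq K) :=
      TensorProduct.toIntegralClosure_bijective_of_tower (S := B)
        TensorProduct.toIntegralClosure_bijective_of_smooth
        (TensorProduct.toIntegralClosure_bijective_of_isLocalization M)
    rw [isIntegrallyClosedIn_iff]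
    refine ⟨hinj, fun {x} hx ↦ ?_⟩
    obtain ⟨z, hz⟩ := h1.2 ⟨x, hx⟩
    have hz' : Algebra.TensorProduct.map (.id Bq Bq) (integralClosure A K).val z = x :=
      congr_arg Subtype.val hz
    rw [← hz']
    clear hz hz'
    induction z with
    | zero => exact ⟨0, by simp⟩
    | add a b ha hb =>
      obtain ⟨y, hy⟩ := ha
      obtain ⟨y', hy'⟩ := hb
      exact ⟨y + y', by rw [map_add, map_add, hy, hy']⟩
    | tmul b c =>
      obtain ⟨a, ha⟩ := (IsIntegrallyClosed.isIntegral_iff (R := A) (K := K)).1 c.2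
      refine ⟨a • b, ?_⟩
      change (a • b) ⊗ₜ[A] (1 : K) = b ⊗ₜ[A] (c : K)
      rw [← ha, Algebra.algebraMap_eq_smul_one, TensorProduct.smul_tmul]
  have hfield : IsField (Bq ⊗[A] K) := by
    refine isField_of_isReduced_of_idempotent _ fun ε hε ↦ ?_
    have hint : IsIntegral Bq ε :=
      ⟨Polynomial.X ^ 2 - Polynomial.X, Polynomial.monic_X_pow_sub (by simp), by
        simp [pow_two, hε.eq]⟩
    obtain ⟨b, rfl⟩ := IsIntegrallyClosedIn.algebraMap_eq_of_integral hint
    have hb : IsIdempotentElem b := hinj (by rw [map_mul]; exact hε.eq)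
    rcases (IsLocalRing.isUnit_or_isUnit_one_sub_self b) with hu | hu
    · right
      have : b = 1 := hu.mul_left_cancel (by rw [hb.eq, mul_one])
      rw [this, map_one]
    · left
      have : b = 0 := hu.mul_left_cancel (by rw [sub_mul, one_mul, hb.eq, sub_self, mul_zero])
      rw [this, map_zero]
  let _ : Field (Bq ⊗[A] K) := hfield.toField
  have hdom : IsDomain Bq := hinj.isDomain (algebraMap Bq (Bq ⊗[A] K))
  refine ⟨hdom, ?_⟩
  have hloc : IsLocalization (Algebra.algebraMapSubmonoid Bq (nonZeroDivisors A)) (Bq ⊗[A] K) :=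
    inferInstance
  have : IsFractionRing Bq (Bq ⊗[A] K) :=
    { map_units := fun y ↦ by
        rw [isUnit_iff_ne_zero, Ne, map_eq_zero_iff _ hinj]
        exact nonZeroDivisors.ne_zero y.2
      surj := fun z ↦ by
        obtain ⟨⟨x, s⟩, h⟩ := IsLocalization.surj
          (Algebra.algebraMapSubmonoid Bq (nonZeroDivisors A)) z
        refine ⟨⟨x, ⟨s, mem_nonZeroDivisors_of_ne_zero fun hs ↦ ?_⟩⟩, h⟩
        have := IsLocalization.map_units (Bq ⊗[A] K) s
        rw [hs, map_zero] at this
        exact not_isUnit_zero this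
      exists_of_eq := fun {x y} h ↦ ⟨1, by rw [hinj h]⟩ }
  exact (isIntegrallyClosed_iff_isIntegrallyClosedIn (Bq ⊗[A] K)).2 hic

end Normality

/-! ### Normal noetherian domains are intersections of discrete valuation rings -/

section Krull

/-- If `x ∉ R`, the annihilator of its class in `K / R` lies in an associated prime `P`, the
annihilator of the class of some `z`. By normality `zP ⊄ P`, so `zp` is a unit at `P` for some `p ∈
P`. Then `p` generates the maximal ideal of `R_P`, which is thus a discrete valuation ring, and the
hypothesis yields a denominator of `x` outside `P`, a contradiction. -/
theorem exists_algebraMap_eq_of_forall_dvr {R K : Type*} [CommRing R] [IsDomain R]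
    [IsNoetherianRing R] [IsIntegrallyClosed R] [Field K] [Algebra R K] [IsFractionRing R K]
    (x : K)
    (h : ∀ (P : Ideal R) [P.IsPrime], P ≠ ⊥ → (IsDiscreteValuationRing (Localization.AtPrime P)) →
      ∃ a s : R, s ∉ P ∧ x * algebraMap R K s = algebraMap R K a) :
    ∃ r, algebraMap R K r = x := by
  by_contra hx
  let N : Submodule R K := LinearMap.range (Algebra.linearMap R K)
  have hN : ∀ z, z ∈ N ↔ ∃ r, algebraMap R K r = z := fun z ↦ Iff.rfl
  have hx0 : N.mkQ x ≠ 0 := by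
    rw [Submodule.mkQ_apply, Ne, Submodule.Quotient.mk_eq_zero, hN]
    exact hx
  obtain ⟨P, hP, hle⟩ := exists_le_isAssociatedPrime_of_isNoetherianRing R (N.mkQ x) hx0
  rw [isAssociatedPrime_iff] at hP
  obtain ⟨hPprime, z', hz'⟩ := hP
  obtain ⟨z, rfl⟩ := N.mkQ_surjective z'
  have hmem : ∀ y : K, ∀ r : R, r ∈ (⊥ : Submodule R (K ⧸ N)).colon {N.mkQ y} ↔
      ∃ a, algebraMap R K a = y * algebraMap R K r := fun y r ↦ by
    rw [Submodule.mem_colon_singleton, Submodule.mem_bot, ← map_smul, Submodule.mkQ_apply,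
      Submodule.Quotient.mk_eq_zero, hN, Algebra.smul_def, mul_comm]
  have hzP : ∀ r, r ∈ P ↔ ∃ a, algebraMap R K a = z * algebraMap R K r := fun r ↦ by
    rw [hz', hmem]
  have hz : ¬ ∃ r, algebraMap R K r = z := fun ⟨r, hr⟩ ↦ by
    apply hPprime.ne_top
    rw [Ideal.eq_top_iff_one, hzP]
    exact ⟨r, by rw [map_one, mul_one, hr]⟩
  have hPbot : P ≠ ⊥ := by
    obtain ⟨⟨a, s⟩, hs⟩ := IsLocalization.surj (nonZeroDivisors R) z
    intro hbot
    have : (s : R) ∈ P := (hzP _).2 ⟨a, hs.symm⟩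
    rw [hbot, Ideal.mem_bot] at this
    exact nonZeroDivisors.ne_zero s.2 this
  have hdvr : IsDiscreteValuationRing (Localization.AtPrime P) := by
    -- If `zP ⊆ P`, then `z` preserves a nonzero finitely generated submodule of `K`, so it is
    -- integral over `R` and lies in `R`.
    obtain ⟨p, hp, u, hu, huP⟩ : ∃ p ∈ P, ∃ u, algebraMap R K u = z * algebraMap R K p ∧ u ∉ P := by
      by_contra! hcon
      refine hz (IsIntegrallyClosed.algebraMap_eq_of_integral (R := R) ?_)
      refine isIntegral_of_smul_mem_submodule (Submodule.map (Algebra.linearMap R K) P) ?_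
        (Submodule.FG.map _ (IsNoetherian.noetherian P)) z ?_
      · obtain ⟨q, hq, hq0⟩ := Submodule.exists_mem_ne_zero_of_ne_bot hPbot
        rw [Submodule.ne_bot_iff]
        exact ⟨_, ⟨q, hq, rfl⟩, (map_ne_zero_iff _ (IsFractionRing.injective R K)).2 hq0⟩
      · rintro _ ⟨q, hq, rfl⟩
        obtain ⟨a, ha⟩ := (hzP q).1 hq
        exact ⟨a, hcon q hq a ha, ha⟩
    have hprin : (IsLocalRing.maximalIdeal (Localization.AtPrime P)).IsPrincipal := by
      refine ⟨algebraMap R _ p, le_antisymm ?_ ?_⟩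
      · rw [← Localization.AtPrime.map_eq_maximalIdeal, Ideal.map_le_iff_le_comap]
        intro q hq
        obtain ⟨a, ha⟩ := (hzP q).1 hq
        have h1 : q * u = a * p := by
          apply IsFractionRing.injective R K
          rw [map_mul, map_mul, hu, ha]
          ring
        have hunit := IsLocalization.map_units (Localization.AtPrime P) (⟨u, huP⟩ : P.primeCompl)
        rw [Ideal.mem_comap, Ideal.submodule_span_eq, ← Ideal.mul_unit_mem_iff_mem _ hunit,
          ← map_mul, h1, map_mul]
        exact Ideal.mul_mem_left _ _ (Ideal.mem_span_singleton_self _)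
      · rw [Ideal.submodule_span_eq, Ideal.span_singleton_le_iff_mem,
          ← Localization.AtPrime.map_eq_maximalIdeal]
        exact Ideal.mem_map_of_mem _ hp
    refine ((IsDiscreteValuationRing.TFAE (Localization.AtPrime P) ?_).out 0 4).2 hprin
    rw [IsLocalRing.isField_iff_maximalIdeal_eq, ← Localization.AtPrime.map_eq_maximalIdeal,
      Ideal.map_eq_bot_iff_of_injective (IsLocalization.injective _ P.primeCompl_le_nonZeroDivisors)]
    exact hPbot
  obtain ⟨a, s, hs, h⟩ := h P hPbot hdvr
  exact hs (hle ((hmem x s).2 ⟨a, h.symm⟩))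

/-- A local noetherian ring whose maximal ideal is generated by a nonzerodivisor. -/
theorem isDomain_and_eq_pow_mul_unit {R : Type*} [CommRing R] [IsLocalRing R] [IsNoetherianRing R]
    {ϖ : R} (hϖ : ϖ ∈ nonZeroDivisors R) (hm : IsLocalRing.maximalIdeal R = Ideal.span {ϖ}) :
    IsDomain R ∧ ∀ r : R, r ≠ 0 → ∃ (t : ℕ) (u : Rˣ), r = ϖ ^ t * u := by
  classical
  have key : ∀ r : R, r ≠ 0 → ∃ (t : ℕ) (u : Rˣ), r = ϖ ^ t * u := by
    intro r hr
    -- By Krull's intersection theorem `r` leaves the powers of the maximal ideal; the exponent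
    -- sought is one less than the first power that does not contain `r`.
    have h1 : ∃ t, r ∉ IsLocalRing.maximalIdeal R ^ t := by
      by_contra! h
      apply hr
      rw [← Ideal.mem_bot, ← Ideal.iInf_pow_eq_bot_of_isLocalRing _
        (IsLocalRing.maximalIdeal.isMaximal R).ne_top, Ideal.mem_iInf]
      exact h
    have h0 : Nat.find h1 ≠ 0 := fun h ↦ Nat.find_spec h1 (by rw [h, pow_zero, Ideal.one_eq_top]; trivial)
    obtain ⟨t, ht⟩ := Nat.exists_eq_succ_of_ne_zero h0
    have hmem : r ∈ IsLocalRing.maximalIdeal R ^ t := by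
      by_contra hcon
      have := Nat.find_min' h1 hcon
      omega
    rw [hm, Ideal.span_singleton_pow, Ideal.mem_span_singleton] at hmem
    obtain ⟨v, rfl⟩ := hmem
    have hv : IsUnit v := by
      by_contra hv
      have : v ∈ IsLocalRing.maximalIdeal R := hv
      apply Nat.find_spec h1
      rw [hm, Ideal.mem_span_singleton] at this
      obtain ⟨w, rfl⟩ := this
      rw [ht, hm, Ideal.span_singleton_pow, Ideal.mem_span_singleton]
      exact ⟨w, by rw [Nat.succ_eq_add_one]; ring⟩
    exact ⟨t, hv.unit, rfl⟩
  refine ⟨?_, key⟩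
  have : NoZeroDivisors R := by
    refine ⟨fun {a b} hab ↦ ?_⟩
    by_contra! h
    obtain ⟨t, u, rfl⟩ := key a h.1
    obtain ⟨s, v, rfl⟩ := key b h.2
    have : ϖ ^ (t + s) * ((u * v : Rˣ) : R) = 0 := by
      rw [← hab, Units.val_mul]; ring
    rw [Units.mul_left_eq_zero] at this
    exact nonZeroDivisors.ne_zero (pow_mem hϖ (t + s)) this
  exact NoZeroDivisors.to_isDomain R

/-- Descent of a uniformizer along a faithfully flat local homomorphism. -/
theorem exists_maximalIdeal_eq_span {O R : Type*} [CommRing O] [CommRing R] [IsLocalRing O]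
    [IsLocalRing R] [IsDomain R] [Algebra O R] [Module.FaithfullyFlat O R] {ϖ : R} (hϖ : ϖ ≠ 0)
    (hm : IsLocalRing.maximalIdeal R = Ideal.span {ϖ})
    (hOR : (IsLocalRing.maximalIdeal O).map (algebraMap O R) = IsLocalRing.maximalIdeal R) :
    ∃ (a : O) (u : Rˣ), IsLocalRing.maximalIdeal O = Ideal.span {a} ∧
      algebraMap O R a = ϖ * u := by
  -- The ideal `𝔪_O` generates `(ϖ)`, which is not contained in `(ϖ²)`; so some element of `𝔪_O` has
  -- valuation exactly one in `R`.
  have h1 : ∃ a ∈ IsLocalRing.maximalIdeal O, algebraMap O R a ∉ Ideal.span {ϖ ^ 2} := by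
    by_contra! h
    have h2 : IsLocalRing.maximalIdeal R ≤ Ideal.span {ϖ ^ 2} := by
      rw [← hOR, Ideal.map_le_iff_le_comap]
      exact h
    rw [hm, Ideal.span_singleton_le_iff_mem, Ideal.mem_span_singleton] at h2
    obtain ⟨c, hc⟩ := h2
    have : IsUnit ϖ := by
      refine IsUnit.of_mul_eq_one c (mul_left_cancel₀ hϖ ?_)
      rw [mul_one, ← mul_assoc, ← pow_two, ← hc]
    have hmem : ϖ ∈ IsLocalRing.maximalIdeal R := hm ▸ Ideal.mem_span_singleton_self ϖ
    exact hmem this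
  obtain ⟨a, ha, ha2⟩ := h1
  have h3 : algebraMap O R a ∈ Ideal.span {ϖ} := by
    rw [← hm, ← hOR]
    exact Ideal.mem_map_of_mem _ ha
  rw [Ideal.mem_span_singleton] at h3
  obtain ⟨v, hv⟩ := h3
  have hvu : IsUnit v := by
    by_contra hvn
    have : v ∈ IsLocalRing.maximalIdeal R := hvn
    rw [hm, Ideal.mem_span_singleton] at this
    obtain ⟨w, rfl⟩ := this
    exact ha2 (by rw [hv, Ideal.mem_span_singleton]; exact ⟨w, by ring⟩)
  refine ⟨a, hvu.unit, ?_, hv⟩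
  refine le_antisymm ?_ ((Ideal.span_singleton_le_iff_mem _).2 ha)
  have h4 : (Ideal.span {a}).map (algebraMap O R) = IsLocalRing.maximalIdeal R := by
    rw [Ideal.map_span, Set.image_singleton, hv, hm, Ideal.span_singleton_eq_span_singleton]
    exact (associated_mul_unit_right ϖ v hvu).symm
  rw [← Ideal.comap_map_eq_self_of_faithfullyFlat (B := R) (Ideal.span {a}), h4, ← hOR]
  exact Ideal.le_comap_map

/-- A generator `a` of `𝔪_O` is `ϖ` times a unit in `R`. Faithful flatness turns `ϖ^t ∈ JR` into
`a^t ∈ J`, and `O / (a^t)` has length `t`. This bounds the coefficient of a divisor in `f^* E` by an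
order of vanishing in an étale extension. -/
theorem length_quotient_le {O R : Type*} [CommRing O] [CommRing R] [IsLocalRing O] [IsDomain O]
    [IsLocalRing R] [IsDomain R] [Algebra O R] [Module.FaithfullyFlat O R] {ϖ : R} (hϖ : ϖ ≠ 0)
    (hm : IsLocalRing.maximalIdeal R = Ideal.span {ϖ})
    (hOR : (IsLocalRing.maximalIdeal O).map (algebraMap O R) = IsLocalRing.maximalIdeal R)
    (J : Ideal O) (t : ℕ) (ht : ϖ ^ t ∈ J.map (algebraMap O R)) :
    Module.length O (O ⧸ J) ≤ t := by
  obtain ⟨a, u, ha, hau⟩ := exists_maximalIdeal_eq_span hϖ hm hOR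
  have haJ : a ^ t ∈ J := by
    rw [← Ideal.comap_map_eq_self_of_faithfullyFlat (B := R) J, Ideal.mem_comap, map_pow, hau,
      mul_pow]
    exact Ideal.mul_mem_right _ _ ht
  have ha0 : a ≠ 0 := by
    rintro rfl
    rw [map_zero] at hau
    exact mul_ne_zero hϖ u.ne_zero hau.symm
  have h1 : Module.length O (O ⧸ Ideal.span {a}) = 1 := by
    rw [Module.length_eq_one_iff, ← ha]
    exact isSimpleModule_iff_isCoatom.2 (IsLocalRing.maximalIdeal.isMaximal O).out
  have h2 : ∀ s : ℕ, Ring.ord O (a ^ s) = s := by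
    intro s
    induction s with
    | zero => simp
    | succ s ih =>
      rw [pow_succ, Ring.ord_mul O (mem_nonZeroDivisors_of_ne_zero ha0), ih]
      have : Ring.ord O a = 1 := h1
      rw [this]
      push_cast
      rfl
  calc Module.length O (O ⧸ J) ≤ Module.length O (O ⧸ Ideal.span {a ^ t}) :=
        Module.length_le_of_surjective (Submodule.factor ((Ideal.span_singleton_le_iff_mem _).2 haJ))
          (Submodule.factor_surjective _)
    _ = t := h2 t

end Krull

/-! ### Rounded-up quotients -/

section CeilQuot

open Orbifold.Chart

lemma ceilQuot_top (a : ℕ) : ceilQuot a ⊤ = 0 := if_pos rfl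

lemma ceilQuot_le_iff {m : ℕ} (hm : 1 ≤ m) (a q : ℕ) : ceilQuot a m ≤ q ↔ a ≤ q * m := by
  have hm0 : (0 : ℚ) < m := by exact_mod_cast hm
  rw [ceilQuot, if_neg (ENat.natCast_ne_top m), Nat.ceil_le, ENat.toNat_natCast, div_le_iff₀ hm0]
  exact_mod_cast Iff.rfl

lemma ceilQuot_one (a : ℕ) : ceilQuot a 1 = a := by
  refine le_antisymm ?_ ?_
  · have := (ceilQuot_le_iff le_rfl a a).2 (by simp)
    exact_mod_cast this
  · have := (ceilQuot_le_iff le_rfl a (ceilQuot a 1)).1 (by exact_mod_cast le_rfl)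
    simpa using this

lemma ceilQuot_zero {m : ℕ∞} : ceilQuot 0 m = 0 := by
  unfold ceilQuot
  simp

lemma ceilQuot_add_le {m : ℕ∞} (hm : 1 ≤ m) (a b : ℕ) :
    ceilQuot (a + b) m ≤ ceilQuot a m + ceilQuot b m := by
  induction m with
  | top => simp [ceilQuot_top]
  | coe m =>
    have hm' : 1 ≤ m := by exact_mod_cast hm
    rw [ceilQuot_le_iff hm', add_mul]
    exact add_le_add ((ceilQuot_le_iff hm' _ _).1 le_rfl) ((ceilQuot_le_iff hm' _ _).1 le_rfl)

lemma ceilQuot_mono {m : ℕ∞} (hm : 1 ≤ m) {a b : ℕ} (h : a ≤ b) :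
    ceilQuot a m ≤ ceilQuot b m := by
  induction m with
  | top => simp [ceilQuot_top]
  | coe m =>
    have hm' : 1 ≤ m := by exact_mod_cast hm
    rw [ceilQuot_le_iff hm']
    exact h.trans ((ceilQuot_le_iff hm' _ _).1 le_rfl)

lemma ceilQuot_le_self {m : ℕ∞} (hm : 1 ≤ m) (a : ℕ) : ceilQuot a m ≤ a := by
  induction m with
  | top => simp [ceilQuot_top]
  | coe m =>
    have hm' : 1 ≤ m := by exact_mod_cast hm
    rw [ceilQuot_le_iff hm']
    exact Nat.le_mul_of_pos_right _ hm'

/-- For finite multiplicities, `a ≤ ⌈a/m'⌉ m' ≤ ⌈a/m'⌉ t m`. If `m = ∞` the left side is `0`, and if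
`m` is finite then so is `m'`. This is how the inequality in the definition of an orbifold morphism
enters. -/
lemma ceilQuot_le_mul {m m' : ℕ∞} (hm' : 1 ≤ m') (t : ℕ) (h : m' ≤ t * m)
    (a : ℕ) : ceilQuot a m ≤ t * ceilQuot a m' := by
  induction m with
  | top => simp [ceilQuot_top]
  | coe m =>
    have htm : m' ≤ ((t * m : ℕ) : ℕ∞) := by exact_mod_cast h
    induction m' with
    | top => exact absurd htm (ENat.natCast_lt_top _).not_ge
    | coe m' =>
      have h1 : 1 ≤ m' := by exact_mod_cast hm'
      have h2 : m' ≤ t * m := by exact_mod_cast htm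
      have hm1 : 1 ≤ m := by
        rcases Nat.eq_zero_or_pos m with rfl | h'
        · simp at h2; omega
        · exact h'
      rw [ceilQuot_le_iff hm1]
      calc a ≤ ceilQuot a m' * m' := (ceilQuot_le_iff h1 _ _).1 le_rfl
        _ ≤ ceilQuot a m' * (t * m) := Nat.mul_le_mul_left _ h2
        _ = t * ceilQuot a m' * m := by ring

lemma ceilQuot_anti {m m' : ℕ∞} (hm : 1 ≤ m) (h : m ≤ m') (a : ℕ) :
    ceilQuot a m' ≤ ceilQuot a m := by
  simpa using ceilQuot_le_mul (m := m') hm 1 (by simpa using h) a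

lemma ceilQuot_sum_le {ι : Type*} {m : ℕ∞} (hm : 1 ≤ m) (s : Finset ι) (κ : ι → ℕ) :
    ceilQuot (∑ i ∈ s, κ i) m ≤ ∑ i ∈ s, ceilQuot (κ i) m := by
  classical
  induction s using Finset.induction_on with
  | empty => simp [ceilQuot_zero]
  | insert i s hi ih =>
    rw [Finset.sum_insert hi, Finset.sum_insert hi]
    exact (ceilQuot_add_le hm _ _).trans (Nat.add_le_add_left ih _)

/-- The estimate behind the pullback of orbifold differentials. -/
lemma ceilQuot_le_sum {ι : Type*} {m : ℕ∞} (hm : 1 ≤ m) (s : Finset ι) (κ t : ι → ℕ)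
    (m' : ι → ℕ∞) (hm' : ∀ i ∈ s, 1 ≤ m' i) (h : ∀ i ∈ s, m' i ≤ t i * m) (K : ℕ)
    (hK : K ≤ ∑ i ∈ s, κ i) : ceilQuot K m ≤ ∑ i ∈ s, t i * ceilQuot (κ i) (m' i) :=
  ((ceilQuot_mono hm hK).trans (ceilQuot_sum_le hm s κ)).trans
    (Finset.sum_le_sum fun i hi ↦ ceilQuot_le_mul (hm' i hi) _ (h i hi) _)

end CeilQuot

/-! ### Lattices of polynomials with prescribed coefficients -/

section Lattice

open MvPolynomial

variable {R L σ : Type*} [CommRing R] [CommRing L] (j : R →+* L)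

/-- The homogeneous polynomials of degree `n` whose coefficient at `μ` is divisible by `e μ`, with
a quotient in the image of `R`. -/
def coeffLattice (n : ℕ) (e : (σ →₀ ℕ) → L) (P : MvPolynomial σ L) : Prop :=
  ∀ μ, (μ.degree ≠ n → coeff μ P = 0) ∧ ∃ r, coeff μ P = j r * e μ

variable {j}

lemma coeffLattice.zero {n : ℕ} {e : (σ →₀ ℕ) → L} : coeffLattice j n e 0 :=
  fun _ ↦ ⟨fun _ ↦ coeff_zero _, 0, by simp⟩

lemma coeffLattice.add {n : ℕ} {e : (σ →₀ ℕ) → L} {P Q : MvPolynomial σ L}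
    (hP : coeffLattice j n e P) (hQ : coeffLattice j n e Q) : coeffLattice j n e (P + Q) := by
  refine fun μ ↦ ⟨fun h ↦ by rw [coeff_add, (hP μ).1 h, (hQ μ).1 h, add_zero], ?_⟩
  obtain ⟨r, hr⟩ := (hP μ).2
  obtain ⟨s, hs⟩ := (hQ μ).2
  exact ⟨r + s, by rw [coeff_add, hr, hs, map_add, add_mul]⟩

lemma coeffLattice.sum {ι : Type*} {n : ℕ} {e : (σ →₀ ℕ) → L} (s : Finset ι)
    (P : ι → MvPolynomial σ L) (h : ∀ i ∈ s, coeffLattice j n e (P i)) :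
    coeffLattice j n e (∑ i ∈ s, P i) :=
  Finset.sum_induction _ _ (fun _ _ ↦ coeffLattice.add) coeffLattice.zero h

lemma coeffLattice.C_mul {n : ℕ} {e e' : (σ →₀ ℕ) → L} {P : MvPolynomial σ L} (c : L)
    (hP : coeffLattice j n e P) (h : ∀ μ, μ.degree = n → ∃ r, c * e μ = j r * e' μ) :
    coeffLattice j n e' (C c * P) := by
  intro μ
  refine ⟨fun hμ ↦ by rw [coeff_C_mul, (hP μ).1 hμ, mul_zero], ?_⟩
  by_cases hμ : μ.degree = n
  · obtain ⟨r, hr⟩ := (hP μ).2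
    obtain ⟨s, hs⟩ := h μ hμ
    exact ⟨r * s, by rw [coeff_C_mul, hr, map_mul, mul_assoc, ← hs]; ring⟩
  · exact ⟨0, by rw [coeff_C_mul, (hP μ).1 hμ, mul_zero, map_zero, zero_mul]⟩

lemma coeffLattice.mul {n m : ℕ} {e e' e'' : (σ →₀ ℕ) → L} {P Q : MvPolynomial σ L}
    (hP : coeffLattice j n e P) (hQ : coeffLattice j m e' Q)
    (h : ∀ μ ν, ∃ r, e μ * e' ν = j r * e'' (μ + ν)) : coeffLattice j (n + m) e'' (P * Q) := by
  classical
  intro μ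
  constructor
  · intro hμ
    rw [coeff_mul]
    refine Finset.sum_eq_zero fun x hx ↦ ?_
    rw [Finset.HasAntidiagonal.mem_antidiagonal] at hx
    by_cases h1 : x.1.degree = n
    · rw [(hQ x.2).1, mul_zero]
      rintro h2
      exact hμ (by rw [← hx, map_add, h1, h2])
    · rw [(hP x.1).1 h1, zero_mul]
  · have : ∀ x ∈ Finset.HasAntidiagonal.antidiagonal μ, ∃ r, coeff x.1 P * coeff x.2 Q = j r * e'' μ := by
      intro x hx
      rw [Finset.HasAntidiagonal.mem_antidiagonal] at hx
      obtain ⟨r, hr⟩ := (hP x.1).2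
      obtain ⟨s, hs⟩ := (hQ x.2).2
      obtain ⟨q, hq⟩ := h x.1 x.2
      rw [hx] at hq
      exact ⟨r * s * q, by rw [hr, hs, map_mul, map_mul, mul_assoc (j r * j s), ← hq]; ring⟩
    choose! r hr using this
    refine ⟨∑ x ∈ Finset.HasAntidiagonal.antidiagonal μ, r x, ?_⟩
    rw [coeff_mul, map_sum, Finset.sum_mul]
    exact Finset.sum_congr rfl hr

lemma coeffLattice.one {e : (σ →₀ ℕ) → L} (h : e 0 = 1) : coeffLattice j 0 e 1 := by
  classical
  intro μ
  rw [coeff_one]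
  refine ⟨fun hμ ↦ if_neg ?_, ?_⟩
  · rintro rfl
    simp at hμ
  · split_ifs with h0
    · exact ⟨1, by rw [← h0, h, map_one, mul_one]⟩
    · exact ⟨0, by simp⟩

lemma coeffLattice.linear [Fintype σ] {e : (σ →₀ ℕ) → L} (c : σ → L)
    (h : ∀ J, ∃ r, c J = j r * e (Finsupp.single J 1)) :
    coeffLattice j 1 e (∑ J, C (c J) * X J) := by
  classical
  refine coeffLattice.sum _ _ fun J _ μ ↦ ?_
  rw [coeff_C_mul, coeff_X]
  constructor
  · intro hμ
    rw [if_neg, mul_zero]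
    rintro rfl
    simp at hμ
  · split_ifs with h0
    · rw [← h0, mul_one]
      exact h J
    · exact ⟨0, by simp⟩

/-- A product of polynomials in lattices given by truncated powers of `ϖ`. -/
lemma coeffLattice.prod_pow {ι : Type*} (s : Finset ι) (ϖ : R) (wt : (σ →₀ ℕ) →+ ℕ) (κ : ι → ℕ)
    (P : ι → MvPolynomial σ L)
    (h : ∀ a ∈ s, coeffLattice j 1 (fun μ ↦ j ϖ ^ (wt μ - κ a)) (P a)) :
    coeffLattice j s.card (fun μ ↦ j ϖ ^ (wt μ - ∑ a ∈ s, κ a)) (∏ a ∈ s, P a) := by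
  classical
  induction s using Finset.induction_on with
  | empty => simpa using coeffLattice.one (e := fun μ ↦ j ϖ ^ (wt μ)) (by simp)
  | insert a s ha ih =>
    rw [Finset.prod_insert ha, Finset.sum_insert ha, Finset.card_insert_of_notMem ha, add_comm]
    refine coeffLattice.mul (h a (Finset.mem_insert_self _ _))
      (ih fun b hb ↦ h b (Finset.mem_insert_of_mem hb)) fun μ ν ↦ ?_
    -- With truncated subtraction `(a - b) + (c - d) ≥ (a + c) - (b + d)`; the witness is `ϖ` to the
    -- excess.
    refine ⟨ϖ ^ ((wt μ - κ a + (wt ν - ∑ a ∈ s, κ a)) - (wt (μ + ν) - (κ a + ∑ a ∈ s, κ a))), ?_⟩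
    rw [map_pow, ← pow_add, ← pow_add]
    congr 1
    rw [map_add]
    omega

end Lattice

/-! ### Logarithmic generators -/

section LogGenerator

open MvPolynomial Orbifold.Chart

/-- The number of factors, in the monomial `μ`, of index sets which contain `i`. -/
def occ {p d : ℕ} (i : Fin d) : ((Fin p ↪o Fin d) →₀ ℕ) →+ ℕ where
  toFun μ := μ.sum fun J a ↦ if i ∈ Set.range J then a else 0
  map_zero' := Finsupp.sum_zero_index
  map_add' μ ν := Finsupp.sum_add_index' (fun _ ↦ by simp) fun _ _ _ ↦ by split_ifs <;> simp

lemma occ_single {p d : ℕ} (i : Fin d) (J : Fin p ↪o Fin d) :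
    occ i (Finsupp.single J 1) = if i ∈ Set.range J then 1 else 0 := by
  change (Finsupp.single J 1).sum (fun J a ↦ if i ∈ Set.range J then a else 0) = _
  rw [Finsupp.sum_single_index (by simp)]

lemma occ_sum_single {p d n : ℕ} (i : Fin d) (J : Fin n → (Fin p ↪o Fin d)) :
    occ i (∑ a, Finsupp.single (J a) 1) = Nat.card {a : Fin n // i ∈ Set.range (J a)} := by
  classical
  rw [map_sum, Nat.card_eq_fintype_card, Fintype.card_subtype]
  simp only [occ_single, Finset.sum_boole, Nat.cast_id]

/-- A monomial of degree `n` is an unordered `n`-tuple of variables; an ordering of it supplies the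
index sets of a generator. -/
lemma exists_sum_single {σ : Type*} {n : ℕ} (μ : σ →₀ ℕ) (h : μ.degree = n) :
    ∃ J : Fin n → σ, μ = ∑ a, Finsupp.single (J a) 1 := by
  classical
  induction n generalizing μ with
  | zero => exact ⟨Fin.elim0, by simpa using (Finsupp.degree_eq_zero_iff _).1 h⟩
  | succ n ih =>
    have h0 : μ ≠ 0 := by rintro rfl; simp at h
    obtain ⟨s, hs⟩ := Finsupp.ne_iff.1 h0
    have hle : Finsupp.single s 1 ≤ μ := by
      rw [Finsupp.single_le_iff]
      exact Nat.one_le_iff_ne_zero.2 hs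
    obtain ⟨J, hJ⟩ := ih (μ - Finsupp.single s 1) (by
      have := congr_arg Finsupp.degree (tsub_add_cancel_of_le hle)
      rw [map_add, h, Finsupp.degree_single] at this
      omega)
    refine ⟨Fin.cons s J, ?_⟩
    rw [Fin.sum_univ_succ]
    simp only [Fin.cons_zero, Fin.cons_succ]
    rw [← hJ, add_tsub_cancel_of_le hle]

variable {k K : Type u} [Field k] [Field K] [Algebra k K]

/-- The element `x^⌈k/m⌉ ⊗ dx_{J_i} / x_{J_i}` for functions `x` and multiplicities `m`. -/
def logGenerator {d : ℕ} (x : Fin d → K) (m : Fin d → ℕ∞) (n p : ℕ)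
    (J : Fin n → (Fin p ↪o Fin d)) : SymForms k K p :=
  (∏ i, x i ^ ceilQuot (Nat.card {a : Fin n // i ∈ Set.range (J a)}) (m i)) •
    ∏ a, SymForms.ι k K p ((∏ l, x (J a l))⁻¹ • exteriorPower.ιMulti K p
      fun l ↦ KaehlerDifferential.D k K (x (J a l)))

/-- In the basis `dx_i / x_i` a generator is a single monomial, and its coefficient depends on that
monomial only. Hence membership in the span is a condition on each coefficient separately. -/
lemma symCoord_logGenerator {d : ℕ} (x : Fin d → K) (m : Fin d → ℕ∞) (n p : ℕ)
    (J : Fin n → (Fin p ↪o Fin d)) (ε : Module.Basis (Fin d) K (Ω[K⁄k]))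
    (hε : ∀ i, ε i = (x i)⁻¹ • KaehlerDifferential.D k K (x i)) :
    symCoord ε p (logGenerator x m n p J) = monomial (∑ a, Finsupp.single (J a) 1)
      (∏ i, x i ^ ceilQuot (occ i (∑ a, Finsupp.single (J a) 1)) (m i)) := by
  have h : ∀ a, ((∏ l, x (J a l))⁻¹ • exteriorPower.ιMulti K p
      fun l ↦ KaehlerDifferential.D k K (x (J a l))) = exteriorPower.ιMulti K p (ε ∘ J a) := by
    intro a
    have : (ε ∘ J a) = fun l ↦ (x (J a l))⁻¹ • KaehlerDifferential.D k K (x (J a l)) :=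
      funext fun l ↦ hε _
    rw [this, AlternatingMap.map_smul_univ, Finset.prod_inv_distrib]
  rw [logGenerator, map_smul, map_prod]
  simp only [h, symCoord_ι_basis, ← occ_sum_single]
  rw [smul_eq_C_mul, ← mul_one (∏ i, x i ^ _), ← C_mul_monomial, monomial_sum_one, mul_one]
  rfl

lemma mem_span_logGenerator {d : ℕ} (O : Subring K) (x : Fin d → K) (m : Fin d → ℕ∞) (n p : ℕ)
    (ε : Module.Basis (Fin d) K (Ω[K⁄k]))
    (hε : ∀ i, ε i = (x i)⁻¹ • KaehlerDifferential.D k K (x i)) (v : SymForms k K p)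
    (h : coeffLattice O.subtype n (fun μ ↦ ∏ i, x i ^ ceilQuot (occ i μ) (m i))
      (symCoord ε p v)) :
    v ∈ Submodule.span O (Set.range (logGenerator (k := k) x m n p)) := by
  rw [← (symCoord ε p).symm_apply_apply v, (symCoord ε p v).as_sum, map_sum]
  refine Submodule.sum_mem _ fun μ hμ ↦ ?_
  have hdeg : μ.degree = n := by
    by_contra hne
    exact (mem_support_iff.1 hμ) ((h μ).1 hne)
  obtain ⟨r, hr⟩ := (h μ).2
  obtain ⟨J, hJ⟩ := exists_sum_single μ hdeg
  have : (symCoord ε p).symm (monomial μ (coeff μ (symCoord ε p v))) =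
      (r : K) • logGenerator (k := k) x m n p J := by
    rw [AlgEquiv.symm_apply_eq, map_smul, symCoord_logGenerator x m n p J ε hε, ← hJ, hr,
      smul_monomial]
    rfl
  rw [this]
  exact Submodule.smul_mem _ r (Submodule.subset_span ⟨J, rfl⟩)

end LogGenerator

/-! ### Pullbacks of generators to a discrete valuation ring -/

section PulledGenerator

open MvPolynomial Orbifold.Chart

variable {k R L : Type u} [Field k] [CommRing R] [Field L] [Algebra k R] [Algebra k L]

/-- The differential `dy` if `y` has multiplicity `1`, and `dy / y` otherwise. -/
def orbDiff (y : L) (m : ℕ∞) : Ω[L⁄k] :=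
  if m = 1 then KaehlerDifferential.D k L y else y⁻¹ • KaehlerDifferential.D k L y

/-- The power `y^⌈a/m⌉`, omitted if `y` has multiplicity `1`. -/
def orbPow (y : L) (m : ℕ∞) (a : ℕ) : L := if m = 1 then 1 else y ^ ceilQuot a m

/-- The generator `y^⌈k/m⌉ ⊗ dy_{J_i} / y_{J_i}`, where the `y_j` of multiplicity `1` have been
cancelled; it makes sense if these vanish. -/
def orbGenerator {e : ℕ} (y : Fin e → L) (m : Fin e → ℕ∞) (n p : ℕ)
    (J : Fin n → (Fin p ↪o Fin e)) : SymForms k L p :=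
  (∏ l, orbPow (y l) (m l) (Nat.card {a : Fin n // l ∈ Set.range (J a)})) •
    ∏ a, SymForms.ι k L p (exteriorPower.ιMulti L p fun q ↦ orbDiff (y (J a q)) (m (J a q)))

/-- If `m_l = 1`, the power `y_l ^ k_l` cancels exactly the `k_l` denominators `y_l`. The cancelled
expression survives pullback even when `y_l` becomes zero, as happens if `f(X)` lies in a coordinate
hypersurface that is not in `supp Δ_Y`. -/
lemma logGenerator_eq_orbGenerator {e : ℕ} (y : Fin e → L) (hy : ∀ l, y l ≠ 0) (m : Fin e → ℕ∞)
    (n p : ℕ) (J : Fin n → (Fin p ↪o Fin e)) :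
    logGenerator (k := k) y m n p J = orbGenerator y m n p J := by
  classical
  have h1 : ∀ l, KaehlerDifferential.D k L (y l) =
      (if m l = 1 then 1 else y l) • orbDiff (k := k) (y l) (m l) := fun l ↦ by
    unfold orbDiff
    split_ifs
    · rw [one_smul]
    · rw [smul_smul, mul_inv_cancel₀ (hy l), one_smul]
  have h2 : ∀ a, SymForms.ι k L p ((∏ l, y (J a l))⁻¹ • exteriorPower.ιMulti L p
      fun l ↦ KaehlerDifferential.D k L (y (J a l))) =
      (∏ l, if l ∈ Set.range (J a) ∧ m l = 1 then (y l)⁻¹ else 1) • SymForms.ι k L p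
        (exteriorPower.ιMulti L p fun q ↦ orbDiff (y (J a q)) (m (J a q))) := fun a ↦ by
    simp only [h1]
    rw [AlternatingMap.map_smul_univ, smul_smul, map_smul, ← Finset.prod_inv_distrib,
      ← Finset.prod_mul_distrib]
    congr 1
    have : ∏ l, (if l ∈ Set.range (J a) ∧ m l = 1 then (y l)⁻¹ else 1) =
        ∏ l ∈ Finset.univ.map (J a).toEmbedding, if m l = 1 then (y l)⁻¹ else 1 := by
      rw [← Finset.prod_filter_mul_prod_filter_not Finset.univ (fun l ↦ l ∈ Set.range (J a))]
      rw [Finset.prod_eq_one (s := Finset.univ.filter fun l ↦ ¬ l ∈ Set.range (J a)), mul_one]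
      · refine Finset.prod_congr ?_ ?_
        · ext l; simp
        · intro l hl
          have : l ∈ Set.range (J a) := by simpa using hl
          simp only [this, true_and]
      · intro l hl
        rw [if_neg]
        rintro ⟨h, -⟩
        exact (Finset.mem_filter.1 hl).2 h
    rw [this, Finset.prod_map]
    refine Finset.prod_congr rfl fun q _ ↦ ?_
    change _ = if m (J a q) = 1 then (y (J a q))⁻¹ else 1
    split_ifs
    · rw [mul_one]
    · exact inv_mul_cancel₀ (hy _)
  rw [logGenerator, orbGenerator]
  simp only [h2]
  rw [Finset.prod_smul, smul_smul, Finset.prod_comm, ← Finset.prod_mul_distrib]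
  congr 1
  refine Finset.prod_congr rfl fun l _ ↦ ?_
  unfold orbPow
  by_cases hm : m l = 1
  · simp only [hm, and_true, if_true, ceilQuot_one]
    rw [Finset.prod_ite, Finset.prod_const, Finset.prod_const_one, mul_one,
      Nat.card_eq_fintype_card, Fintype.card_subtype, ← mul_pow, mul_inv_cancel₀ (hy l), one_pow]
  · simp [hm]

variable (j : R →ₐ[k] L)

/-- `dr = ∑ (∂_i r) dx_i = ∑ (x_i ∂_i r) dx_i / x_i`. -/
lemma repr_log_D {d : ℕ} {x : Fin d → R} (b : Module.Basis (Fin d) R (Ω[R⁄k]))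
    (hb : ∀ i, b i = KaehlerDifferential.D k R (x i)) (hx : ∀ i, j (x i) ≠ 0)
    (ε : Module.Basis (Fin d) L (Ω[L⁄k]))
    (hε : ∀ i, ε i = (j (x i))⁻¹ • KaehlerDifferential.D k L (j (x i))) (r : R) (i : Fin d) :
    ε.repr (KaehlerDifferential.D k L (j r)) i =
      j (x i * b.repr (KaehlerDifferential.D k R r) i) := by
  classical
  have h : ∀ i, KaehlerDifferential.D k L (j (x i)) = j (x i) • ε i := fun i ↦ by
    rw [hε, smul_smul, mul_inv_cancel₀ (hx i), one_smul]
  rw [← diffMap_D]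
  conv_lhs => rw [← b.sum_repr (KaehlerDifferential.D k R r)]
  simp only [map_sum, diffMap_smul, hb, diffMap_D, h, map_smul, Finsupp.coe_finsetSum,
    Finset.sum_apply, Finsupp.smul_apply, Module.Basis.repr_self, Finsupp.single_apply,
    smul_eq_mul]
  simp [mul_comm]

/-- Coordinates of the logarithmic derivative of `ϖ ^ t * u`. -/
lemma repr_log_pow_mul_unit {d : ℕ} {x : Fin d → R} (b : Module.Basis (Fin d) R (Ω[R⁄k]))
    (hb : ∀ i, b i = KaehlerDifferential.D k R (x i)) (hx : ∀ i, j (x i) ≠ 0)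
    (ε : Module.Basis (Fin d) L (Ω[L⁄k]))
    (hε : ∀ i, ε i = (j (x i))⁻¹ • KaehlerDifferential.D k L (j (x i))) {ϖ : R} (hϖ : j ϖ ≠ 0)
    (t : ℕ) (u : Rˣ) (i : Fin d) :
    ε.repr ((j (ϖ ^ t * u))⁻¹ • KaehlerDifferential.D k L (j (ϖ ^ t * u))) i =
      j (x i * (((u⁻¹ : Rˣ) : R) * b.repr (KaehlerDifferential.D k R (u : R)) i)) +
      j t * (j (x i * b.repr (KaehlerDifferential.D k R ϖ) i) / j ϖ) := by
  have hu : j ((u⁻¹ : Rˣ) : R) * j (u : R) = 1 := by rw [← map_mul, Units.inv_mul, map_one]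
  have hu0 : j (u : R) ≠ 0 := right_ne_zero_of_mul_eq_one hu
  have hu' : j ((u⁻¹ : Rˣ) : R) = (j (u : R))⁻¹ := eq_inv_of_mul_eq_one_left hu
  rw [map_smul, Finsupp.smul_apply, repr_log_D j b hb hx ε hε, Derivation.leibniz,
    Derivation.leibniz_pow]
  simp only [map_add, map_smul, map_nsmul, Finsupp.add_apply, Finsupp.smul_apply, smul_eq_mul,
    map_mul, map_pow, hu', nsmul_eq_mul, map_natCast]
  -- The Leibniz rule produces the truncated exponent `t - 1`, so `t = 0` is separate.
  rcases t with - | t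
  · simp
    field_simp
  · rw [Nat.add_sub_cancel]
    field_simp
    ring

/-- The matrix `C + τ αᵀ / ϖ` is the Schur complement of the entry `ϖ` in a matrix of size `p + 1`
over `R`. So a minor built from logarithmic forms has at most a simple pole, although every entry
may have one. This is needed when `ϖ` is not one of the coordinates, and it works in every
characteristic. -/
lemma bordered_det {p : ℕ} {ϖ : R} (hϖ : j ϖ ≠ 0) (C : Matrix (Fin p) (Fin p) R) (τ α : Fin p → R) :
    ∃ r, j ϖ * (Matrix.of fun i q ↦ j (C i q) + j (τ i) * (j (α q) / j ϖ)).det = j r := by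
  let A : Matrix Unit Unit R := Matrix.of fun _ _ ↦ ϖ
  let B : Matrix Unit (Fin p) R := Matrix.of fun _ q ↦ -α q
  let T : Matrix (Fin p) Unit R := Matrix.of fun i _ ↦ τ i
  refine ⟨(Matrix.fromBlocks A B T C).det, ?_⟩
  rw [AlgHom.map_det, AlgHom.mapMatrix_apply, Matrix.fromBlocks_map]
  let A' : Matrix Unit Unit L := Matrix.of fun _ _ ↦ (j ϖ)⁻¹
  let _ : Invertible (A.map j) :=
    { invOf := A'
      invOf_mul_self := by ext; simp [A, A', Matrix.mul_apply, hϖ]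
      mul_invOf_self := by ext; simp [A, A', Matrix.mul_apply, hϖ] }
  rw [Matrix.det_fromBlocks₁₁]
  congr 1
  · simp [A]
  · congr 1
    refine Matrix.ext fun i q ↦ ?_
    change _ = j (C i q) - (T.map j * A' * B.map j) i q
    simp [Matrix.mul_apply, T, A', B]
    field_simp

/-- The pullback of a generator for `y` to a discrete valuation ring is an integral combination of
generators for `x`. -/
theorem coeffLattice_orbGenerator {d : ℕ} {x : Fin d → R}
    (b : Module.Basis (Fin d) R (Ω[R⁄k]))
    (hb : ∀ i, b i = KaehlerDifferential.D k R (x i)) (hx : ∀ i, j (x i) ≠ 0)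
    (ε : Module.Basis (Fin d) L (Ω[L⁄k]))
    (hε : ∀ i, ε i = (j (x i))⁻¹ • KaehlerDifferential.D k L (j (x i))) {ϖ : R} (hϖ : j ϖ ≠ 0)
    (m : ℕ∞) (hm : 1 ≤ m) (mW : Fin d → ℕ∞)
    (hcase : (∃ i₀, x i₀ = ϖ ∧ (∀ i, i ≠ i₀ → IsUnit (x i)) ∧ m ≤ mW i₀) ∨
      ((∀ i, IsUnit (x i)) ∧ m = 1))
    {e : ℕ} (y : Fin e → R) (m' : Fin e → ℕ∞) (hm' : ∀ l, 1 ≤ m' l) (t : Fin e → ℕ)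
    (u : Fin e → Rˣ) (hy : ∀ l, m' l ≠ 1 → y l = ϖ ^ t l * u l)
    (ht : ∀ l, m' l ≠ 1 → t l ≠ 0 → m' l ≤ t l * m) (n p : ℕ) (J : Fin n → (Fin p ↪o Fin e)) :
    coeffLattice (j : R →+* L) n (fun μ ↦ ∏ i, j (x i) ^ ceilQuot (occ i μ) (mW i))
      (symCoord ε p (orbGenerator (fun l ↦ j (y l)) m' n p J)) := by
  classical
  -- These are the coordinates of `dϖ` in the basis `dx_i / x_i`. Each factor then has coordinates
  -- `x_i c_i + τ a_i / ϖ`, with polar part `τ = t_l` if `m_l ≠ 1` and `τ = 0` otherwise.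
  let a : Fin d → R := fun i ↦ x i * b.repr (KaehlerDifferential.D k R ϖ) i
  have hθ : ∀ l, ∃ (c : Fin d → R) (τ : R), (¬ (m' l ≠ 1 ∧ t l ≠ 0) → τ = 0) ∧ ∀ i,
      ε.repr (orbDiff (j (y l)) (m' l)) i = j (x i * c i) + j τ * (j (a i) / j ϖ) := by
    intro l
    unfold orbDiff
    by_cases hl : m' l = 1
    · refine ⟨fun i ↦ b.repr (KaehlerDifferential.D k R (y l)) i, 0, fun _ ↦ rfl, fun i ↦ ?_⟩
      rw [if_pos hl, repr_log_D j b hb hx ε hε, map_zero, zero_mul, add_zero]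
    · refine ⟨fun i ↦ (((u l)⁻¹ : Rˣ) : R) * b.repr (KaehlerDifferential.D k R (u l : R)) i, t l,
        fun h ↦ ?_, fun i ↦ ?_⟩
      · have : t l = 0 := by
          by_contra h0
          exact h ⟨hl, h0⟩
        rw [this, Nat.cast_zero]
      · rw [if_neg hl, hy l hl, repr_log_pow_mul_unit j b hb hx ε hε hϖ]
  choose c τ hτ hθ using hθ
  -- `N` collects the coordinates whose logarithmic differential may have a pole, `κ` marks the
  -- factors that involve one of them, and `s` is the power of `ϖ` provided by the prefactor.
  let N : Finset (Fin e) := Finset.univ.filter fun l ↦ m' l ≠ 1 ∧ t l ≠ 0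
  let κ : Fin n → ℕ := fun a ↦ if ∃ q, J a q ∈ N then 1 else 0
  let occY : Fin e → ℕ := fun l ↦ Nat.card {a : Fin n // l ∈ Set.range (J a)}
  let s : ℕ := ∑ l ∈ N, t l * ceilQuot (occY l) (m' l)
  -- Each marked factor contains at least one index of `N`, so it is counted at least once on the
  -- right.
  have hK : ∑ a, κ a ≤ ∑ l ∈ N, occY l := by
    have h1 : ∀ l, occY l = ∑ a : Fin n, if l ∈ Set.range (J a) then 1 else 0 := fun l ↦ by
      simp only [occY]
      rw [Nat.card_eq_fintype_card, Fintype.card_subtype, Finset.sum_boole, Nat.cast_id]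
    simp only [h1]
    rw [Finset.sum_comm]
    refine Finset.sum_le_sum fun a _ ↦ ?_
    by_cases h : ∃ q, J a q ∈ N
    · obtain ⟨q, hq⟩ := h
      have := Finset.single_le_sum (f := fun l ↦ if l ∈ Set.range (J a) then 1 else 0)
        (fun _ _ ↦ Nat.zero_le _) hq
      simp only [Set.mem_range_self, if_true] at this
      exact (by simp only [κ]; split_ifs <;> simp : κ a ≤ 1).trans this
    · simp [κ, h]
  have hs : ceilQuot (∑ a, κ a) m ≤ s :=
    ceilQuot_le_sum hm N occY t m' (fun l _ ↦ hm' l)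
      (fun l hl ↦ ht l (Finset.mem_filter.1 hl).2.1 (Finset.mem_filter.1 hl).2.2) _ hK
  obtain ⟨v, hv⟩ : ∃ v : R, ∏ l, orbPow (j (y l)) (m' l) (occY l) = j v * j ϖ ^ s := by
    refine ⟨∏ l, if m' l = 1 then 1 else (u l : R) ^ ceilQuot (occY l) (m' l), ?_⟩
    simp only [s]
    rw [← Finset.prod_pow_eq_pow_sum, Finset.prod_filter, map_prod, ← Finset.prod_mul_distrib]
    refine Finset.prod_congr rfl fun l _ ↦ ?_
    unfold orbPow
    by_cases hl : m' l = 1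
    · simp [hl]
    · rw [if_neg hl, if_neg hl, hy l hl]
      by_cases h0 : t l = 0
      · simp [h0]
      · simp only [ne_eq, hl, not_false_eq_true, h0, and_self, if_true, map_mul, map_pow]
        rw [mul_pow, ← pow_mul, mul_comm]
  rw [orbGenerator, hv, map_smul, map_prod, smul_eq_C_mul]
  simp only [symCoord_ι, formsBasis_repr_ιMulti]
  rcases hcase with ⟨i₀, rfl, hunit, hmi⟩ | ⟨hunit, rfl⟩
  -- Here `dϖ/ϖ` is the basis vector at `i₀`, so marked factors have coefficients in `R`. An
  -- unmarked factor is a regular form, so its coefficient at `dx_K / x_K` is divisible by every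
  -- `x_i` with `i ∈ K`. Both cases are encoded by the exponent `occ i₀ - κ`.
  · have hai : ∀ i, j (a i) / j (x i₀) = if i = i₀ then 1 else 0 := by
      intro i
      simp only [a, ← hb, Module.Basis.repr_self, Finsupp.single_apply]
      by_cases h : i = i₀
      · subst h; simp [hx]
      · simp [h, Ne.symm h]
    have hfac : ∀ q ∈ (Finset.univ : Finset (Fin n)), coeffLattice (j : R →+* L) 1
        (fun μ ↦ (j : R →+* L) (x i₀) ^ (occ i₀ μ - κ q))
        (∑ K : Fin p ↪o Fin d, C (Matrix.of fun i r ↦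
          ε.repr (orbDiff (j (y (J q i))) (m' (J q i))) (K r)).det * X K) := by
      intro q _
      refine coeffLattice.linear _ fun K ↦ ?_
      rw [occ_single]
      by_cases hq : ∃ r, J q r ∈ N
      · refine ⟨(Matrix.of fun i r ↦ x (K r) * c (J q i) (K r) +
          τ (J q i) * (if K r = i₀ then 1 else 0)).det, ?_⟩
        have : (if i₀ ∈ Set.range K then 1 else 0) - κ q = 0 := by
          simp only [κ, if_pos hq]
          split_ifs <;> simp
        rw [this, pow_zero, mul_one]
        change _ = j _
        rw [AlgHom.map_det]
        congr 1
        refine Matrix.ext fun i r ↦ ?_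
        simp only [Matrix.of_apply, AlgHom.mapMatrix_apply, Matrix.map_apply, hθ, hai, map_add,
          map_mul]
        split_ifs <;> simp
      · have hτ0 : ∀ r, τ (J q r) = 0 := fun r ↦ hτ _ fun h ↦
          hq ⟨r, Finset.mem_filter.2 ⟨Finset.mem_univ _, h⟩⟩
        have hκ : κ q = 0 := if_neg hq
        have hdet : (Matrix.of fun i r ↦ ε.repr (orbDiff (j (y (J q i))) (m' (J q i))) (K r)).det =
            j ((∏ r, x (K r)) * (Matrix.of fun i r ↦ c (J q i) (K r)).det) := by
          rw [← Matrix.det_mul_row, AlgHom.map_det]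
          congr 1
          refine Matrix.ext fun i r ↦ ?_
          simp [hθ, hτ0]
        rw [hdet, hκ, Nat.sub_zero]
        split_ifs with hi
        · obtain ⟨r, hr⟩ := hi
          obtain ⟨z, hz⟩ := Finset.dvd_prod_of_mem (fun r ↦ x (K r)) (Finset.mem_univ r)
          refine ⟨z * (Matrix.of fun i r ↦ c (J q i) (K r)).det, ?_⟩
          change _ = j _ * j _ ^ 1
          rw [hz, pow_one, ← map_mul, hr]
          congr 1
          ring
        · exact ⟨_, by rw [pow_zero, mul_one]; rfl⟩
    have hprod := coeffLattice.prod_pow Finset.univ (x i₀) (occ i₀) κ _ hfac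
    rw [Finset.card_univ, Fintype.card_fin] at hprod
    refine hprod.C_mul _ fun μ _ ↦ ?_
    -- `⌈occ/m⌉ ≤ ⌈∑κ/m⌉ + ⌈(occ - ∑κ)/m⌉ ≤ s + (occ - ∑κ)`; truncation takes care of `occ < ∑κ`.
    have hle : ceilQuot (occ i₀ μ) (mW i₀) ≤ s + (occ i₀ μ - ∑ a, κ a) := by
      refine (ceilQuot_anti hm hmi _).trans ?_
      refine (ceilQuot_mono hm (b := (∑ a, κ a) + (occ i₀ μ - ∑ a, κ a)) (by omega)).trans ?_
      exact (ceilQuot_add_le hm _ _).trans (add_le_add hs (ceilQuot_le_self hm _))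
    obtain ⟨w, hw⟩ : ∃ w : R, w * ∏ i, x i ^ ceilQuot (occ i μ) (mW i) =
        x i₀ ^ (s + (occ i₀ μ - ∑ a, κ a)) := by
      rw [← Finset.mul_prod_erase _ _ (Finset.mem_univ i₀)]
      have hu : IsUnit (∏ i ∈ Finset.univ.erase i₀, x i ^ ceilQuot (occ i μ) (mW i)) :=
        IsUnit.prod_iff.2 fun i hi ↦ (hunit i (Finset.ne_of_mem_erase hi)).pow _
      obtain ⟨w, hw⟩ := hu.exists_left_inv
      refine ⟨x i₀ ^ (s + (occ i₀ μ - ∑ a, κ a) - ceilQuot (occ i₀ μ) (mW i₀)) * w, ?_⟩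
      rw [mul_assoc, mul_left_comm w, hw, mul_one, ← pow_add, Nat.sub_add_cancel hle]
    refine ⟨v * w, ?_⟩
    change _ * j _ ^ _ = j _ * _
    simp only [← map_pow, ← map_prod, ← map_mul]
    rw [mul_assoc, mul_assoc, hw, ← pow_add]
  -- All `x_i` are units, so only integrality of the coefficients is at stake. By `bordered_det` the
  -- power `ϖ^κ` clears the pole of each factor, and `m = 1` gives `∑κ ≤ s`. The lattice used has
  -- trivial weight, hence the base `1`.
  · have hfac : ∀ q ∈ (Finset.univ : Finset (Fin n)), coeffLattice (j : R →+* L) 1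
        (fun μ ↦ (j : R →+* L) 1 ^ ((0 : ((Fin p ↪o Fin d) →₀ ℕ) →+ ℕ) μ - 0))
        (C (j ϖ ^ κ q) * ∑ K : Fin p ↪o Fin d, C (Matrix.of fun i r ↦
          ε.repr (orbDiff (j (y (J q i))) (m' (J q i))) (K r)).det * X K) := by
      intro q _
      rw [Finset.mul_sum]
      simp only [← mul_assoc, ← C_mul]
      refine coeffLattice.linear _ fun K ↦ ?_
      rw [map_one, one_pow]
      simp only [hθ, mul_one]
      obtain ⟨r, hr⟩ := bordered_det j hϖ (Matrix.of fun i r ↦ x (K r) * c (J q i) (K r))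
        (fun i ↦ τ (J q i)) (fun r ↦ a (K r))
      by_cases hq : ∃ r, J q r ∈ N
      · refine ⟨r, ?_⟩
        rw [show κ q = 1 from if_pos hq, pow_one]
        exact hr
      · have hτ0 : ∀ r, τ (J q r) = 0 := fun r ↦ hτ _ fun h ↦
          hq ⟨r, Finset.mem_filter.2 ⟨Finset.mem_univ _, h⟩⟩
        refine ⟨(Matrix.of fun i r ↦ x (K r) * c (J q i) (K r)).det, ?_⟩
        rw [show κ q = 0 from if_neg hq, pow_zero, one_mul]
        change _ = j _
        rw [AlgHom.map_det]
        congr 1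
        refine Matrix.ext fun i r ↦ ?_
        simp [hτ0]
    have hprod := coeffLattice.prod_pow Finset.univ 1 0 (fun _ ↦ 0) _ hfac
    rw [Finset.card_univ, Fintype.card_fin, Finset.prod_mul_distrib, ← map_prod,
      Finset.prod_pow_eq_pow_sum] at hprod
    have hs' : ∑ a, κ a ≤ s := by rwa [ceilQuot_one] at hs
    have hsplit : C (j v * j ϖ ^ s) = (C (j v * j ϖ ^ (s - ∑ a, κ a)) * C (j ϖ ^ ∑ a, κ a) :
        MvPolynomial (Fin p ↪o Fin d) L) := by
      rw [← C_mul, mul_assoc, ← pow_add, Nat.sub_add_cancel hs']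
    rw [hsplit, mul_assoc]
    refine hprod.C_mul _ fun μ _ ↦ ?_
    have hu : IsUnit (∏ i, x i ^ ceilQuot (occ i μ) (mW i)) :=
      IsUnit.prod_iff.2 fun i _ ↦ (hunit i).pow _
    obtain ⟨w, hw⟩ := hu.exists_left_inv
    refine ⟨v * ϖ ^ (s - ∑ a, κ a) * w, ?_⟩
    rw [map_one, one_pow, mul_one]
    change _ = j _ * _
    simp only [← map_pow, ← map_prod, ← map_mul]
    rw [mul_assoc _ w, hw, mul_one]

end PulledGenerator

/-! ### Étale coordinates on local rings -/

section EtaleCoordinates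

open TensorProduct KaehlerDifferential

/-- For a formally étale `A → B`, the canonical map `B ⊗_A Ω_{A/k} → Ω_{B/k}` is an isomorphism. -/
theorem exists_basis_of_formallyEtale {k A B : Type u} [CommRing k] [CommRing A] [CommRing B]
    [Algebra k A] [Algebra k B] {ι : Type*} (φ : A →ₐ[k] B) (hφ : φ.toRingHom.FormallyEtale)
    (b : Module.Basis ι A (Ω[A⁄k])) :
    ∃ b' : Module.Basis ι B (Ω[B⁄k]), ∀ i, b' i = diffMap φ (b i) := by
  let _ : Algebra A B := φ.toRingHom.toAlgebra
  have : IsScalarTower k A B := IsScalarTower.of_algebraMap_eq' φ.comp_algebraMap.symm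
  have : Algebra.FormallyEtale A B := hφ
  refine ⟨(b.baseChange B).map (tensorKaehlerEquivOfFormallyEtale k A B), fun i ↦ ?_⟩
  rw [Module.Basis.map_apply, Module.Basis.baseChange_apply,
    tensorKaehlerEquivOfFormallyEtale_apply, mapBaseChange_tmul, one_smul]
  rfl

/-- The elements `x₁, …, x_d` of `B` define a morphism `k[X₁, …, X_d] → B` which is a localization
of an étale one. -/
def HasEtaleCoordinates (k : Type u) {B : Type u} [CommRing k] [CommRing B] [Algebra k B] {d : ℕ}
    (x : Fin d → B) : Prop :=
  ∃ (C : Type u) (_ : CommRing C) (_ : Algebra (MvPolynomial (ULift.{u} (Fin d)) k) C)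
    (_ : Algebra C B) (M : Submonoid C), Algebra.Etale (MvPolynomial (ULift.{u} (Fin d)) k) C ∧
    IsLocalization M B ∧ ∀ P : MvPolynomial (ULift.{u} (Fin d)) k,
      algebraMap C B (algebraMap _ C P) = MvPolynomial.aeval (fun i ↦ x i.down) P

namespace HasEtaleCoordinates

variable {k B : Type u} [CommRing k] [CommRing B] [Algebra k B] {d : ℕ} {x : Fin d → B}

theorem formallyEtale (h : HasEtaleCoordinates k x) :
    (MvPolynomial.aeval (R := k) fun i : ULift.{u} (Fin d) ↦ x i.down).toRingHom.FormallyEtale := by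
  obtain ⟨C, _, _, _, M, hC, hM, h⟩ := h
  let _ : Algebra (MvPolynomial (ULift.{u} (Fin d)) k) B :=
    ((algebraMap C B).comp (algebraMap _ C)).toAlgebra
  have : IsScalarTower (MvPolynomial (ULift.{u} (Fin d)) k) C B := IsScalarTower.of_algebraMap_eq'
    rfl
  have : Algebra.FormallyEtale C B := Algebra.FormallyEtale.of_isLocalization M
  have h1 : Algebra.FormallyEtale (MvPolynomial (ULift.{u} (Fin d)) k) B :=
    Algebra.FormallyEtale.comp _ C B
  have h2 : (algebraMap (MvPolynomial (ULift.{u} (Fin d)) k) B) =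
      (MvPolynomial.aeval (R := k) fun i : ULift.{u} (Fin d) ↦ x i.down).toRingHom :=
    RingHom.ext h
  rw [← h2]
  exact RingHom.formallyEtale_algebraMap.2 h1

theorem exists_basis (h : HasEtaleCoordinates k x) :
    ∃ b : Module.Basis (Fin d) B (Ω[B⁄k]), ∀ i, b i = D k B (x i) := by
  obtain ⟨b, hb⟩ := exists_basis_of_formallyEtale _ h.formallyEtale
    ((mvPolynomialBasis k (ULift.{u} (Fin d))).reindex Equiv.ulift)
  refine ⟨b, fun i ↦ ?_⟩
  rw [hb, Module.Basis.reindex_apply, mvPolynomialBasis_apply, diffMap_D, MvPolynomial.aeval_X]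
  rfl

theorem formallySmooth (h : HasEtaleCoordinates k x) : Algebra.FormallySmooth k B := by
  let _ : Algebra (MvPolynomial (ULift.{u} (Fin d)) k) B :=
    (MvPolynomial.aeval (R := k) fun i : ULift.{u} (Fin d) ↦ x i.down).toRingHom.toAlgebra
  have : IsScalarTower k (MvPolynomial (ULift.{u} (Fin d)) k) B :=
    IsScalarTower.of_algebraMap_eq'
      (MvPolynomial.aeval (R := k) fun i : ULift.{u} (Fin d) ↦ x i.down).comp_algebraMap.symm
  have : Algebra.FormallyEtale (MvPolynomial (ULift.{u} (Fin d)) k) B := h.formallyEtale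
  exact Algebra.FormallySmooth.comp k (MvPolynomial (ULift.{u} (Fin d)) k) B

end HasEtaleCoordinates

theorem HasEtaleCoordinates.isDomain_and_isIntegrallyClosed {k B : Type u} [Field k] [CommRing B]
    [Algebra k B] [IsLocalRing B] {d : ℕ} {x : Fin d → B} (h : HasEtaleCoordinates k x) :
    IsDomain B ∧ IsIntegrallyClosed B := by
  obtain ⟨C, _, _, _, M, hC, hM, h⟩ := h
  let _ : Algebra (MvPolynomial (ULift.{u} (Fin d)) k) B :=
    ((algebraMap C B).comp (algebraMap _ C)).toAlgebra
  have : IsScalarTower (MvPolynomial (ULift.{u} (Fin d)) k) C B := IsScalarTower.of_algebraMap_eq'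
    rfl
  exact isDomain_and_isIntegrallyClosed_of_etale (MvPolynomial (ULift.{u} (Fin d)) k) C B M

theorem HasEtaleCoordinates.isNoetherianRing {k B : Type u} [Field k] [CommRing B]
    [Algebra k B] {d : ℕ} {x : Fin d → B} (h : HasEtaleCoordinates k x) :
    IsNoetherianRing B := by
  obtain ⟨C, _, _, _, M, hC, hM, h⟩ := h
  have : IsNoetherianRing C :=
    Algebra.FiniteType.isNoetherianRing (MvPolynomial (ULift.{u} (Fin d)) k) C
  exact IsLocalization.isNoetherianRing M B this

/-- The quotient `B / IB` is a local localization of an étale algebra over the normal domain `A /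
I`, hence a domain. Applied to a coordinate hyperplane, it shows that `{x_j = 0}` has one component
through a given point of a chart. -/
theorem isPrime_map_of_etale (A C B : Type u) [CommRing A] [CommRing C] [CommRing B] [Algebra A C]
    [Algebra.Etale A C] [Algebra C B] [Algebra A B] [IsScalarTower A C B] (M : Submonoid C)
    [IsLocalization M B] [IsLocalRing B] (I : Ideal A) [IsDomain (A ⧸ I)]
    [IsIntegrallyClosed (A ⧸ I)] (hI : I.map (algebraMap A B) ≠ ⊤) :
    (I.map (algebraMap A B)).IsPrime := by
  have hnt : Nontrivial (B ⧸ I.map (algebraMap A B)) := Ideal.Quotient.nontrivial_iff.2 hI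
  let e := Algebra.TensorProduct.quotIdealMapEquivQuotTensor B I
  have hloc1 : IsLocalRing (B ⧸ I.map (algebraMap A B)) :=
    IsLocalRing.of_surjective' _ Ideal.Quotient.mk_surjective
  have hloc : IsLocalRing ((A ⧸ I) ⊗[A] B) := e.toRingEquiv.isLocalRing
  let _ : Algebra ((A ⧸ I) ⊗[A] C) ((A ⧸ I) ⊗[A] B) :=
    (Algebra.TensorProduct.map (AlgHom.id A (A ⧸ I)) (IsScalarTower.toAlgHom A C B)).toAlgebra
  have hT : IsScalarTower (A ⧸ I) ((A ⧸ I) ⊗[A] C) ((A ⧸ I) ⊗[A] B) := by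
    refine IsScalarTower.of_algebraMap_eq (R := A ⧸ I) (S := (A ⧸ I) ⊗[A] C)
      (A := (A ⧸ I) ⊗[A] B) fun z ↦ ?_
    change z ⊗ₜ[A] (1 : B) = Algebra.TensorProduct.map (AlgHom.id A (A ⧸ I))
      (IsScalarTower.toAlgHom A C B) (z ⊗ₜ[A] (1 : C))
    simp
  have hM := IsLocalization.tensorProduct_tensorProduct_right A (A ⧸ I) M B
    (by ext; change Algebra.TensorProduct.map _ _ (1 ⊗ₜ _) = _; simp)
  have hdom := (isDomain_and_isIntegrallyClosed_of_etale (A ⧸ I) ((A ⧸ I) ⊗[A] C)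
    ((A ⧸ I) ⊗[A] B)
    (M.map (Algebra.TensorProduct.includeRight (R := A) (A := A ⧸ I)))).1
  rw [← Ideal.Quotient.isDomain_iff_prime]
  exact e.toMulEquiv.isDomain _

lemma MvPolynomial.isDomain_and_isIntegrallyClosed_quotient (k : Type u) [Field k] {σ : Type u}
    (j : σ) : IsDomain (MvPolynomial σ k ⧸ Ideal.span {(MvPolynomial.X j : MvPolynomial σ k)}) ∧
      IsIntegrallyClosed (MvPolynomial σ k ⧸ Ideal.span {(MvPolynomial.X j : MvPolynomial σ k)}) := by
  classical
  let ρ : MvPolynomial σ k →ₐ[k] MvPolynomial {i : σ // i ≠ j} k := MvPolynomial.aeval fun i ↦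
    if hi : i ≠ j then MvPolynomial.X (⟨i, hi⟩ : {i : σ // i ≠ j}) else 0
  have hs : ρ.comp (MvPolynomial.rename Subtype.val) = AlgHom.id k _ := by
    refine MvPolynomial.algHom_ext fun i ↦ ?_
    simp [ρ, i.2]
  have hρ : Function.Surjective ρ := fun q ↦ ⟨MvPolynomial.rename Subtype.val q, congr($hs q)⟩
  have hker : RingHom.ker ρ = Ideal.span {(MvPolynomial.X j : MvPolynomial σ k)} := by
    refine le_antisymm (fun q hq ↦ ?_) ?_
    · have h1 : (Ideal.Quotient.mkₐ k (Ideal.span {(MvPolynomial.X j : MvPolynomial σ k)})).comp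
          ((MvPolynomial.rename Subtype.val).comp ρ) = Ideal.Quotient.mkₐ k _ := by
        refine MvPolynomial.algHom_ext fun i ↦ ?_
        by_cases hi : i = j
        · have : (MvPolynomial.X j : MvPolynomial σ k) ∈
            Ideal.span {(MvPolynomial.X j : MvPolynomial σ k)} := Ideal.mem_span_singleton_self _
          simp [ρ, hi, (Ideal.Quotient.eq_zero_iff_mem.2 this)]
        · simp [ρ, hi]
      have h2 := congr($h1 q)
      rw [AlgHom.comp_apply, AlgHom.comp_apply, (RingHom.mem_ker).1 hq, map_zero, map_zero] at h2
      exact Ideal.Quotient.eq_zero_iff_mem.1 h2.symm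
    · rw [Ideal.span_singleton_le_iff_mem, RingHom.mem_ker]
      simp [ρ]
  let e := (Ideal.quotEquivOfEq hker.symm).trans (RingHom.quotientKerEquivOfSurjective
    (f := (ρ : MvPolynomial σ k →+* MvPolynomial {i : σ // i ≠ j} k)) hρ)
  exact ⟨e.toMulEquiv.isDomain _, IsIntegrallyClosed.of_equiv e.symm⟩

theorem HasEtaleCoordinates.isPrime_span_singleton {k B : Type u} [Field k] [CommRing B]
    [Algebra k B] [IsLocalRing B] {d : ℕ} {x : Fin d → B} (h : HasEtaleCoordinates k x) (j : Fin d)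
    (hj : ¬ IsUnit (x j)) : (Ideal.span {x j}).IsPrime := by
  obtain ⟨C, _, _, _, M, hC, hM, h⟩ := h
  let _ : Algebra (MvPolynomial (ULift.{u} (Fin d)) k) B :=
    ((algebraMap C B).comp (algebraMap _ C)).toAlgebra
  have : IsScalarTower (MvPolynomial (ULift.{u} (Fin d)) k) C B :=
    IsScalarTower.of_algebraMap_eq' rfl
  have h1 : (Ideal.span {(MvPolynomial.X ⟨j⟩ : MvPolynomial (ULift.{u} (Fin d)) k)}).map
      (algebraMap (MvPolynomial (ULift.{u} (Fin d)) k) B) = Ideal.span {x j} := by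
    rw [Ideal.map_span, Set.image_singleton]
    congr 2
    exact (h _).trans (MvPolynomial.aeval_X _ _)
  obtain ⟨_, _⟩ := MvPolynomial.isDomain_and_isIntegrallyClosed_quotient k (ULift.up.{u} j)
  rw [← h1]
  refine isPrime_map_of_etale _ C B M _ ?_
  rw [h1]
  exact fun h2 ↦ hj (Ideal.span_singleton_eq_top.1 h2)

/-! ### Differentials of equations of smooth subschemes -/

/-- Jacobian criterion: as `B` and `B / I` are formally smooth, `I/I² → (B/I) ⊗ Ω_{B/k}` has a
retraction. Applied to `dh ∈ 𝔪Ω`, it gives `h ∈ 𝔪I + I² = 𝔪I`. -/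
theorem mem_maximalIdeal_smul_of_D_mem {k B : Type u} [Field k] [CommRing B] [Algebra k B]
    [IsLocalRing B] [Algebra.FormallySmooth k B] (I : Ideal B) (hI : I ≠ ⊤)
    [Algebra.FormallySmooth k (B ⧸ I)]
    {h : B} (hh : h ∈ I) (hD : D k B h ∈ IsLocalRing.maximalIdeal B • (⊤ : Submodule B (Ω[B⁄k]))) :
    h ∈ IsLocalRing.maximalIdeal B • I := by
  have hker : RingHom.ker (algebraMap B (B ⧸ I)) = I := Ideal.mk_ker
  obtain ⟨l, hl⟩ := (Algebra.FormallySmooth.iff_split_injection (R := k) (P := B) (A := B ⧸ I)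
    Ideal.Quotient.mk_surjective).1 inferInstance
  let h' : RingHom.ker (algebraMap B (B ⧸ I)) := ⟨h, hker.symm ▸ hh⟩
  have h1 : Ideal.toCotangent _ h' ∈ IsLocalRing.maximalIdeal B •
      (⊤ : Submodule B (RingHom.ker (algebraMap B (B ⧸ I))).Cotangent) := by
    have h2 : l ((1 : B ⧸ I) ⊗ₜ D k B h) = Ideal.toCotangent _ h' :=
      congr($hl (Ideal.toCotangent _ h'))
    rw [← h2]
    let f : (Ω[B⁄k]) →ₗ[B] (RingHom.ker (algebraMap B (B ⧸ I))).Cotangent :=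
      l ∘ₗ TensorProduct.mk B (B ⧸ I) (Ω[B⁄k]) 1
    have h3 : f (D k B h) ∈ (IsLocalRing.maximalIdeal B • (⊤ : Submodule B (Ω[B⁄k]))).map f :=
      Submodule.mem_map_of_mem hD
    rw [Submodule.map_smul''] at h3
    exact Submodule.smul_mono le_rfl le_top h3
  have h4 : (⊤ : Submodule B (RingHom.ker (algebraMap B (B ⧸ I))).Cotangent) =
      (⊤ : Submodule B (RingHom.ker (algebraMap B (B ⧸ I)))).map (Ideal.toCotangent _) := by
    rw [Submodule.map_top, LinearMap.range_eq_top.2 (Ideal.toCotangent_surjective _)]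
  rw [h4, ← Submodule.map_smul''] at h1
  obtain ⟨h'', hm, he⟩ := h1
  rw [Ideal.toCotangent_eq] at he
  have h5 : (h'' : B) ∈ IsLocalRing.maximalIdeal B • I := by
    have := Submodule.mem_map_of_mem (f := (RingHom.ker (algebraMap B (B ⧸ I))).subtype) hm
    rw [Submodule.map_smul'', Submodule.map_top, Submodule.range_subtype] at this
    exact Submodule.smul_mono le_rfl hker.le this
  have h6 : (h'' : B) - h ∈ IsLocalRing.maximalIdeal B • I := by
    have h7 : I ^ 2 ≤ IsLocalRing.maximalIdeal B • I := by
      rw [pow_two, smul_eq_mul]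
      exact Ideal.mul_mono_left (IsLocalRing.le_maximalIdeal hI)
    exact h7 (Ideal.pow_right_mono hker.le 2 he)
  have := sub_mem h5 h6
  rwa [sub_sub_cancel] at this

/-- If `y ∉ I`, every `h ∈ I` is `by` with `b ∈ 𝔪`, so `dh = b dy + y db` lies in `𝔪Ω` and the
Jacobian criterion gives `I = 𝔪I`. Nakayama's lemma then forces `I = 0`. -/
theorem mem_of_formallySmooth_quotient {k B : Type u} [Field k] [CommRing B] [Algebra k B]
    [IsLocalRing B] [IsNoetherianRing B] [Algebra.FormallySmooth k B] (I : Ideal B) (hI0 : I ≠ ⊥)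
    [Algebra.FormallySmooth k (B ⧸ I)] {y : B} (hy : ¬ IsUnit y) (hIy : I ≤ Ideal.span {y}) :
    y ∈ I := by
  by_contra hyI
  have hym : y ∈ IsLocalRing.maximalIdeal B := hy
  have hItop : I ≠ ⊤ := by
    rintro rfl
    exact hyI trivial
  refine hI0 (Submodule.eq_bot_of_le_smul_of_le_jacobson_bot (IsLocalRing.maximalIdeal B) I
    (IsNoetherian.noetherian I) (fun h hh ↦ ?_) (IsLocalRing.maximalIdeal_le_jacobson _))
  refine mem_maximalIdeal_smul_of_D_mem (k := k) I hItop hh ?_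
  obtain ⟨b, rfl⟩ := Ideal.mem_span_singleton'.1 (hIy hh)
  have hb : b ∈ IsLocalRing.maximalIdeal B := by
    intro hb
    exact hyI ((Ideal.unit_mul_mem_iff_mem I hb).1 hh)
  rw [Derivation.leibniz]
  exact add_mem (Submodule.smul_mem_smul hb trivial) (Submodule.smul_mem_smul hym trivial)

theorem formallySmooth_quotient_map {k A B : Type u} [Field k] [CommRing A] [CommRing B]
    [Algebra k A] [Algebra k B] [Algebra A B] [IsScalarTower k A B] [Algebra.FormallySmooth A B]
    (I : Ideal A) [Algebra.FormallySmooth k (A ⧸ I)] :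
    Algebra.FormallySmooth k (B ⧸ I.map (algebraMap A B)) := by
  have : Algebra.FormallySmooth (A ⧸ I) (B ⧸ I.map (algebraMap A B)) :=
    .of_equiv (Algebra.TensorProduct.quotIdealMapEquivQuotTensor B I).symm
  have : IsScalarTower k (A ⧸ I) (B ⧸ I.map (algebraMap A B)) := .of_algebraMap_eq fun a ↦ by
    change Ideal.Quotient.mk _ (algebraMap k B a) = _
    rw [IsScalarTower.algebraMap_apply k A B]
    rfl
  exact Algebra.FormallySmooth.comp k (A ⧸ I) _

end EtaleCoordinates

/-! ### Lifting orbifold forms to local rings -/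

section Lifting

/-- Only the coordinates of multiplicity different from `1` have to be inverted, so one form over
`S` specializes to the generator under every map from `S` to a field. -/
theorem exists_symFormsMap_eq_orbGenerator {k S : Type u} [Field k] [CommRing S] [Algebra k S]
    {e : ℕ} (y : Fin e → S) (m : Fin e → ℕ∞) (hy : ∀ l, m l ≠ 1 → IsUnit (y l)) (n p : ℕ)
    (J : Fin n → (Fin p ↪o Fin e)) :
    ∃ G : SymForms k S p, ∀ (L : Type u) [Field L] [Algebra k L] (β : S →ₐ[k] L),
      symFormsMap p β G = orbGenerator (fun l ↦ β (y l)) m n p J := by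
  classical
  let θ : Fin e → Ω[S⁄k] := fun l ↦ if m l = 1 then KaehlerDifferential.D k S (y l) else
    Ring.inverse (y l) • KaehlerDifferential.D k S (y l)
  let c : Fin e → ℕ → S := fun l a ↦ if m l = 1 then 1 else y l ^ Orbifold.Chart.ceilQuot a (m l)
  refine ⟨(∏ l, c l (Nat.card {a : Fin n // l ∈ Set.range (J a)})) •
    ∏ a, SymForms.ι k S p (exteriorPower.ιMulti S p fun q ↦ θ (J a q)), fun L _ _ β ↦ ?_⟩
  have hθ : ∀ l, diffMap β (θ l) = orbDiff (β (y l)) (m l) := by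
    intro l
    unfold orbDiff
    by_cases hl : m l = 1
    · rw [show θ l = _ from if_pos hl, if_pos hl, diffMap_D]
    · rw [show θ l = _ from if_neg hl, if_neg hl, diffMap_smul, diffMap_D]
      congr 1
      refine eq_inv_of_mul_eq_one_left ?_
      rw [← map_mul, Ring.inverse_mul_cancel _ (hy l hl), map_one]
  have hc : ∀ l a, β (c l a) = orbPow (β (y l)) (m l) a := by
    intro l a
    unfold orbPow
    by_cases hl : m l = 1
    · rw [show c l a = _ from if_pos hl, if_pos hl, map_one]
    · rw [show c l a = _ from if_neg hl, if_neg hl, map_pow]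
  rw [symFormsMap_smul, map_prod, map_prod]
  unfold orbGenerator
  congr 1
  · exact Finset.prod_congr rfl fun l _ ↦ hc l _
  · refine Finset.prod_congr rfl fun a _ ↦ ?_
    rw [symFormsMap_ι, formsMap_ιMulti]
    congr 2
    funext q
    exact hθ _

/-- A relation between rational forms is lifted to a form over `S` and then specialized elsewhere.
This transports membership in the span along maps `S → L` that need not be injective. -/
theorem exists_symFormsMap_eq_of_mem_span {k B S KB : Type u} [Field k] [CommRing B] [CommRing S]
    [Field KB] [Algebra k B] [Algebra k S] [Algebra k KB] (i : B →ₐ[k] S) (j : S →ₐ[k] KB)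
    {e : ℕ} (y : Fin e → B) (m : Fin e → ℕ∞)
    (hy : ∀ l, m l ≠ 1 → IsUnit (i (y l))) (n p : ℕ) {ω : SymForms k KB p}
    (hω : ω ∈ Submodule.span (j.comp i).toRingHom.range
      (Set.range (orbGenerator (k := k) (fun l ↦ j (i (y l))) m n p))) :
    ∃ G : SymForms k S p, symFormsMap p j G = ω ∧
      ∀ (L : Type u) [Field L] [Algebra k L] (β : S →ₐ[k] L),
        symFormsMap p β G ∈ Submodule.span (β.comp i).toRingHom.range
          (Set.range (orbGenerator (k := k) (fun l ↦ β (i (y l))) m n p)) := by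
  induction hω using Submodule.span_induction with
  | mem ω h =>
    obtain ⟨J, rfl⟩ := h
    obtain ⟨G, hG⟩ := exists_symFormsMap_eq_orbGenerator (k := k) (fun l ↦ i (y l)) m hy n p J
    refine ⟨G, hG KB j, fun L _ _ β ↦ ?_⟩
    rw [hG L β]
    exact Submodule.subset_span ⟨J, rfl⟩
  | zero =>
    refine ⟨0, map_zero _, fun L _ _ β ↦ ?_⟩
    rw [map_zero]
    exact zero_mem _
  | add a b _ _ ha hb =>
    obtain ⟨a', rfl, ha⟩ := ha
    obtain ⟨b', rfl, hb⟩ := hb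
    refine ⟨a' + b', map_add _ _ _, fun L _ _ β ↦ ?_⟩
    rw [map_add]
    exact add_mem (ha L β) (hb L β)
  | smul r a _ ha =>
    obtain ⟨a', rfl, ha⟩ := ha
    obtain ⟨_, r, rfl⟩ := r
    refine ⟨i r • a', symFormsMap_smul p _ _ _, fun L _ _ β ↦ ?_⟩
    rw [symFormsMap_smul]
    exact Submodule.smul_mem _ (⟨_, r, rfl⟩ : (β.comp i).toRingHom.range) (ha L β)

/-- The pullback of an orbifold form along `Aξ → L`: it may be computed through coordinates on
a formally étale extension `B` of `A`. -/
theorem symFormsMap_mem_span_orbGenerator {k A B Aξ KB L : Type u} [Field k] [CommRing A]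
    [CommRing B] [IsDomain B] [CommRing Aξ] [Field KB] [Field L] [Algebra k A] [Algebra k B]
    [Algebra k Aξ] [Algebra k KB] [Algebra k L] [Algebra A Aξ] [IsScalarTower k A Aξ]
    (N : Submonoid A) [IsLocalization N Aξ] [Algebra B KB] [IsScalarTower k B KB]
    [IsFractionRing B KB] (φ : A →ₐ[k] B) (σ : Aξ →ₐ[k] KB) (θ : Aξ →ₐ[k] L) (β : B →ₐ[k] L)
    (hσ : ∀ a, σ (algebraMap A Aξ a) = algebraMap B KB (φ a))
    (hθ : ∀ a, θ (algebraMap A Aξ a) = β (φ a))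
    {e : ℕ} {y : Fin e → B} (hy : HasEtaleCoordinates k y) (m : Fin e → ℕ∞)
    (hm : ∀ l, m l ≠ 1 → β (y l) ≠ 0) (n p : ℕ) (τ : SymForms k Aξ p)
    (hτ : symFormsMap p σ τ ∈ Submodule.span (algebraMap B KB).range
      (Set.range (logGenerator (k := k) (fun l ↦ algebraMap B KB (y l)) m n p))) :
    symFormsMap p θ τ ∈ Submodule.span (β : B →+* L).range
      (Set.range (orbGenerator (k := k) (fun l ↦ β (y l)) m n p)) := by
  obtain ⟨b, hb⟩ := hy.exists_basis
  have hne : ∀ l, y l ≠ 0 := by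
    intro l hl
    have := hb l
    rw [hl, map_zero] at this
    exact b.ne_zero l this
  have hinj : Function.Injective (algebraMap B KB) := IsFractionRing.injective B KB
  -- The localization `B_q` at the kernel of `β` maps to both `KB` and `L` and receives `Aξ`, so it
  -- compares the two pullbacks of `τ`.
  let q : Ideal B := RingHom.ker (β : B →+* L)
  have hq : q.IsPrime := RingHom.ker_isPrime _
  have hqm : ∀ s : B, s ∈ q.primeCompl ↔ β s ≠ 0 := fun s ↦ Iff.rfl
  let S := Localization.AtPrime q
  let i : B →ₐ[k] S := IsScalarTower.toAlgHom k B S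
  have hi : ∀ s : B, β s ≠ 0 → IsUnit (i s) := fun s hs ↦
    IsLocalization.map_units S (⟨s, hs⟩ : q.primeCompl)
  let βS : S →ₐ[k] L := IsLocalization.liftAlgHom (M := q.primeCompl) (f := β)
    fun s ↦ ((hqm s).1 s.2).isUnit
  have hβS : ∀ s, βS (i s) = β s := fun s ↦ IsLocalization.lift_eq _ s
  let jS : S →ₐ[k] KB := IsLocalization.liftAlgHom (M := q.primeCompl)
    (f := IsScalarTower.toAlgHom k B KB) fun s ↦ by
      rw [isUnit_iff_ne_zero]
      intro h0
      have : (s : B) = 0 := hinj (h0.trans (map_zero _).symm)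
      exact (hqm s).1 s.2 (by rw [this, map_zero])
  have hjS : ∀ s, jS (i s) = algebraMap B KB s := fun s ↦ IsLocalization.lift_eq _ s
  have hjSinj : Function.Injective jS := by
    refine (IsLocalization.lift_injective_iff (M := q.primeCompl) _).2 fun a b ↦ ?_
    refine ⟨fun h ↦ ?_, fun h ↦ ?_⟩
    · exact (hjS a).symm.trans ((congr_arg jS h).trans (hjS b))
    · exact congr_arg _ (hinj h)
  let ψ : Aξ →ₐ[k] S := IsLocalization.liftAlgHom (M := N) (f := i.comp φ) fun a ↦ by
    refine hi _ ?_
    change β (φ a) ≠ 0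
    rw [← hθ]
    exact ((IsLocalization.map_units Aξ a).map θ).ne_zero
  have hψ : ∀ a, ψ (algebraMap A Aξ a) = i (φ a) := fun a ↦ IsLocalization.lift_eq _ a
  have hψσ : jS.comp ψ = σ := by
    refine AlgHom.coe_ringHom_injective (IsLocalization.ringHom_ext N (RingHom.ext fun a ↦ ?_))
    change jS (ψ (algebraMap A Aξ a)) = σ (algebraMap A Aξ a)
    rw [hψ, hjS, hσ]
  have hψθ : βS.comp ψ = θ := by
    refine AlgHom.coe_ringHom_injective (IsLocalization.ringHom_ext N (RingHom.ext fun a ↦ ?_))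
    change βS (ψ (algebraMap A Aξ a)) = θ (algebraMap A Aξ a)
    rw [hψ, hβS, hθ]
  have hci : (jS.comp i).toRingHom = algebraMap B KB := RingHom.ext hjS
  have hcβ : (βS.comp i).toRingHom = (β : B →+* L) := RingHom.ext hβS
  have hgen : logGenerator (k := k) (fun l ↦ algebraMap B KB (y l)) m n p =
      orbGenerator (k := k) (fun l ↦ jS (i (y l))) m n p := by
    funext J
    rw [logGenerator_eq_orbGenerator _ (fun l ↦ (map_ne_zero_iff _ hinj).2 (hne l))]
    simp only [hjS]
  rw [hgen, ← hci] at hτ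
  obtain ⟨G, hG, hG'⟩ := exists_symFormsMap_eq_of_mem_span i jS y m (fun l hl ↦ hi _ (hm l hl))
    n p hτ
  obtain ⟨bS, hbS⟩ := exists_basis_of_formallyEtale i
    (RingHom.formallyEtale_algebraMap.2 (Algebra.FormallyEtale.of_isLocalization q.primeCompl)) b
  obtain ⟨bK, hbK⟩ := exists_basis_of_formallyEtale (IsScalarTower.toAlgHom k B KB)
    (RingHom.formallyEtale_algebraMap.2
      (Algebra.FormallyEtale.of_isLocalization (nonZeroDivisors B))) b
  -- Both forms have the same image over `KB`, and symmetric forms over `S` inject there.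
  have hSG : symFormsMap p ψ τ = G := by
    refine symFormsMap_injective p jS bS bK (fun l ↦ ?_) hjSinj ?_
    · rw [hbS, hbK, ← diffMap_comp,
        show jS.comp i = IsScalarTower.toAlgHom k B KB from AlgHom.ext hjS]
    · rw [hG, ← symFormsMap_comp, hψσ]
  have := hG' L βS
  rw [← hSG, ← symFormsMap_comp, hψθ, hcβ] at this
  simpa only [hβS] using this

/-- Divisibility of coefficients descends along faithfully flat extensions. -/
theorem coeffLattice_of_faithfullyFlat {O R K L σ : Type*} [CommRing O] [CommRing R] [IsDomain O]
    [Field K] [Field L] [Algebra O R] [Module.FaithfullyFlat O R] [Algebra O K] [IsFractionRing O K]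
    (jR : R →+* L) (hjR : Function.Injective jR) (κ : K →+* L)
    (hκ : ∀ a, κ (algebraMap O K a) = jR (algebraMap O R a)) {n : ℕ} {ε : (σ →₀ ℕ) → O} {P : MvPolynomial σ K}
    (h : coeffLattice jR n (fun μ ↦ jR (algebraMap O R (ε μ))) (MvPolynomial.map κ P)) :
    coeffLattice (algebraMap O K) n (fun μ ↦ algebraMap O K (ε μ)) P := by
  intro μ
  obtain ⟨h1, r, hr⟩ := h μ
  rw [MvPolynomial.coeff_map] at h1 hr
  refine ⟨fun hμ ↦ (map_eq_zero_iff κ κ.injective).1 (h1 hμ), ?_⟩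
  obtain ⟨a, s, hs, hc⟩ := IsFractionRing.div_surjective (A := O) (MvPolynomial.coeff μ P)
  have hs0 : algebraMap O K s ≠ 0 :=
    (map_ne_zero_iff _ (IsFractionRing.injective O K)).2 (nonZeroDivisors.ne_zero hs)
  have h2 : algebraMap O R a = algebraMap O R (s * ε μ) * r := by
    apply hjR
    rw [map_mul, map_mul, map_mul, ← hκ, ← hκ s]
    rw [← hc, map_div₀, div_eq_iff ((map_ne_zero κ).2 hs0)] at hr
    rw [hr]
    ring
  -- Divisibility is membership in a principal ideal, and `IR ∩ O = I` by faithful flatness.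
  have h3 : a ∈ Ideal.span {s * ε μ} := by
    rw [← Ideal.comap_map_eq_self_of_faithfullyFlat (B := R) (Ideal.span {s * ε μ}),
      Ideal.mem_comap, Ideal.map_span, Set.image_singleton, h2]
    exact Ideal.mul_mem_right _ _ (Ideal.mem_span_singleton_self _)
  obtain ⟨t, rfl⟩ := Ideal.mem_span_singleton'.1 h3
  refine ⟨t, ?_⟩
  rw [← hc, div_eq_iff hs0, map_mul, map_mul]
  ring

end Lifting

/-! ### Dominating two local rings -/

section Domination

open TensorProduct

/-- `R` is the localization of `O ⊗_A B` at a prime over the closed point of `O`; one exists because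
`B` is faithfully flat over `A`. As `R` is formally unramified and essentially of finite type over
`O`, the ideal `𝔪_O` generates `𝔪_R`. -/
theorem exists_etale_domination (k A O B : Type u) [Field k] [CommRing A] [CommRing O]
    [CommRing B] [IsLocalRing A] [IsLocalRing O] [IsLocalRing B] [IsNoetherianRing O] [Algebra k A]
    [Algebra k O] [Algebra k B] [Algebra A O] [Algebra A B] [IsScalarTower k A O]
    [IsScalarTower k A B] [IsLocalHom (algebraMap A B)]
    [Module.Flat A B] [Algebra.FormallyEtale A B] [Algebra.EssFiniteType A B] :
    ∃ (R : Type u) (_ : CommRing R) (_ : IsLocalRing R) (_ : IsNoetherianRing R) (_ : Algebra k R)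
      (_ : Algebra O R) (_ : IsScalarTower k O R) (β : B →ₐ[k] R),
      (∀ a, β (algebraMap A B a) = algebraMap O R (algebraMap A O a)) ∧
      Module.FaithfullyFlat O R ∧ Algebra.FormallyEtale O R ∧
      (IsLocalRing.maximalIdeal O).map (algebraMap O R) = IsLocalRing.maximalIdeal R := by
  have hff : Module.FaithfullyFlat A B := Module.FaithfullyFlat.of_flat_of_isLocalHom
  have hff' : Module.FaithfullyFlat O (O ⊗[A] B) := inferInstance
  obtain ⟨N, hN⟩ := PrimeSpectrum.comap_surjective_of_faithfullyFlat (A := O) (B := O ⊗[A] B)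
    (IsLocalRing.closedPoint O)
  have hN' : N.asIdeal.comap (algebraMap O (O ⊗[A] B)) = IsLocalRing.maximalIdeal O :=
    congr_arg PrimeSpectrum.asIdeal hN
  let R := Localization.AtPrime N.asIdeal
  have : Algebra.EssFiniteType O (O ⊗[A] B) := inferInstance
  have : Algebra.EssFiniteType O R := inferInstance
  have hfe : Algebra.FormallyEtale O R := inferInstance
  have hflat : Module.Flat O R := by
    have : Module.Flat (O ⊗[A] B) R := IsLocalization.flat R N.asIdeal.primeCompl
    exact Module.Flat.trans O (O ⊗[A] B) R
  have hloc : IsLocalHom (algebraMap O R) := by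
    refine ((IsLocalRing.local_hom_TFAE (algebraMap O R)).out 0 2).2 ?_
    have h1 : (IsLocalRing.maximalIdeal R).comap (algebraMap (O ⊗[A] B) R) = N.asIdeal :=
      IsLocalization.AtPrime.under_maximalIdeal R N.asIdeal
    rw [Ideal.map_le_iff_le_comap, IsScalarTower.algebraMap_eq O (O ⊗[A] B) R,
      ← Ideal.comap_comap, h1, hN']
  let β : B →ₐ[k] R := (IsScalarTower.toAlgHom k (O ⊗[A] B) R).comp
    ((Algebra.TensorProduct.includeRight : B →ₐ[A] O ⊗[A] B).restrictScalars k)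
  refine ⟨R, inferInstance, inferInstance, Algebra.EssFiniteType.isNoetherianRing O R, inferInstance,
    inferInstance, inferInstance, β, fun a ↦ ?_, Module.FaithfullyFlat.of_flat_of_isLocalHom,
    hfe, Algebra.FormallyUnramified.map_maximalIdeal⟩
  change algebraMap (O ⊗[A] B) R (1 ⊗ₜ algebraMap A B a) = _
  rw [IsScalarTower.algebraMap_apply O (O ⊗[A] B) R, Algebra.TensorProduct.algebraMap_apply,
    ← Algebra.TensorProduct.tmul_one_eq_one_tmul]
  rfl

end Domination

/-! ### The local form of the pullback theorem -/

section LocalPullback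

open KaehlerDifferential

lemma exists_log_basis {k K : Type u} [Field k] [Field K] [Algebra k K] {d : ℕ} {x : Fin d → K}
    (b : Module.Basis (Fin d) K (Ω[K⁄k])) (hb : ∀ i, b i = D k K (x i)) (hx : ∀ i, x i ≠ 0) :
    ∃ ε : Module.Basis (Fin d) K (Ω[K⁄k]), ∀ i, ε i = (x i)⁻¹ • D k K (x i) :=
  ⟨b.isUnitSMul fun i ↦ (inv_ne_zero (hx i)).isUnit, fun i ↦ by
    rw [Module.Basis.isUnitSMul_apply, hb]⟩

lemma HasEtaleCoordinates.ne_zero {k B : Type u} [CommRing k] [CommRing B] [Algebra k B]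
    [Nontrivial B] {d : ℕ} {x : Fin d → B} (h : HasEtaleCoordinates k x) (i : Fin d) :
    x i ≠ 0 := by
  obtain ⟨b, hb⟩ := h.exists_basis
  intro hi
  have := hb i
  rw [hi, map_zero] at this
  exact b.ne_zero i this

theorem coeffLattice_of_mem_span {k R L : Type u} [Field k] [CommRing R] [Field L] [Algebra k R]
    [Algebra k L] (j : R →ₐ[k] L) {d n p : ℕ} (ε : Module.Basis (Fin d) L (Ω[L⁄k]))
    {e : ((Fin p ↪o Fin d) →₀ ℕ) → L} {S : Subring L} (hS : S ≤ (j : R →+* L).range)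
    {s : Set (SymForms k L p)} (hs : ∀ G ∈ s, coeffLattice (j : R →+* L) n e (symCoord ε p G))
    {v : SymForms k L p} (hv : v ∈ Submodule.span S s) :
    coeffLattice (j : R →+* L) n e (symCoord ε p v) := by
  induction hv using Submodule.span_induction with
  | mem v hv => exact hs v hv
  | zero =>
    rw [map_zero]
    exact coeffLattice.zero
  | add a b _ _ ha hb =>
    rw [map_add]
    exact coeffLattice.add ha hb
  | smul r a _ ha =>
    obtain ⟨r', hr'⟩ := hS r.2
    have h1 : symCoord ε p (r • a) = MvPolynomial.C (r : L) * symCoord ε p a := by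
      rw [← MvPolynomial.smul_eq_C_mul, ← map_smul]
      rfl
    rw [h1]
    refine coeffLattice.C_mul _ ha fun μ _ ↦ ⟨r', ?_⟩
    rw [hr']

/-- The form is expressed through the coordinates of `B`, pulled back to `Frac R`, where
`coeffLattice_orbGenerator` applies, and the divisibility is brought back from `R` to `O`. -/
theorem coeffLattice_pullback_aux {k A O B R K Aξ KB : Type u} [Field k] [CommRing A] [CommRing O]
    [CommRing B] [IsDomain B] [IsDomain O] [CommRing R] [IsDomain R] [Field K] [CommRing Aξ]
    [Field KB] [Algebra k A]
    [Algebra k O] [Algebra k B] [Algebra k R] [Algebra k K] [Algebra k Aξ] [Algebra k KB]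
    [Algebra A O] [Algebra A B] [Algebra A Aξ] [Algebra O R] [Algebra O K] [Algebra B KB]
    [IsScalarTower k A O] [IsScalarTower k A B] [IsScalarTower k A Aξ] [IsScalarTower k O R]
    [IsScalarTower k O K] [IsScalarTower k B KB] [IsFractionRing O K] [IsFractionRing B KB]
    (N : Submonoid A) [IsLocalization N Aξ] [Module.FaithfullyFlat O R] [Algebra.FormallyEtale O R]
    (σ : Aξ →ₐ[k] KB) (θ : Aξ →ₐ[k] K) (β : B →ₐ[k] R)
    (hσ : ∀ a, σ (algebraMap A Aξ a) = algebraMap B KB (algebraMap A B a))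
    (hθ : ∀ a, θ (algebraMap A Aξ a) = algebraMap O K (algebraMap A O a))
    (hβ : ∀ a, β (algebraMap A B a) = algebraMap O R (algebraMap A O a))
    {d : ℕ} {x : Fin d → O} (hx : HasEtaleCoordinates k x)
    (ε : Module.Basis (Fin d) K (Ω[K⁄k]))
    (hε : ∀ i, ε i = (algebraMap O K (x i))⁻¹ • D k K (algebraMap O K (x i)))
    {e : ℕ} {y : Fin e → B} (hy : HasEtaleCoordinates k y) {ϖ : O} (hϖ0 : ϖ ≠ 0)
    (m : ℕ∞) (hm : 1 ≤ m) (mW : Fin d → ℕ∞)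
    (hcase : (∃ i₀, x i₀ = ϖ ∧ (∀ i, i ≠ i₀ → IsUnit (x i)) ∧ m ≤ mW i₀) ∨
      ((∀ i, IsUnit (x i)) ∧ m = 1)) (m' : Fin e → ℕ∞) (hm' : ∀ l, 1 ≤ m' l)
    (ht : ∀ l, m' l ≠ 1 → ∃ (t : ℕ) (u : Rˣ), β (y l) = algebraMap O R ϖ ^ t * u ∧
      (t ≠ 0 → m' l ≤ t * m)) (n p : ℕ) (τ : SymForms k Aξ p)
    (hτ : symFormsMap p σ τ ∈ Submodule.span (algebraMap B KB).range
      (Set.range (logGenerator (k := k) (fun l ↦ algebraMap B KB (y l)) m' n p))) :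
    coeffLattice (algebraMap O K) n
      (fun μ ↦ algebraMap O K (∏ i, x i ^ Orbifold.Chart.ceilQuot (occ i μ) (mW i)))
      (symCoord ε p (symFormsMap p θ τ)) := by
  let L := FractionRing R
  let j : R →ₐ[k] L := IsScalarTower.toAlgHom k R L
  have hj : Function.Injective j := IsFractionRing.injective R L
  have hOR : Function.Injective (algebraMap O R) := FaithfulSMul.algebraMap_injective O R
  let κ : K →ₐ[k] L := IsLocalization.liftAlgHom (M := nonZeroDivisors O)
    (f := j.comp (IsScalarTower.toAlgHom k O R)) fun s ↦ by
      rw [isUnit_iff_ne_zero]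
      exact (map_ne_zero_iff _ hj).2 ((map_ne_zero_iff _ hOR).2 (nonZeroDivisors.ne_zero s.2))
  have hκ : ∀ a, κ (algebraMap O K a) = j (algebraMap O R a) := fun a ↦ IsLocalization.lift_eq _ a
  have hmem := symFormsMap_mem_span_orbGenerator N (IsScalarTower.toAlgHom k A B) σ (κ.comp θ)
    (j.comp β) hσ (fun a ↦ by
      rw [AlgHom.comp_apply, hθ, hκ, AlgHom.comp_apply, ← hβ]
      rfl) hy m'
    (fun l hl ↦ by
      obtain ⟨t, u, h, -⟩ := ht l hl
      rw [AlgHom.comp_apply, map_ne_zero_iff _ hj, h]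
      exact mul_ne_zero (pow_ne_zero _ ((map_ne_zero_iff _ hOR).2 hϖ0)) u.ne_zero) n p τ hτ
  obtain ⟨bO, hbO⟩ := hx.exists_basis
  obtain ⟨bR, hbR⟩ := exists_basis_of_formallyEtale (IsScalarTower.toAlgHom k O R)
    (RingHom.formallyEtale_algebraMap.2 inferInstance) bO
  obtain ⟨bL, hbL⟩ := exists_basis_of_formallyEtale j (RingHom.formallyEtale_algebraMap.2
      (Algebra.FormallyEtale.of_isLocalization (nonZeroDivisors R))) bR
  have hbR' : ∀ i, bR i = D k R (algebraMap O R (x i)) := fun i ↦ by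
    rw [hbR, hbO, diffMap_D]
    rfl
  have hx0 : ∀ i, j (algebraMap O R (x i)) ≠ 0 := fun i ↦
    (map_ne_zero_iff _ hj).2 ((map_ne_zero_iff _ hOR).2 (hx.ne_zero i))
  obtain ⟨εL, hεL⟩ := exists_log_basis (x := fun i ↦ j (algebraMap O R (x i))) bL
    (fun i ↦ by rw [hbL, hbR', diffMap_D]) hx0
  have hεL' : ∀ i, εL i = diffMap κ (ε i) := fun i ↦ by
    rw [hεL, hε, diffMap_smul, diffMap_D, map_inv₀, hκ]
  have hjϖ : j (algebraMap O R ϖ) ≠ 0 :=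
    (map_ne_zero_iff _ hj).2 ((map_ne_zero_iff _ hOR).2 hϖ0)
  have hdec : ∀ l, ∃ (t : ℕ) (u : Rˣ), m' l ≠ 1 → β (y l) = algebraMap O R ϖ ^ t * u ∧
      (t ≠ 0 → m' l ≤ t * m) := fun l ↦ by
    by_cases hl : m' l = 1
    -- Dummy values: a coordinate of multiplicity `1` may even vanish in `R`, and no factorization
    -- of it is used.
    · exact ⟨0, 1, fun h ↦ (h hl).elim⟩
    · obtain ⟨t, u, h⟩ := ht l hl
      exact ⟨t, u, fun _ ↦ h⟩
  choose t u htu using hdec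
  have hgen : ∀ G ∈ Set.range (orbGenerator (k := k) (fun l ↦ j.comp β (y l)) m' n p),
      coeffLattice (j : R →+* L) n (fun μ ↦ ∏ i, j (algebraMap O R (x i)) ^
        Orbifold.Chart.ceilQuot (occ i μ) (mW i)) (symCoord εL p G) := by
    rintro _ ⟨J, rfl⟩
    refine coeffLattice_orbGenerator j (x := fun i ↦ algebraMap O R (x i)) bR hbR' hx0 εL hεL hjϖ
      m hm mW ?_ (fun l ↦ β (y l)) m' hm' t u (fun l hl ↦ (htu l hl).1)
      (fun l hl ↦ (htu l hl).2) n p J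
    rcases hcase with ⟨i₀, h1, h2, h3⟩ | ⟨h1, h2⟩
    · exact Or.inl ⟨i₀, by rw [h1], fun i hi ↦ (h2 i hi).map _, h3⟩
    · exact Or.inr ⟨fun i ↦ (h1 i).map _, h2⟩
  have hL := coeffLattice_of_mem_span j εL (S := ((j.comp β : B →ₐ[k] L) : B →+* L).range)
    (by rintro _ ⟨b, rfl⟩; exact ⟨β b, rfl⟩) hgen hmem
  refine coeffLattice_of_faithfullyFlat (R := R) (j : R →+* L) hj (κ : K →+* L) hκ ?_
  have h1 := symCoord_symFormsMap p κ ε εL hεL' (symFormsMap p θ τ)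
  rw [← symFormsMap_comp] at h1
  rw [h1] at hL
  simp only [map_prod, map_pow]
  exact hL

/-- If `x_i = c x_{i₀}`, then `dx_i = c dx_{i₀} + x_{i₀} dc`; comparing coefficients of `dx_i` makes
`x_{i₀}` a unit. -/
theorem HasEtaleCoordinates.isUnit_of_ne {k O : Type u} [Field k] [CommRing O] [Algebra k O]
    [IsLocalRing O] {d : ℕ} {x : Fin d → O} (hx : HasEtaleCoordinates k x) {i₀ i : Fin d}
    (hi₀ : IsLocalRing.maximalIdeal O = Ideal.span {x i₀}) (hi : i ≠ i₀) : IsUnit (x i) := by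
  by_contra h
  obtain ⟨b, hb⟩ := hx.exists_basis
  have h1 : x i ∈ Ideal.span {x i₀} := hi₀ ▸ h
  obtain ⟨c, hc⟩ := Ideal.mem_span_singleton'.1 h1
  have h2 := congr_arg (fun z ↦ b.repr z i) (hb i)
  simp only [← hc, Derivation.leibniz, ← hb, map_add, map_smul, Module.Basis.repr_self,
    Finsupp.add_apply, Finsupp.smul_apply, Finsupp.single_eq_same, smul_eq_mul] at h2
  rw [Finsupp.single_eq_of_ne hi, mul_zero, zero_add] at h2
  have h3 : x i₀ ∈ IsLocalRing.maximalIdeal O := hi₀ ▸ Ideal.mem_span_singleton_self _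
  exact h3 (IsUnit.of_mul_eq_one _ h2.symm)

/-- `X` is the local ring on the orbifold, where the coefficient of `f^* E` is measured, and `O` the
one on the chart. Either a coordinate vanishes along the divisor, and then it is a uniformizer and
the other coordinates are units, or none does and `m = 1`. An ideal `I` with `IB = (y_l)` satisfies
`IR = (ϖ^t)`, so `X / IX` has length at most `t`. -/
theorem coeffLattice_pullback_of_dvr {k A X O B K Aξ KB : Type u} [Field k] [CommRing A] [CommRing X]
    [CommRing O] [CommRing B] [IsLocalRing A] [IsLocalRing X] [IsDomain X]
    [IsDomain O] [IsDiscreteValuationRing O] [IsLocalRing B]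
    [Field K] [CommRing Aξ]
    [Field KB] [Algebra k A] [Algebra k O] [Algebra k B] [Algebra k K] [Algebra k Aξ] [Algebra k KB]
    [Algebra A O] [Algebra A X] [Algebra X O] [IsScalarTower A X O] [Algebra A B] [Algebra A Aξ]
    [Algebra O K] [Algebra B KB]
    [IsScalarTower k A O] [IsScalarTower k A B] [IsScalarTower k A Aξ]
    [IsScalarTower k O K] [IsScalarTower k B KB] [IsFractionRing O K] [IsFractionRing B KB]
    [Module.FaithfullyFlat X O]
    (hXO : (IsLocalRing.maximalIdeal X).map (algebraMap X O) = IsLocalRing.maximalIdeal O)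
    [IsLocalHom (algebraMap A B)] [Module.Flat A B] [Algebra.FormallyEtale A B]
    [Algebra.EssFiniteType A B]
    (N : Submonoid A) [IsLocalization N Aξ] (σ : Aξ →ₐ[k] KB) (θ : Aξ →ₐ[k] K)
    (hσ : ∀ a, σ (algebraMap A Aξ a) = algebraMap B KB (algebraMap A B a))
    (hθ : ∀ a, θ (algebraMap A Aξ a) = algebraMap O K (algebraMap A O a))
    {d : ℕ} {x : Fin d → O} (hx : HasEtaleCoordinates k x)
    (ε : Module.Basis (Fin d) K (Ω[K⁄k]))
    (hε : ∀ i, ε i = (algebraMap O K (x i))⁻¹ • D k K (algebraMap O K (x i)))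
    {e : ℕ} {y : Fin e → B} (hy : HasEtaleCoordinates k y)
    (m : ℕ∞) (hm : 1 ≤ m) (mW : Fin d → ℕ∞)
    (hcase : ∀ i, ¬ IsUnit (x i) → m ≤ mW i)
    (hcase' : (∀ i, IsUnit (x i)) → m = 1) (m' : Fin e → ℕ∞) (hm' : ∀ l, 1 ≤ m' l)
    (hy0 : ∀ l, m' l ≠ 1 →
      ∃ I : Ideal A, I.map (algebraMap A B) = Ideal.span {y l} ∧ I.map (algebraMap A O) ≠ ⊥)
    (ht : ∀ l, m' l ≠ 1 → ∀ t : ℕ, t ≠ 0 → (∀ I : Ideal A,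
      I.map (algebraMap A B) = Ideal.span {y l} → Module.length X (X ⧸ I.map (algebraMap A X)) ≤ t) →
      m' l ≤ t * m) (n p : ℕ) (τ : SymForms k Aξ p)
    (hτ : symFormsMap p σ τ ∈ Submodule.span (algebraMap B KB).range
      (Set.range (logGenerator (k := k) (fun l ↦ algebraMap B KB (y l)) m' n p))) :
    coeffLattice (algebraMap O K) n
      (fun μ ↦ algebraMap O K (∏ i, x i ^ Orbifold.Chart.ceilQuot (occ i μ) (mW i)))
      (symCoord ε p (symFormsMap p θ τ)) := by
  have hB := hy.isDomain_and_isIntegrallyClosed.1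
  obtain ⟨R, _, _, _, _, _, _, β, hβ, _, _, hmR⟩ := exists_etale_domination k A O B
  have hϖ : ∃ ϖ : O, IsLocalRing.maximalIdeal O = Ideal.span {ϖ} ∧
      ((∃ i₀, x i₀ = ϖ ∧ (∀ i, i ≠ i₀ → IsUnit (x i)) ∧ m ≤ mW i₀) ∨
      ((∀ i, IsUnit (x i)) ∧ m = 1)) := by
    by_cases hu : ∀ i, IsUnit (x i)
    · obtain ⟨ϖ, hϖ⟩ := IsDiscreteValuationRing.exists_irreducible O
      exact ⟨ϖ, hϖ.maximalIdeal_eq, Or.inr ⟨hu, hcase' hu⟩⟩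
    · push Not at hu
      obtain ⟨i₀, hi₀⟩ := hu
      have h1 := hx.isPrime_span_singleton i₀ hi₀
      have h2 : IsLocalRing.maximalIdeal O = Ideal.span {x i₀} := by
        refine (IsLocalRing.eq_maximalIdeal ?_).symm
        refine Ring.DimensionLEOne.maximalOfPrime ?_ h1
        rw [Ne, Ideal.span_singleton_eq_bot]
        exact hx.ne_zero i₀
      exact ⟨x i₀, h2, Or.inl ⟨i₀, rfl, fun i hi ↦ hx.isUnit_of_ne h2 hi,
        hcase i₀ hi₀⟩⟩
  obtain ⟨ϖ, hϖ, hcases⟩ := hϖ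
  have hϖ0 : ϖ ≠ 0 := by
    rintro rfl
    exact IsDiscreteValuationRing.not_a_field O (hϖ.trans (Ideal.span_singleton_eq_bot.2 rfl))
  have hOR : Function.Injective (algebraMap O R) := FaithfulSMul.algebraMap_injective O R
  have hmR' : IsLocalRing.maximalIdeal R = Ideal.span {algebraMap O R ϖ} := by
    rw [← hmR, hϖ, Ideal.map_span, Set.image_singleton]
  -- `R` is not yet known to be a domain; flatness over `O` makes `ϖ` regular, and this gives both
  -- integrality and the factorization `ϖ^t u`.
  have hreg : algebraMap O R ϖ ∈ nonZeroDivisors R := by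
    have h1 : IsSMulRegular R ϖ := Module.Flat.isSMulRegular_of_nonZeroDivisors
      (mem_nonZeroDivisors_of_ne_zero hϖ0)
    refine mem_nonZeroDivisors_iff_right.2 fun r hr ↦ ?_
    refine h1.right_eq_zero_of_smul ?_
    rw [Algebra.smul_def, mul_comm, hr]
  obtain ⟨_, hdec⟩ := isDomain_and_eq_pow_mul_unit hreg hmR'
  let _ : Algebra X R := ((algebraMap O R).comp (algebraMap X O)).toAlgebra
  have : IsScalarTower X O R := IsScalarTower.of_algebraMap_eq' rfl
  have : Module.FaithfullyFlat X R := Module.FaithfullyFlat.trans X O R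
  have hmX : (IsLocalRing.maximalIdeal X).map (algebraMap X R) = IsLocalRing.maximalIdeal R := by
    rw [IsScalarTower.algebraMap_eq X O R, ← Ideal.map_map, hXO, hmR]
  have hmap : ∀ I : Ideal A, (I.map (algebraMap A O)).map (algebraMap O R) =
      (I.map (algebraMap A B)).map β := fun I ↦ by
    rw [Ideal.map_map]
    refine Eq.trans ?_ (Ideal.map_map (algebraMap A B) (β : B →+* R)).symm
    congr 1
    exact RingHom.ext fun a ↦ (hβ a).symm
  refine coeffLattice_pullback_aux N σ θ β hσ hθ hβ hx ε hε hy hϖ0 m hm mW hcases m' hm'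
    (fun l hl ↦ ?_) n p τ hτ
  have hyl : β (y l) ≠ 0 := by
    intro h0
    obtain ⟨I, hI, hI0⟩ := hy0 l hl
    have h1 := hmap I
    rw [hI, Ideal.map_span, Set.image_singleton, h0, Ideal.span_singleton_eq_bot.2 rfl] at h1
    exact hI0 ((Ideal.map_eq_bot_iff_of_injective hOR).1 h1)
  obtain ⟨t, u, htu⟩ := hdec _ hyl
  refine ⟨t, u, htu, fun h0 ↦ ht l hl t h0 fun I hI ↦ ?_⟩
  refine length_quotient_le (R := R) (nonZeroDivisors.ne_zero hreg) hmR' hmX _ t ?_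
  have h1 : (I.map (algebraMap A X)).map (algebraMap X R) = Ideal.span {β (y l)} := by
    rw [IsScalarTower.algebraMap_eq X O R, ← Ideal.map_map, Ideal.map_map (algebraMap A X),
      ← IsScalarTower.algebraMap_eq, hmap, hI, Ideal.map_span, Set.image_singleton]
  rw [h1, htu]
  exact Ideal.mem_span_singleton'.2 ⟨(u⁻¹ : Rˣ), by rw [mul_comm, mul_assoc, Units.mul_inv, mul_one]⟩

/-- Homogeneity of degree `n` is checked at the generic point, since a variety may have no point of
codimension one. The uniformizer is replaced by `1` and all exponents by `0`, so the inequalities on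
multiplicities are void. -/
theorem coeffLattice_pullback_of_field {k A K B Aξ KB : Type u} [Field k] [CommRing A] [Field K]
    [CommRing B] [IsLocalRing A] [IsLocalRing B] [CommRing Aξ]
    [Field KB] [Algebra k A] [Algebra k K] [Algebra k B] [Algebra k Aξ] [Algebra k KB]
    [Algebra A K] [Algebra A B] [Algebra A Aξ] [Algebra B KB]
    [IsScalarTower k A K] [IsScalarTower k A B] [IsScalarTower k A Aξ]
    [IsScalarTower k B KB] [IsFractionRing B KB]
    [IsLocalHom (algebraMap A B)] [Module.Flat A B] [Algebra.FormallyEtale A B]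
    [Algebra.EssFiniteType A B]
    (N : Submonoid A) [IsLocalization N Aξ] (σ : Aξ →ₐ[k] KB) (θ : Aξ →ₐ[k] K)
    (hσ : ∀ a, σ (algebraMap A Aξ a) = algebraMap B KB (algebraMap A B a))
    (hθ : ∀ a, θ (algebraMap A Aξ a) = algebraMap A K a)
    {d : ℕ} {x : Fin d → K} (hx : HasEtaleCoordinates k x)
    (ε : Module.Basis (Fin d) K (Ω[K⁄k])) (hε : ∀ i, ε i = (x i)⁻¹ • D k K (x i))
    {e : ℕ} {y : Fin e → B} (hy : HasEtaleCoordinates k y) (m' : Fin e → ℕ∞) (hm' : ∀ l, 1 ≤ m' l)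
    (hy0 : ∀ l, m' l ≠ 1 →
      ∃ I : Ideal A, I.map (algebraMap A B) = Ideal.span {y l} ∧ I.map (algebraMap A K) ≠ ⊥)
    (n p : ℕ) (τ : SymForms k Aξ p)
    (hτ : symFormsMap p σ τ ∈ Submodule.span (algebraMap B KB).range
      (Set.range (logGenerator (k := k) (fun l ↦ algebraMap B KB (y l)) m' n p)))
    (μ : (Fin p ↪o Fin d) →₀ ℕ) (hμ : μ.degree ≠ n) :
    (symCoord ε p (symFormsMap p θ τ)).coeff μ = 0 := by
  have hB := hy.isDomain_and_isIntegrallyClosed.1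
  obtain ⟨R, _, _, _, _, _, _, β, hβ, _, _, hmR⟩ := exists_etale_domination k A K B
  have hR : ∀ r : R, r ≠ 0 → IsUnit r := by
    have hF : IsField R := by
      rw [IsLocalRing.isField_iff_maximalIdeal_eq, ← hmR,
        IsLocalRing.isField_iff_maximalIdeal_eq.1 (Field.toIsField K), Ideal.map_bot]
    intro r hr
    obtain ⟨s, hs⟩ := hF.mul_inv_cancel hr
    exact IsUnit.of_mul_eq_one s hs
  have : IsDomain R := by
    have : NoZeroDivisors R := ⟨fun {a b} hab ↦ by
      by_contra! h
      exact ((hR a h.1).mul (hR b h.2)).ne_zero hab⟩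
    exact NoZeroDivisors.to_isDomain R
  have hOR : Function.Injective (algebraMap K R) := FaithfulSMul.algebraMap_injective K R
  have hxu : ∀ i, IsUnit (x i) := fun i ↦ (hx.ne_zero i).isUnit
  refine (coeffLattice_pullback_aux (O := K) N σ θ β hσ hθ hβ hx ε hε hy (one_ne_zero) 1 le_rfl 1
    (Or.inr ⟨hxu, rfl⟩) m' hm' (fun l hl ↦ ?_) n p τ hτ μ).1 hμ
  have hyl : β (y l) ≠ 0 := by
    intro h0
    obtain ⟨I, hI, hI0⟩ := hy0 l hl
    have h1 : (I.map (algebraMap A K)).map (algebraMap K R) = (I.map (algebraMap A B)).map β := by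
      rw [Ideal.map_map]
      refine Eq.trans ?_ (Ideal.map_map (algebraMap A B) (β : B →+* R)).symm
      congr 1
      exact RingHom.ext fun a ↦ (hβ a).symm
    rw [hI, Ideal.map_span, Set.image_singleton, h0, Ideal.span_singleton_eq_bot.2 rfl] at h1
    exact hI0 ((Ideal.map_eq_bot_iff_of_injective hOR).1 h1)
  exact ⟨0, (hR _ hyl).unit, by simp, fun h ↦ (h rfl).elim⟩

end LocalPullback

/-! ### Local rings of schemes -/

section LocalRings

theorem formallyEtale_stalkMap {X Y : Scheme.{u}} (f : X ⟶ Y) [Etale f] (x : X) :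
    (f.stalkMap x).hom.FormallyEtale := by
  have h1 : (f.stalkMap x).hom.FormallyUnramified := FormallyUnramified.stalkMap f x
  have h2 : (f.stalkMap x).hom.FormallySmooth := by
    rw [← Scheme.Hom.mem_smoothLocus, Scheme.Hom.smoothLocus_eq_top]
    trivial
  algebraize [(f.stalkMap x).hom]
  exact RingHom.formallyEtale_algebraMap.2
    (Algebra.FormallyEtale.of_formallyUnramified_and_formallySmooth)

/-- The map `𝒪_{Y,y} → 𝒪_{X,x}` for a point `y` equal to `f(x)`. -/
def stalkMapAt (k : Type u) [Field k] {X Y : Scheme.{u}} [X.Over (Spec (.of k))]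
    [Y.Over (Spec (.of k))] (f : X ⟶ Y) [f.IsOver (Spec (.of k))] {x : X} {y : Y} (h : f x = y) :
    Y.presheaf.stalk y →ₐ[k] X.presheaf.stalk x :=
  (stalkMapAlgHom k f x).comp (stalkSpecAlgHom k Y (specializes_of_eq h))

theorem stalkMapAt_etale (k : Type u) [Field k] {X Y : Scheme.{u}} [X.Over (Spec (.of k))]
    [Y.Over (Spec (.of k))] (f : X ⟶ Y) [f.IsOver (Spec (.of k))] [Etale f] {x : X} {y : Y}
    (h : f x = y) : (stalkMapAt k f h).toRingHom.Flat ∧ (stalkMapAt k f h).toRingHom.FormallyEtale ∧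
      (stalkMapAt k f h).toRingHom.EssFiniteType ∧ IsLocalHom (stalkMapAt k f h).toRingHom := by
  subst h
  have : (stalkMapAt k f (rfl : f x = f x)).toRingHom = (f.stalkMap x).hom := by
    change (Y.presheaf.stalkSpecializes (specializes_of_eq rfl) ≫ f.stalkMap x).hom = _
    rw [TopCat.Presheaf.stalkSpecializes_refl, Category.id_comp]
  rw [this]
  exact ⟨Flat.stalkMap f x, formallyEtale_stalkMap f x, LocallyOfFiniteType.stalkMap f x,
    inferInstance⟩

theorem exists_isLocalization_stalkSpecializes {X : Scheme.{u}} {x y : X} (h : x ⤳ y) :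
    letI := (X.presheaf.stalkSpecializes h).hom.toAlgebra
    ∃ N : Submonoid (X.presheaf.stalk y), IsLocalization N (X.presheaf.stalk x) := by
  let _ := (X.presheaf.stalkSpecializes h).hom.toAlgebra
  obtain ⟨_, ⟨U, hU, rfl⟩, hyU, -⟩ :=
    X.isBasis_affineOpens.exists_subset_of_mem_open (Set.mem_univ y) isOpen_univ
  have hxU : x ∈ U := h.mem_open U.2 hyU
  let _ : Algebra Γ(X, U) (X.presheaf.stalk x) :=
    TopCat.Presheaf.algebra_section_stalk X.presheaf ⟨x, hxU⟩
  let _ : Algebra Γ(X, U) (X.presheaf.stalk y) :=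
    TopCat.Presheaf.algebra_section_stalk X.presheaf ⟨y, hyU⟩
  have h1 := hU.isLocalization_stalk ⟨x, hxU⟩
  have h2 := hU.isLocalization_stalk ⟨y, hyU⟩
  have : IsScalarTower Γ(X, U) (X.presheaf.stalk y) (X.presheaf.stalk x) :=
    IsScalarTower.of_algebraMap_eq' <| by
      change (X.presheaf.germ U x hxU).hom =
        (X.presheaf.germ U y hyU ≫ X.presheaf.stalkSpecializes h).hom
      rw [TopCat.Presheaf.germ_stalkSpecializes]
  refine ⟨_, IsLocalization.isLocalization_of_submonoid_le (X.presheaf.stalk y)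
    (X.presheaf.stalk x) (hU.primeIdealOf ⟨y, hyU⟩).asIdeal.primeCompl
    (hU.primeIdealOf ⟨x, hxU⟩).asIdeal.primeCompl fun s hs ↦ ?_⟩
  have h3 : IsUnit (algebraMap Γ(X, U) (X.presheaf.stalk y) s) :=
    IsLocalization.map_units (X.presheaf.stalk y)
      (⟨s, hs⟩ : (hU.primeIdealOf ⟨y, hyU⟩).asIdeal.primeCompl)
  have h4 := h3.map (algebraMap (X.presheaf.stalk y) (X.presheaf.stalk x))
  rw [← IsScalarTower.algebraMap_apply] at h4
  exact (IsLocalization.AtPrime.isUnit_to_map_iff _ (hU.primeIdealOf ⟨x, hxU⟩).asIdeal s).1 h4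

/-- The prime ideal of `𝒪_{X,y}` of a generization `x` of `y`. -/
def generizationIdeal {X : Scheme.{u}} {x y : X} (h : x ⤳ y) : Ideal (X.presheaf.stalk y) :=
  (IsLocalRing.maximalIdeal (X.presheaf.stalk x)).comap (X.presheaf.stalkSpecializes h).hom

instance {X : Scheme.{u}} {x y : X} (h : x ⤳ y) : (generizationIdeal h).IsPrime :=
  Ideal.comap_isPrime _ _

lemma fromSpecStalk_generizationIdeal {X : Scheme.{u}} {x y : X} (h : x ⤳ y) :
    X.fromSpecStalk y ⟨generizationIdeal h, inferInstance⟩ = x := by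
  have := Scheme.fromSpecStalk_closedPoint (x := x)
  rw [← Scheme.SpecMap_stalkSpecializes_fromSpecStalk h] at this
  exact this

theorem specializes_of_generizationIdeal_le {X : Scheme.{u}} {x x' y : X} (h : x ⤳ y) (h' : x' ⤳ y)
    (hle : generizationIdeal h ≤ generizationIdeal h') : x ⤳ x' := by
  rw [← fromSpecStalk_generizationIdeal h, ← fromSpecStalk_generizationIdeal h']
  exact Specializes.map ((PrimeSpectrum.le_iff_specializes _ _).1 hle)
    (X.fromSpecStalk y).continuous

/-- `Spec 𝒪_{X,y} → X` is an embedding onto the generizations of `y`. The height one primes in the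
normality argument thus become points of the chart. -/
theorem exists_generizationIdeal_eq {X : Scheme.{u}} {y : X} (P : Ideal (X.presheaf.stalk y))
    [hP : P.IsPrime] : ∃ (x : X) (h : x ⤳ y), generizationIdeal h = P := by
  have h : X.fromSpecStalk y ⟨P, hP⟩ ⤳ y := by
    have : X.fromSpecStalk y ⟨P, hP⟩ ∈ Set.range (X.fromSpecStalk y) := ⟨_, rfl⟩
    rwa [Scheme.range_fromSpecStalk] at this
  refine ⟨_, h, ?_⟩
  have h1 := fromSpecStalk_generizationIdeal h
  exact congr_arg PrimeSpectrum.asIdeal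
    ((IsPreimmersion.isEmbedding (X.fromSpecStalk y)).injective h1)

theorem isLocalization_generizationIdeal {X : Scheme.{u}} {x y : X} (h : x ⤳ y) :
    letI := (X.presheaf.stalkSpecializes h).hom.toAlgebra
    IsLocalization.AtPrime (X.presheaf.stalk x) (generizationIdeal h) := by
  let _ := (X.presheaf.stalkSpecializes h).hom.toAlgebra
  obtain ⟨N, hN⟩ := exists_isLocalization_stalkSpecializes h
  refine IsLocalization.of_le N _ (fun s hs hs' ↦ hs' ?_) fun s hs ↦ ?_
  · exact IsLocalization.map_units (X.presheaf.stalk x) (⟨s, hs⟩ : N)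
  · exact not_not.1 hs

theorem isDiscreteValuationRing_of_coheight_eq_one {X : Scheme.{u}} {x : X}
    [IsDomain (X.presheaf.stalk x)] [IsNoetherianRing (X.presheaf.stalk x)]
    [IsIntegrallyClosed (X.presheaf.stalk x)] (h : Order.coheight x = 1) :
    IsDiscreteValuationRing (X.presheaf.stalk x) := by
  have h1 := ringKrullDim_stalk_eq_coheight x
  rw [h] at h1
  have h2 : ¬ IsField (X.presheaf.stalk x) := by
    intro hf
    rw [ringKrullDim_eq_zero_of_isField hf] at h1
    exact zero_ne_one (α := ℕ) (by exact_mod_cast h1)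
  have h3 := ((IsDiscreteValuationRing.TFAE (X.presheaf.stalk x) h2).out 0 2)
  rw [h3]
  have : Ring.KrullDimLE 1 (X.presheaf.stalk x) := by
    rw [Ring.krullDimLE_iff, h1]
    rfl
  have : Ring.DimensionLEOne (X.presheaf.stalk x) :=
    ⟨fun {P} hP hP' ↦ Ring.krullDimLE_one_iff_of_noZeroDivisors.1 this P hP hP'⟩
  exact { }

theorem coheight_eq_one_of_isDiscreteValuationRing {X : Scheme.{u}} {x : X}
    [IsDomain (X.presheaf.stalk x)] [IsDiscreteValuationRing (X.presheaf.stalk x)] :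
    Order.coheight x = 1 := by
  have h1 := ringKrullDim_stalk_eq_coheight x
  rw [IsDiscreteValuationRing.ringKrullDim_eq_one] at h1
  exact_mod_cast h1.symm

/-- A uniformizer descends along the faithfully flat unramified map of local rings, so the local
ring at `f(x)` is a discrete valuation ring too. -/
theorem coheight_apply_eq_one_of_etale {X Y : Scheme.{u}} (f : X ⟶ Y) [Etale f] (x : X)
    [IsDomain (X.presheaf.stalk x)] [IsDiscreteValuationRing (X.presheaf.stalk x)]
    [IsDomain (Y.presheaf.stalk (f x))] [IsNoetherianRing (Y.presheaf.stalk (f x))] :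
    Order.coheight (f x) = 1 := by
  let _ := (f.stalkMap x).hom.toAlgebra
  have : Module.Flat (Y.presheaf.stalk (f x)) (X.presheaf.stalk x) := Flat.stalkMap f x
  have : Algebra.FormallyEtale (Y.presheaf.stalk (f x)) (X.presheaf.stalk x) :=
    formallyEtale_stalkMap f x
  have : Algebra.EssFiniteType (Y.presheaf.stalk (f x)) (X.presheaf.stalk x) :=
    LocallyOfFiniteType.stalkMap f x
  have : IsLocalHom (algebraMap (Y.presheaf.stalk (f x)) (X.presheaf.stalk x)) :=
    inferInstanceAs (IsLocalHom (f.stalkMap x).hom)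
  have : Module.FaithfullyFlat (Y.presheaf.stalk (f x)) (X.presheaf.stalk x) :=
    Module.FaithfullyFlat.of_flat_of_isLocalHom
  obtain ⟨ϖ, hϖ⟩ := IsDiscreteValuationRing.exists_irreducible (X.presheaf.stalk x)
  obtain ⟨a, u, ha, hau⟩ := exists_maximalIdeal_eq_span hϖ.ne_zero hϖ.maximalIdeal_eq
    (Algebra.FormallyUnramified.map_maximalIdeal (R := Y.presheaf.stalk (f x)))
  have h2 : ¬ IsField (Y.presheaf.stalk (f x)) := by
    rw [IsLocalRing.isField_iff_maximalIdeal_eq, ha, Ideal.span_singleton_eq_bot]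
    rintro rfl
    rw [map_zero] at hau
    exact mul_ne_zero hϖ.ne_zero u.ne_zero hau.symm
  have h3 := (IsDiscreteValuationRing.TFAE (Y.presheaf.stalk (f x)) h2).out 0 4
  have : IsDiscreteValuationRing (Y.presheaf.stalk (f x)) := h3.2 ⟨⟨a, ha⟩⟩
  exact coheight_eq_one_of_isDiscreteValuationRing

/-! ### Smoothness over the base field -/

/-- The structure of a `k`-algebra on the sections of a `k`-scheme. -/
abbrev sectionsAlgebra {k : Type u} [Field k] {X : Scheme.{u}} (f : X ⟶ Spec (.of k)) (U : X.Opens) :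
    Algebra k Γ(X, U) :=
  ((f.appLE ⊤ U le_top).hom.comp (Scheme.ΓSpecIso (.of k)).inv.hom).toAlgebra

theorem formallySmooth_sections {k : Type u} [Field k] {X : Scheme.{u}} (f : X ⟶ Spec (.of k))
    [Smooth f] {U : X.Opens} (hU : IsAffineOpen U) :
    letI := sectionsAlgebra f U
    Algebra.FormallySmooth k Γ(X, U) := by
  let _ := sectionsAlgebra f U
  have h1 : (f.appLE ⊤ U le_top).hom.Smooth := f.smooth_appLE (isAffineOpen_top _) hU _
  have h2 : ((f.appLE ⊤ U le_top).hom.comp (Scheme.ΓSpecIso (.of k)).inv.hom).Smooth :=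
    RingHom.Smooth.respectsIso.2 _ (Scheme.ΓSpecIso (.of k)).symm.commRingCatIsoToRingEquiv h1
  have h3 : Algebra.Smooth k Γ(X, U) := h2
  infer_instance

/-- `𝒪_{X,x}` is a localization of the algebra of sections over an affine neighbourhood. -/
lemma isScalarTower_sections_stalk (k : Type u) [Field k] {X : Scheme.{u}} [X.Over (Spec (.of k))]
    {U : X.Opens} (x : U) :
    letI := sectionsAlgebra (X ↘ Spec (.of k)) U
    IsScalarTower k Γ(X, U) (X.presheaf.stalk x.1) := by
  let _ := sectionsAlgebra (X ↘ Spec (.of k)) U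
  refine IsScalarTower.of_algebraMap_eq fun a ↦ ?_
  change _ = (X.presheaf.germ U x.1 x.2).hom (((X ↘ Spec (.of k)).appLE ⊤ U le_top).hom _)
  change _ = (((X ↘ Spec (.of k)).app ⊤ ≫ X.presheaf.map _) ≫ X.presheaf.germ U x.1 x.2).hom _
  rw [Category.assoc, TopCat.Presheaf.germ_res]
  rfl

theorem formallySmooth_stalk (k : Type u) [Field k] {X : Scheme.{u}} [X.Over (Spec (.of k))]
    [Smooth (X ↘ Spec (.of k))] (x : X) : Algebra.FormallySmooth k (X.presheaf.stalk x) := by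
  obtain ⟨_, ⟨U, hU, rfl⟩, hxU, -⟩ :=
    X.isBasis_affineOpens.exists_subset_of_mem_open (Set.mem_univ x) isOpen_univ
  let _ := sectionsAlgebra (X ↘ Spec (.of k)) U
  have := formallySmooth_sections (X ↘ Spec (.of k)) hU
  let _ : Algebra Γ(X, U) (X.presheaf.stalk x) :=
    TopCat.Presheaf.algebra_section_stalk X.presheaf ⟨x, hxU⟩
  have := isScalarTower_sections_stalk k (⟨x, hxU⟩ : U)
  have := hU.isLocalization_stalk ⟨x, hxU⟩
  have : Algebra.FormallyEtale Γ(X, U) (X.presheaf.stalk x) :=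
    Algebra.FormallyEtale.of_isLocalization (hU.primeIdealOf ⟨x, hxU⟩).asIdeal.primeCompl
  exact Algebra.FormallySmooth.comp k Γ(X, U) (X.presheaf.stalk x)

theorem exists_basis_stalk (k : Type u) [Field k] {X : Scheme.{u}} [X.Over (Spec (.of k))]
    [Smooth (X ↘ Spec (.of k))] (x : X) :
    ∃ d : ℕ, Nonempty (Module.Basis (Fin d) (X.presheaf.stalk x) (Ω[X.presheaf.stalk x⁄k])) := by
  have := formallySmooth_stalk k x
  have : Algebra.EssFiniteType k (X.presheaf.stalk x) := by
    obtain ⟨_, ⟨U, hU, rfl⟩, hxU, -⟩ :=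
      X.isBasis_affineOpens.exists_subset_of_mem_open (Set.mem_univ x) isOpen_univ
    let _ := sectionsAlgebra (X ↘ Spec (.of k)) U
    have h1 : ((X ↘ Spec (.of k)).appLE ⊤ U le_top).hom.FiniteType :=
      LocallyOfFiniteType.finiteType_appLE _ (isAffineOpen_top _) hU _
    have h2 : Algebra.FiniteType k Γ(X, U) :=
      RingHom.finiteType_respectsIso.2 _ (Scheme.ΓSpecIso (.of k)).symm.commRingCatIsoToRingEquiv h1
    let _ : Algebra Γ(X, U) (X.presheaf.stalk x) :=
      TopCat.Presheaf.algebra_section_stalk X.presheaf ⟨x, hxU⟩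
    have := isScalarTower_sections_stalk k (⟨x, hxU⟩ : U)
    have := hU.isLocalization_stalk ⟨x, hxU⟩
    have := Algebra.EssFiniteType.of_isLocalization (X.presheaf.stalk x)
      (hU.primeIdealOf ⟨x, hxU⟩).asIdeal.primeCompl
    exact Algebra.EssFiniteType.comp k Γ(X, U) (X.presheaf.stalk x)
  have : Module.Free (X.presheaf.stalk x) (Ω[X.presheaf.stalk x⁄k]) :=
    Module.free_of_flat_of_isLocalRing
  exact ⟨_, ⟨Module.finBasis _ _⟩⟩

end LocalRings

/-! ### Smooth components and charts -/

section SmoothComponents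

/-- On an affine `U`, the quotient of `Γ(Y, U)` by the prime of `E` is the coordinate ring of the
smooth scheme `closure {E} ∩ U`; the quotient of the stalk is a base change of it along a
localization. -/
theorem formallySmooth_quotient_generizationIdeal (k : Type u) [Field k] {Y : Scheme.{u}}
    [Y.Over (Spec (.of k))] {E y : Y} (h : E ⤳ y)
    (hE : Smooth ((Scheme.IdealSheafData.vanishingIdeal (Closeds.closure {E})).subschemeι ≫
      Y ↘ Spec (.of k))) :
    Algebra.FormallySmooth k (Y.presheaf.stalk y ⧸ generizationIdeal h) := by
  obtain ⟨_, ⟨U, hU, rfl⟩, hyU, -⟩ :=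
    Y.isBasis_affineOpens.exists_subset_of_mem_open (Set.mem_univ y) isOpen_univ
  replace hU : IsAffineOpen U := hU
  have hEU : E ∈ U := h.mem_open U.2 hyU
  let 𝓘 := Scheme.IdealSheafData.vanishingIdeal (Closeds.closure {E})
  let p := (hU.primeIdealOf ⟨E, hEU⟩).asIdeal
  have := hU.isOpenImmersion_fromSpec
  have hfE : hU.fromSpec (hU.primeIdealOf ⟨E, hEU⟩) = E := hU.fromSpec_primeIdealOf ⟨E, hEU⟩
  have hp : 𝓘.ideal ⟨U, hU⟩ = p := by
    rw [Scheme.IdealSheafData.vanishingIdeal_ideal]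
    ext s
    rw [PrimeSpectrum.mem_vanishingIdeal]
    constructor
    · intro hs
      refine hs (hU.primeIdealOf ⟨E, hEU⟩) ?_
      change hU.fromSpec _ ∈ closure {E}
      rw [hfE]
      exact subset_closure rfl
    · intro hs q hq
      have h1 : E ⤳ hU.fromSpec q := specializes_iff_mem_closure.2 hq
      rw [← hfE] at h1
      exact (PrimeSpectrum.le_iff_specializes _ _).2
        (hU.fromSpec.isOpenEmbedding.isInducing.specializes_iff.1 h1) hs
  let Z := 𝓘.subscheme
  let V := 𝓘.subschemeι ⁻¹ᵁ U
  have hV : IsAffineOpen V := hU.preimage 𝓘.subschemeι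
  let _ := sectionsAlgebra (Y ↘ Spec (.of k)) U
  let _ : Algebra k Γ(Z, V) := sectionsAlgebra (𝓘.subschemeι ≫ Y ↘ Spec (.of k)) V
  have h1 : Algebra.FormallySmooth k Γ(Z, V) := formallySmooth_sections _ hV
  let φ : Γ(Y, U) →ₐ[k] Γ(Z, V) :=
    { (𝓘.subschemeι.app U).hom with
      commutes' := fun a ↦ by
        change ((Y ↘ Spec (.of k)).appLE ⊤ U le_top ≫ 𝓘.subschemeι.app U).hom _ = _
        rw [Scheme.Hom.app_eq_appLE]
        exact congr($(Scheme.Hom.appLE_comp_appLE 𝓘.subschemeι (Y ↘ Spec (.of k)) ⊤ U V le_top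
          le_rfl).hom _) }
  have hφ : Function.Surjective φ := 𝓘.subschemeι_app_surjective ⟨U, hU⟩
  have hker : RingHom.ker φ = p := (𝓘.ker_subschemeι_app ⟨U, hU⟩).trans hp
  have h2 : Algebra.FormallySmooth k (Γ(Y, U) ⧸ p) :=
    .of_equiv ((Ideal.quotientEquivAlgOfEq k hker).symm.trans
      (Ideal.quotientKerAlgEquivOfSurjective hφ)).symm
  let _ : Algebra Γ(Y, U) (Y.presheaf.stalk y) :=
    TopCat.Presheaf.algebra_section_stalk Y.presheaf ⟨y, hyU⟩
  let _ : Algebra Γ(Y, U) (Y.presheaf.stalk E) :=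
    TopCat.Presheaf.algebra_section_stalk Y.presheaf ⟨E, hEU⟩
  have := isScalarTower_sections_stalk k (⟨y, hyU⟩ : U)
  have hloc := hU.isLocalization_stalk ⟨y, hyU⟩
  have hlocE := hU.isLocalization_stalk ⟨E, hEU⟩
  have : Algebra.FormallyEtale Γ(Y, U) (Y.presheaf.stalk y) :=
    Algebra.FormallyEtale.of_isLocalization (hU.primeIdealOf ⟨y, hyU⟩).asIdeal.primeCompl
  have h3 : generizationIdeal h = p.map (algebraMap Γ(Y, U) (Y.presheaf.stalk y)) := by
    rw [← IsLocalization.map_under (hU.primeIdealOf ⟨y, hyU⟩).asIdeal.primeCompl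
      (Y.presheaf.stalk y) (generizationIdeal h)]
    congr 1
    ext s
    change ((Y.presheaf.germ U y hyU ≫ Y.presheaf.stalkSpecializes h).hom s) ∈
      IsLocalRing.maximalIdeal (Y.presheaf.stalk E) ↔ s ∈ p
    rw [TopCat.Presheaf.germ_stalkSpecializes]
    exact IsLocalization.AtPrime.to_map_mem_maximal_iff (Y.presheaf.stalk E)
      (hU.primeIdealOf ⟨E, hEU⟩).asIdeal s
  rw [h3]
  exact formallySmooth_quotient_map p

end SmoothComponents

namespace Orbifold

/-! ### Coordinates of a chart in its local rings. -/

section Charts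

variable {k : Type u} [Field k] {𝒳 : Orbifold k}

/-- The coordinates in the local ring of a point. -/
def Chart.coordAt (c : 𝒳.Chart) (w : c.W) (j : Fin c.d) : c.W.presheaf.stalk w :=
  (c.W.presheaf.germ ⊤ w (Opens.mem_top _)).hom (c.coord j)

lemma Chart.stalkSpecializes_coordAt (c : 𝒳.Chart) {w w' : c.W} (h : w' ⤳ w) (j : Fin c.d) :
    (c.W.presheaf.stalkSpecializes h).hom (c.coordAt w j) = c.coordAt w' j := by
  change (c.W.presheaf.germ ⊤ w _ ≫ c.W.presheaf.stalkSpecializes h).hom _ = _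
  rw [TopCat.Presheaf.germ_stalkSpecializes]
  rfl

lemma Chart.algebraMap_coordAt (c : 𝒳.Chart) (w : c.W) (j : Fin c.d) :
    algebraMap (c.W.presheaf.stalk w) c.W.functionField (c.coordAt w j) = c.coordK j :=
  c.stalkSpecializes_coordAt _ j

lemma Chart.isUnit_coordAt (c : 𝒳.Chart) (w : c.W) (j : Fin c.d) :
    IsUnit (c.coordAt w j) ↔ w ∈ c.W.basicOpen (c.coord j) :=
  (Scheme.mem_basicOpen_top _ _ _).symm

/-- Sections over an affine neighbourhood `V` of `w` are étale over the polynomial ring and localize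
to the stalk. What remains is to identify the map on polynomials with evaluation at the coordinates.
-/
theorem Chart.hasEtaleCoordinates (c : 𝒳.Chart) (w : c.W) :
    HasEtaleCoordinates k (c.coordAt w) := by
  obtain ⟨_, ⟨V, hV, rfl⟩, hwV, -⟩ :=
    c.W.isBasis_affineOpens.exists_subset_of_mem_open (Set.mem_univ w) isOpen_univ
  let n := ULift.{u} (Fin c.d)
  let v : n → Γ(c.W, ⊤) := fun j ↦ c.coord j.down
  let P : CommRingCat.{u} := .of (MvPolynomial n k)
  let hv := AffineSpace.homOfVector (n := n) (c.W ↘ Spec (.of k)) v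
  have hvet : Etale hv := c.etale_coord
  let ψ : c.W ⟶ Spec P := hv ≫ (AffineSpace.SpecIso n (.of k)).hom
  have hψ : Etale ψ := inferInstance
  have h1 : (ψ.appLE ⊤ V le_top).hom.Etale :=
    HasRingHomProperty.appLE @Etale ψ hψ ⟨⊤, isAffineOpen_top _⟩ ⟨V, hV⟩ _
  let α : MvPolynomial n k →+* Γ(c.W, V) :=
    (ψ.appLE ⊤ V le_top).hom.comp (Scheme.ΓSpecIso P).inv.hom
  have hα : α.Etale :=
    (HasRingHomProperty.isLocal_ringHomProperty @Etale).respectsIso.2 _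
      (Scheme.ΓSpecIso P).symm.commRingCatIsoToRingEquiv h1
  let _ : Algebra (MvPolynomial n k) Γ(c.W, V) := α.toAlgebra
  let _ : Algebra Γ(c.W, V) (c.W.presheaf.stalk w) :=
    TopCat.Presheaf.algebra_section_stalk c.W.presheaf ⟨w, hwV⟩
  refine ⟨Γ(c.W, V), inferInstance, inferInstance, inferInstance,
    (hV.primeIdealOf ⟨w, hwV⟩).asIdeal.primeCompl, hα, hV.isLocalization_stalk ⟨w, hwV⟩, ?_⟩
  have h2 : ∀ p, algebraMap Γ(c.W, V) (c.W.presheaf.stalk w) (α p) =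
      (c.W.presheaf.germ ⊤ w (Opens.mem_top _)).hom (hv.appTop.hom
        ((AffineSpace.SpecIso n (.of k)).hom.appTop.hom ((Scheme.ΓSpecIso P).inv.hom p))) := by
    intro p
    change (((ψ.app ⊤ ≫ c.W.presheaf.map _) ≫ c.W.presheaf.germ V w hwV)).hom _ = _
    rw [Category.assoc, TopCat.Presheaf.germ_res]
    rfl
  have h3 : ∀ p, (AffineSpace.SpecIso n (.of k)).hom.appTop.hom ((Scheme.ΓSpecIso P).inv.hom p) =
      MvPolynomial.eval₂Hom ((Scheme.ΓSpecIso (.of k)).inv ≫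
        (𝔸(n; Spec (.of k)) ↘ Spec (.of k)).appTop).hom (AffineSpace.coord (Spec (.of k))) p := by
    intro p
    rw [AffineSpace.SpecIso_hom_appTop]
    exact congr_arg (MvPolynomial.eval₂Hom ((Scheme.ΓSpecIso (.of k)).inv ≫
        (𝔸(n; Spec (.of k)) ↘ Spec (.of k)).appTop).hom (AffineSpace.coord (Spec (.of k))))
      congr($((Scheme.ΓSpecIso P).inv_hom_id).hom p)
  intro p
  change algebraMap Γ(c.W, V) (c.W.presheaf.stalk w) (α p) = _
  rw [h2, h3]
  induction p using MvPolynomial.induction_on with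
  | C a =>
    rw [MvPolynomial.coe_eval₂Hom, MvPolynomial.eval₂_C, MvPolynomial.aeval_C]
    have h4 : (𝔸(n; Spec (.of k)) ↘ Spec (.of k)).appTop ≫ hv.appTop =
        (c.W ↘ Spec (.of k)).appTop := by
      rw [← Scheme.Hom.comp_appTop, AffineSpace.homOfVector_over]
    change (c.W.presheaf.germ ⊤ w _).hom (((𝔸(n; Spec (.of k)) ↘ Spec (.of k)).appTop ≫
      hv.appTop).hom _) = _
    rw [h4]
    rfl
  | add p q hp hq => rw [map_add, map_add, map_add, hp, hq, map_add]
  | mul_X p j hp =>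
    rw [map_mul, map_mul, map_mul, hp, map_mul, MvPolynomial.aeval_X]
    congr 1
    rw [MvPolynomial.coe_eval₂Hom, MvPolynomial.eval₂_X]
    exact congr_arg _ (AffineSpace.homOfVector_appTop_coord _ _ _)

end Charts

/-! ### Multiplicities -/

section Multiplicities

variable {k : Type u} [Field k] {𝒳 : Orbifold k}

lemma mult_eq_one {E : 𝒳.X} (h : 𝒳.Δ E = 0) : 𝒳.mult E = 1 := by
  unfold mult
  rw [h, if_neg zero_ne_one]
  simp

lemma one_le_mult (E : 𝒳.X) : 1 ≤ 𝒳.mult E := by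
  unfold mult
  split_ifs with h
  · exact le_top
  · have h1 : (0 : ℚ) < 1 - 𝒳.Δ E := sub_pos.2 (lt_of_le_of_ne (𝒳.coeff_le_one E) h)
    have h2 : 1 ≤ (1 - 𝒳.Δ E)⁻¹ := (one_le_inv₀ h1).2 (by linarith [𝒳.coeff_nonneg E])
    exact_mod_cast Nat.le_floor (by exact_mod_cast h2)

lemma Chart.one_le_coordMult (c : 𝒳.Chart) (w : c.W) (j : Fin c.d) : 1 ≤ c.coordMult w j :=
  le_max_left _ _

lemma Chart.mult_le_coordMult (c : 𝒳.Chart) {w D : c.W} (h : D ⤳ w) (hD : Order.coheight D = 1)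
    {j : Fin c.d} (hj : ¬ IsUnit (c.coordAt D j)) : 𝒳.mult (c.g D) ≤ c.coordMult w j :=
  le_max_of_le_right (le_iSup₂_of_le (f := fun D (_ : D ∈ {D : c.W | D ⤳ w ∧ Order.coheight D = 1 ∧
    D ∉ c.W.basicOpen (c.coord j)}) ↦ 𝒳.mult (c.g D)) D
    ⟨h, hD, fun h' ↦ hj ((c.isUnit_coordAt D j).2 h')⟩ le_rfl)

lemma Chart.coordMult_le (c : 𝒳.Chart) {w : c.W} {j : Fin c.d} {N : ℕ∞} (hN : 1 ≤ N)
    (h : ∀ D, D ⤳ w → Order.coheight D = 1 → ¬ IsUnit (c.coordAt D j) → 𝒳.Δ (c.g D) ≠ 0 →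
      𝒳.mult (c.g D) ≤ N) : c.coordMult w j ≤ N := by
  refine max_le hN (iSup₂_le fun D hD ↦ ?_)
  by_cases h0 : 𝒳.Δ (c.g D) = 0
  · rwa [mult_eq_one h0]
  · exact h D hD.1 hD.2.1 (fun h' ↦ hD.2.2 ((c.isUnit_coordAt D j).1 h')) h0

lemma Chart.exists_of_coordMult_ne_one (c : 𝒳.Chart) {w : c.W} {j : Fin c.d}
    (h : c.coordMult w j ≠ 1) : ∃ D, D ⤳ w ∧ Order.coheight D = 1 ∧ ¬ IsUnit (c.coordAt D j) ∧
      𝒳.Δ (c.g D) ≠ 0 := by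
  by_contra! h'
  exact h (le_antisymm (c.coordMult_le le_rfl fun D h1 h2 h3 h4 ↦ (h4 (h' D h1 h2 h3)).elim)
    (c.one_le_coordMult w j))

/-- The support is cut out on the chart by a product of coordinates, so `g(D)` is outside it if no
coordinate vanishes at `D`. -/
lemma Chart.mult_eq_one_of_isUnit (c : 𝒳.Chart) {D : c.W} (h : ∀ j, IsUnit (c.coordAt D j)) :
    𝒳.mult (c.g D) = 1 := by
  refine mult_eq_one ?_
  by_contra h0
  have h1 : c.g D ∈ 𝒳.supp := ⟨c.g D, h0, specializes_rfl⟩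
  refine (c.mem_supp_iff D).1 h1 ?_
  rw [Scheme.mem_basicOpen_top, map_prod]
  exact Finset.prod_induction _ IsUnit (fun _ _ ↦ IsUnit.mul) isUnit_one fun j _ ↦ h j

end Multiplicities

end Orbifold

/-! ### Pullback of orbifold differentials at a point -/

section FunctionFields

variable (k : Type u) [Field k]

lemma stalkSpecAlgHom_stalkMapAlgHom {X Y : Scheme.{u}} [X.Over (Spec (.of k))]
    [Y.Over (Spec (.of k))] (f : X ⟶ Y) [f.IsOver (Spec (.of k))] {x x' : X} (h : x ⤳ x')
    (a : Y.presheaf.stalk (f x')) :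
    stalkSpecAlgHom k X h (stalkMapAlgHom k f x' a) =
      stalkMapAlgHom k f x (stalkSpecAlgHom k Y (h.map f.continuous) a) :=
  congr($(Scheme.Hom.stalkSpecializes_stalkMap f x x' h).hom a).symm

lemma stalkSpecAlgHom_stalkSpecAlgHom {X : Scheme.{u}} [X.Over (Spec (.of k))] {x y z : X}
    (h : x ⤳ y) (h' : y ⤳ z) (a : X.presheaf.stalk z) :
    stalkSpecAlgHom k X h (stalkSpecAlgHom k X h' a) = stalkSpecAlgHom k X (h.trans h') a := by
  change (X.presheaf.stalkSpecializes h' ≫ X.presheaf.stalkSpecializes h).hom a = _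
  rw [TopCat.Presheaf.stalkSpecializes_comp]
  rfl

lemma functionFieldMap_algebraMap {W X : Scheme.{u}} [W.Over (Spec (.of k))]
    [X.Over (Spec (.of k))] [IsIntegral W] [IsIntegral X] (g : W ⟶ X) [g.IsOver (Spec (.of k))]
    [Etale g] {w : W} {x : X} (h : g w = x) (a : X.presheaf.stalk x) :
    functionFieldMap k g (algebraMap (X.presheaf.stalk x) X.functionField a) =
      algebraMap (W.presheaf.stalk w) W.functionField (stalkMapAt k g h a) := by
  subst h
  refine Eq.trans ?_ (stalkSpecAlgHom_stalkMapAlgHom k g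
    ((genericPoint_spec W).specializes (Set.mem_univ w)) _).symm
  refine congr_arg (stalkMapAlgHom k g (genericPoint W)) ?_
  refine (stalkSpecAlgHom_stalkSpecAlgHom k _ _ a).trans ?_
  exact (stalkSpecAlgHom_stalkSpecAlgHom k _ _ a).symm

lemma isScalarTower_stalk_functionField (X : Scheme.{u}) [X.Over (Spec (.of k))] [IsIntegral X]
    (x : X) : IsScalarTower k (X.presheaf.stalk x) X.functionField :=
  IsScalarTower.of_algebraMap_eq' (stalkSpecAlgHom k X
    ((genericPoint_spec X).specializes (Set.mem_univ x))).comp_algebraMap.symm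

end FunctionFields

namespace Orbifold

/-! ### Ideals of the components of the orbifold divisor, in charts and under pullback. -/

section Components

variable {k : Type u} [Field k] {𝒴 : Orbifold k}

instance (𝒳 : Orbifold k) : IsLocallyNoetherian 𝒳.X :=
  LocallyOfFiniteType.isLocallyNoetherian (𝒳.X ↘ Spec (.of k))

/-- Coheight one provides a strict generization `z` of `E`; if the ideal of `E` were zero, it would
lie in that of `z`, and `E` would specialize to `z`. -/
lemma generizationIdeal_ne_bot {E y : 𝒴.X} (h : E ⤳ y) (hE : 𝒴.Δ E ≠ 0) :
    generizationIdeal h ≠ ⊥ := by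
  intro h0
  have h1 := 𝒴.coheight_eq_one E hE
  have h2 : ¬ IsMax E := by
    intro hm
    rw [Order.coheight_eq_zero.2 hm] at h1
    exact zero_ne_one h1
  obtain ⟨z, hz⟩ := not_isMax_iff.1 h2
  exact hz.not_ge (specializes_of_generizationIdeal_le h (Specializes.trans hz.le h) (h0 ▸ bot_le))

/-- The prime `(x_l)` is the ideal of `D`, and `D` maps to `E`, so the extension of `I_E` is
contained in `(x_l)`. Conversely, `E` is smooth, hence so is its étale preimage, and a nonzero ideal
inside `(x_l)` with formally smooth quotient contains `x_l` by `mem_of_formallySmooth_quotient`. -/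
theorem Chart.map_generizationIdeal (h𝒴 : 𝒴.IsSmooth) (c : 𝒴.Chart) {w : c.W} {y : 𝒴.X}
    (h : c.g w = y) {D : c.W} (hD : D ⤳ w) (hD1 : Order.coheight D = 1) {l : Fin c.d}
    (hl : ¬ IsUnit (c.coordAt D l)) {E : 𝒴.X} (hDE : c.g D = E) (hE : E ⤳ y) (hE0 : 𝒴.Δ E ≠ 0) :
    (generizationIdeal hE).map (stalkMapAt k c.g h).toRingHom = Ideal.span {c.coordAt w l} := by
  subst h hDE
  have hy := c.hasEtaleCoordinates w
  have hyD := c.hasEtaleCoordinates D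
  have := hy.isNoetherianRing
  have := hyD.isNoetherianRing
  have := hyD.isDomain_and_isIntegrallyClosed.2
  have := isDiscreteValuationRing_of_coheight_eq_one hD1
  let _ := (c.W.presheaf.stalkSpecializes hD).hom.toAlgebra
  have hloc := isLocalization_generizationIdeal hD
  have hlw : ¬ IsUnit (c.coordAt w l) := fun hu ↦ hl <| by
    rw [← c.stalkSpecializes_coordAt hD]
    exact hu.map _
  have hQ := hy.isPrime_span_singleton l hlw
  have hle : Ideal.span {c.coordAt w l} ≤ generizationIdeal hD := by
    rw [Ideal.span_singleton_le_iff_mem]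
    change (c.W.presheaf.stalkSpecializes hD).hom (c.coordAt w l) ∈ IsLocalRing.maximalIdeal _
    rw [c.stalkSpecializes_coordAt hD]
    exact hl
  -- `(x_l)` is prime and stays a nonzero prime in the discrete valuation ring at `D`, where it must
  -- be the maximal ideal.
  have hP : generizationIdeal hD = Ideal.span {c.coordAt w l} := by
    have hdisj : Disjoint ((generizationIdeal hD).primeCompl : Set (c.W.presheaf.stalk w))
        (Ideal.span {c.coordAt w l} : Ideal (c.W.presheaf.stalk w)) :=
      Set.disjoint_left.2 fun a ha ha' ↦ ha (hle ha')
    have h1 := IsLocalization.isPrime_of_isPrime_disjoint (generizationIdeal hD).primeCompl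
      (c.W.presheaf.stalk D) _ hQ hdisj
    have h2 : (Ideal.span {c.coordAt w l}).map (algebraMap _ (c.W.presheaf.stalk D)) =
        IsLocalRing.maximalIdeal _ := by
      refine IsLocalRing.eq_maximalIdeal (Ring.DimensionLEOne.maximalOfPrime ?_ h1)
      rw [Ideal.map_span, Set.image_singleton, Ne, Ideal.span_singleton_eq_bot]
      change (c.W.presheaf.stalkSpecializes hD).hom (c.coordAt w l) ≠ 0
      rw [c.stalkSpecializes_coordAt hD]
      exact hyD.ne_zero l
    have h3 := IsLocalization.under_map_of_isPrime_disjoint (generizationIdeal hD).primeCompl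
      (c.W.presheaf.stalk D) hQ hdisj
    rw [h2] at h3
    exact h3
  obtain ⟨hf, he, -, hloc⟩ := stalkMapAt_etale k c.g (rfl : c.g w = c.g w)
  let φ := stalkMapAt k c.g (rfl : c.g w = c.g w)
  let _ := φ.toRingHom.toAlgebra
  have : IsScalarTower k (𝒴.X.presheaf.stalk (c.g w)) (c.W.presheaf.stalk w) :=
    IsScalarTower.of_algebraMap_eq' φ.comp_algebraMap.symm
  have : Module.Flat (𝒴.X.presheaf.stalk (c.g w)) (c.W.presheaf.stalk w) := hf
  have : Algebra.FormallyEtale (𝒴.X.presheaf.stalk (c.g w)) (c.W.presheaf.stalk w) := he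
  have : IsLocalHom (algebraMap (𝒴.X.presheaf.stalk (c.g w)) (c.W.presheaf.stalk w)) := hloc
  have : Module.FaithfullyFlat (𝒴.X.presheaf.stalk (c.g w)) (c.W.presheaf.stalk w) :=
    Module.FaithfullyFlat.of_flat_of_isLocalHom
  have hI : (generizationIdeal hE).map φ.toRingHom ≤ Ideal.span {c.coordAt w l} := by
    rw [← hP, Ideal.map_le_iff_le_comap]
    intro a ha
    change stalkSpecAlgHom k c.W hD (stalkMapAlgHom k c.g w (stalkSpecAlgHom k 𝒴.X _ a)) ∈
      IsLocalRing.maximalIdeal _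
    rw [stalkSpecAlgHom_stalkMapAlgHom, stalkSpecAlgHom_stalkSpecAlgHom]
    exact fun hu ↦ ha (isUnit_of_map_unit (c.g.stalkMap D).hom _ hu)
  refine le_antisymm hI ?_
  have := formallySmooth_quotient_generizationIdeal k hE (h𝒴.smooth_component _ hE0)
  have : Algebra.FormallySmooth k (c.W.presheaf.stalk w ⧸
      (generizationIdeal hE).map φ.toRingHom) := formallySmooth_quotient_map (generizationIdeal hE)
  have := hy.formallySmooth
  rw [Ideal.span_singleton_le_iff_mem]
  refine mem_of_formallySmooth_quotient (k := k) _ ?_ hlw hI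
  intro h0
  exact generizationIdeal_ne_bot hE hE0 ((Ideal.map_eq_bot_iff_of_injective
    (FaithfulSMul.algebraMap_injective _ (c.W.presheaf.stalk w))).1 h0)

/-- If every equation of `E` pulled back to zero, the generic point of `X` would map into `E`, and
so would all of `X`. -/
theorem IsMorphism.exists_stalkMap_ne_zero {𝒳 : Orbifold k} {f : 𝒳.X ⟶ 𝒴.X}
    [f.IsOver (Spec (.of k))] (hf : IsMorphism 𝒳 𝒴 f) {E : 𝒴.X} (hE0 : 𝒴.Δ E ≠ 0) {x : 𝒳.X}
    (hE : E ⤳ f x) : ∃ a ∈ generizationIdeal hE,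
      algebraMap (𝒳.X.presheaf.stalk x) 𝒳.X.functionField (stalkMapAlgHom k f x a) ≠ 0 := by
  by_contra! h
  have hη := (genericPoint_spec 𝒳.X).specializes (Set.mem_univ x)
  have h1 : E ⤳ f (genericPoint 𝒳.X) := by
    refine specializes_of_generizationIdeal_le hE (hη.map f.continuous) fun a ha ↦ ?_
    have h2 := h a ha
    change stalkSpecAlgHom k 𝒳.X hη (stalkMapAlgHom k f x a) = 0 at h2
    rw [stalkSpecAlgHom_stalkMapAlgHom] at h2
    change ¬ IsUnit (stalkSpecAlgHom k 𝒴.X _ a)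
    intro hu
    have h3 := hu.map (stalkMapAlgHom k f (genericPoint 𝒳.X))
    rw [h2] at h3
    exact not_isUnit_zero h3
  refine hf.not_subset ?_
  rintro _ ⟨x', rfl⟩
  exact ⟨E, hE0, h1.trans
    (((genericPoint_spec 𝒳.X).specializes (Set.mem_univ x')).map f.continuous)⟩

end Components

end Orbifold

namespace Orbifold

/-! ### The pullback of an orbifold differential in a chart -/

section ChartPullback

variable {k : Type u} [Field k] {𝒳 𝒴 : Orbifold k} {f : 𝒳.X ⟶ 𝒴.X} [f.IsOver (Spec (.of k))]

lemma Chart.localModule_eq (c : 𝒴.Chart) (n p : ℕ) (w : c.W) : c.localModule n p w =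
    Submodule.span (algebraMap (c.W.presheaf.stalk w) c.W.functionField).range
      (Set.range (logGenerator (k := k) (fun l ↦ algebraMap (c.W.presheaf.stalk w)
        c.W.functionField (c.coordAt w l)) (c.coordMult w) n p)) := by
  have h : (fun l ↦ algebraMap (c.W.presheaf.stalk w) c.W.functionField (c.coordAt w l)) =
      c.coordK := funext (c.algebraMap_coordAt w)
  rw [h]
  rfl

lemma Chart.pull_symFormsMap (c : 𝒳.Chart) (p : ℕ)
    (τ : SymForms k (𝒴.X.presheaf.stalk (f (genericPoint 𝒳.X))) p) :
    c.pull p (symFormsMap p (stalkMapAlgHom k f (genericPoint 𝒳.X)) τ) =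
      symFormsMap p ((functionFieldMap k c.g).comp (stalkMapAlgHom k f (genericPoint 𝒳.X))) τ :=
  (symFormsMap_comp p _ _ τ).symm

/-- Divisibility is checked at `D`, but with the multiplicities taken at `w`, as the module at `w`
requires; these are at least `m(D)` for the coordinates vanishing along `D`, which suffices. -/
theorem Chart.coeffLattice_pull_of_coheight (h𝒴 : 𝒴.IsSmooth) (hf : IsMorphism 𝒳 𝒴 f) (n p : ℕ)
    (τ : SymForms k (𝒴.X.presheaf.stalk (f (genericPoint 𝒳.X))) p) (c : 𝒳.Chart)
    (ε : Module.Basis (Fin c.d) c.W.functionField (Ω[c.W.functionField⁄k]))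
    (hε : ∀ i, ε i = (c.coordK i)⁻¹ • KaehlerDifferential.D k _ (c.coordK i))
    {w D : c.W} (hDw : D ⤳ w) (hD : IsDiscreteValuationRing (c.W.presheaf.stalk D))
    (hτ : symFormsMap p (stalkSpecAlgHom k 𝒴.X ((genericPoint_spec 𝒴.X).specializes trivial)) τ ∈
      𝒴.stalkForms n p (f (c.g D))) :
    coeffLattice (algebraMap (c.W.presheaf.stalk D) c.W.functionField) n
      (fun μ ↦ algebraMap (c.W.presheaf.stalk D) c.W.functionField
        (∏ i, c.coordAt D i ^ Chart.ceilQuot (occ i μ) (c.coordMult w i)))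
      (symCoord ε p (c.pull p (symFormsMap p (stalkMapAlgHom k f (genericPoint 𝒳.X)) τ))) := by
  obtain ⟨c', w', hw'⟩ := h𝒴.exists_chart (f (c.g D))
  let A := 𝒴.X.presheaf.stalk (f (c.g D))
  let X := 𝒳.X.presheaf.stalk (c.g D)
  let O := c.W.presheaf.stalk D
  let B := c'.W.presheaf.stalk w'
  have hη : genericPoint 𝒳.X ⤳ c.g D := (genericPoint_spec 𝒳.X).specializes (Set.mem_univ _)
  have hξ : f (genericPoint 𝒳.X) ⤳ f (c.g D) := hη.map f.continuous
  let Aξ := 𝒴.X.presheaf.stalk (f (genericPoint 𝒳.X))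
  let φB : A →ₐ[k] B := stalkMapAt k c'.g hw'
  let φX : A →ₐ[k] X := stalkMapAlgHom k f (c.g D)
  let φO : X →ₐ[k] O := stalkMapAt k c.g rfl
  let φξ : A →ₐ[k] Aξ := stalkSpecAlgHom k 𝒴.X hξ
  let _ : Algebra A B := φB.toRingHom.toAlgebra
  let _ : Algebra A X := φX.toRingHom.toAlgebra
  let _ : Algebra X O := φO.toRingHom.toAlgebra
  let _ : Algebra A O := (φO.comp φX).toRingHom.toAlgebra
  let _ : Algebra A Aξ := φξ.toRingHom.toAlgebra
  have : IsScalarTower A X O := .of_algebraMap_eq' rfl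
  have : IsScalarTower k A B := .of_algebraMap_eq' φB.comp_algebraMap.symm
  have : IsScalarTower k A O := .of_algebraMap_eq' (φO.comp φX).comp_algebraMap.symm
  have : IsScalarTower k A Aξ := .of_algebraMap_eq' φξ.comp_algebraMap.symm
  have : IsScalarTower k O c.W.functionField := isScalarTower_stalk_functionField k c.W D
  have : IsScalarTower k B c'.W.functionField := isScalarTower_stalk_functionField k c'.W w'
  obtain ⟨N, hN⟩ := exists_isLocalization_stalkSpecializes hξ
  have : IsLocalization N Aξ := hN
  obtain ⟨h1, h2, h3, h4⟩ := stalkMapAt_etale k c'.g hw'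
  have : Module.Flat A B := h1
  have : Algebra.FormallyEtale A B := h2
  have : Algebra.EssFiniteType A B := h3
  have : IsLocalHom (algebraMap A B) := h4
  obtain ⟨h1, h2, h3, h4⟩ := stalkMapAt_etale k c.g (rfl : c.g D = c.g D)
  have : Module.Flat X O := h1
  have : Algebra.FormallyEtale X O := h2
  have : Algebra.EssFiniteType X O := h3
  have : IsLocalHom (algebraMap X O) := h4
  have : Module.FaithfullyFlat X O := Module.FaithfullyFlat.of_flat_of_isLocalHom
  have hD1 : Order.coheight D = 1 := coheight_eq_one_of_isDiscreteValuationRing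
  have hD0 : Order.coheight (c.g D) = 1 := coheight_apply_eq_one_of_etale c.g D
  let θ : Aξ →ₐ[k] c.W.functionField :=
    (functionFieldMap k c.g).comp (stalkMapAlgHom k f (genericPoint 𝒳.X))
  let σ : Aξ →ₐ[k] c'.W.functionField := (functionFieldMap k c'.g).comp
    (stalkSpecAlgHom k 𝒴.X ((genericPoint_spec 𝒴.X).specializes trivial))
  have hθ' : ∀ a : A, algebraMap O c.W.functionField (algebraMap A O a) =
      functionFieldMap k c.g (algebraMap X 𝒳.X.functionField (φX a)) := fun a ↦
    (functionFieldMap_algebraMap k c.g (rfl : c.g D = c.g D) (φX a)).symm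
  have hθ : ∀ a, θ (algebraMap A Aξ a) = algebraMap O c.W.functionField (algebraMap A O a) := by
    intro a
    rw [hθ']
    exact congr_arg (functionFieldMap k c.g) (stalkSpecAlgHom_stalkMapAlgHom k f hη a).symm
  have hσ : ∀ a, σ (algebraMap A Aξ a) = algebraMap B c'.W.functionField (algebraMap A B a) := by
    intro a
    refine Eq.trans ?_ (functionFieldMap_algebraMap k c'.g hw' a)
    exact congr_arg (functionFieldMap k c'.g) (stalkSpecAlgHom_stalkSpecAlgHom k _ _ a)
  have hτ' := hτ c' w' hw'
  have h5 : c'.pull p (symFormsMap p (stalkSpecAlgHom k 𝒴.X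
      ((genericPoint_spec 𝒴.X).specializes trivial)) τ) = symFormsMap p σ τ :=
    (symFormsMap_comp p _ _ τ).symm
  rw [h5, c'.localModule_eq] at hτ'
  rw [c.pull_symFormsMap]
  refine coeffLattice_pullback_of_dvr (X := X) (A := A) (B := B)
    Algebra.FormallyUnramified.map_maximalIdeal N σ θ hσ hθ (c.hasEtaleCoordinates D) ε
    (fun i ↦ by rw [hε, c.algebraMap_coordAt]) (c'.hasEtaleCoordinates w') (𝒳.mult (c.g D))
    (one_le_mult _) _ (fun i hi ↦ c.mult_le_coordMult hDw hD1 hi) c.mult_eq_one_of_isUnit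
    (c'.coordMult w') (c'.one_le_coordMult w') (fun l hl ↦ ?_) (fun l hl t ht0 ht ↦ ?_) n p τ hτ'
  · obtain ⟨D', h6, h7, h8, h9⟩ := c'.exists_of_coordMult_ne_one hl
    have hE : c'.g D' ⤳ f (c.g D) := hw' ▸ h6.map c'.g.continuous
    refine ⟨generizationIdeal hE, c'.map_generizationIdeal h𝒴 hw' h6 h7 h8 rfl hE h9, fun h0 ↦ ?_⟩
    obtain ⟨a, ha, ha'⟩ := hf.exists_stalkMap_ne_zero h9 hE
    refine (map_ne_zero_iff _ (functionFieldMap k c.g).injective).2 ha' ?_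
    have h10 : algebraMap A O a = 0 := (Ideal.map_eq_bot_iff_le_ker _).1 h0 ha
    refine (hθ' a).symm.trans ?_
    rw [h10, map_zero]
  -- The multiplicity of a coordinate is a supremum over components, so each component `E` is
  -- bounded separately: `m(E) ≤ length · m(D) ≤ t m(D)`.
  · refine c'.coordMult_le ?_ fun D' h6 h7 h8 h9 ↦ ?_
    · exact one_le_mul (by exact_mod_cast Nat.one_le_iff_ne_zero.2 ht0) (one_le_mult _)
    · have hE : c'.g D' ⤳ f (c.g D) := hw' ▸ h6.map c'.g.continuous
      refine (hf.mult_le _ _ hE h9 hD0).trans (mul_le_mul_left ?_ _)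
      exact ht (generizationIdeal hE) (c'.map_generizationIdeal h𝒴 hw' h6 h7 h8 rfl hE h9)

theorem Chart.coeff_pull_eq_zero (h𝒴 : 𝒴.IsSmooth) (hf : IsMorphism 𝒳 𝒴 f) (n p : ℕ)
    (τ : SymForms k (𝒴.X.presheaf.stalk (f (genericPoint 𝒳.X))) p) (c : 𝒳.Chart)
    (ε : Module.Basis (Fin c.d) c.W.functionField (Ω[c.W.functionField⁄k]))
    (hε : ∀ i, ε i = (c.coordK i)⁻¹ • KaehlerDifferential.D k _ (c.coordK i))
    (hτ : symFormsMap p (stalkSpecAlgHom k 𝒴.X ((genericPoint_spec 𝒴.X).specializes trivial)) τ ∈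
      𝒴.stalkForms n p (f (genericPoint 𝒳.X))) (μ : (Fin p ↪o Fin c.d) →₀ ℕ) (hμ : μ.degree ≠ n) :
    (symCoord ε p (c.pull p
      (symFormsMap p (stalkMapAlgHom k f (genericPoint 𝒳.X)) τ))).coeff μ = 0 := by
  obtain ⟨c', w', hw'⟩ := h𝒴.exists_chart (f (genericPoint 𝒳.X))
  let A := 𝒴.X.presheaf.stalk (f (genericPoint 𝒳.X))
  let B := c'.W.presheaf.stalk w'
  let φB : A →ₐ[k] B := stalkMapAt k c'.g hw'
  let θ : A →ₐ[k] c.W.functionField :=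
    (functionFieldMap k c.g).comp (stalkMapAlgHom k f (genericPoint 𝒳.X))
  let σ : A →ₐ[k] c'.W.functionField := (functionFieldMap k c'.g).comp
    (stalkSpecAlgHom k 𝒴.X ((genericPoint_spec 𝒴.X).specializes trivial))
  let _ : Algebra A B := φB.toRingHom.toAlgebra
  let _ : Algebra A c.W.functionField := θ.toRingHom.toAlgebra
  have : IsScalarTower k A B := .of_algebraMap_eq' φB.comp_algebraMap.symm
  have : IsScalarTower k A c.W.functionField := .of_algebraMap_eq' θ.comp_algebraMap.symm
  have : IsScalarTower k B c'.W.functionField := isScalarTower_stalk_functionField k c'.W w'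
  obtain ⟨h1, h2, h3, h4⟩ := stalkMapAt_etale k c'.g hw'
  have : Module.Flat A B := h1
  have : Algebra.FormallyEtale A B := h2
  have : Algebra.EssFiniteType A B := h3
  have : IsLocalHom (algebraMap A B) := h4
  have hτ' := hτ c' w' hw'
  have h5 : c'.pull p (symFormsMap p (stalkSpecAlgHom k 𝒴.X
      ((genericPoint_spec 𝒴.X).specializes trivial)) τ) = symFormsMap p σ τ :=
    (symFormsMap_comp p _ _ τ).symm
  rw [h5, c'.localModule_eq] at hτ'
  rw [c.pull_symFormsMap]
  have : IsLocalization (⊥ : Submonoid A) A := .self bot_le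
  refine coeffLattice_pullback_of_field (A := A) (B := B) (⊥ : Submonoid A) σ θ
    (fun a ↦ functionFieldMap_algebraMap k c'.g hw' a) (fun a ↦ rfl)
    (c.hasEtaleCoordinates (genericPoint c.W)) ε hε (c'.hasEtaleCoordinates w')
    (c'.coordMult w') (c'.one_le_coordMult w') (fun l hl ↦ ?_) n p τ hτ' μ hμ
  obtain ⟨D', h6, h7, h8, h9⟩ := c'.exists_of_coordMult_ne_one hl
  have hE : c'.g D' ⤳ f (genericPoint 𝒳.X) := hw' ▸ h6.map c'.g.continuous
  refine ⟨generizationIdeal hE, c'.map_generizationIdeal h𝒴 hw' h6 h7 h8 rfl hE h9, fun h0 ↦ ?_⟩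
  obtain ⟨a, ha, ha'⟩ := hf.exists_stalkMap_ne_zero h9 hE
  refine ha' ?_
  have h10 : functionFieldMap k c.g (stalkMapAlgHom k f (genericPoint 𝒳.X) a) = 0 :=
    (Ideal.map_eq_bot_iff_le_ker _).1 h0 ha
  rw [(map_eq_zero_iff _ (functionFieldMap k c.g).injective).1 h10, map_zero]

theorem Chart.pull_mem_localModule (h𝒴 : 𝒴.IsSmooth) (hf : IsMorphism 𝒳 𝒴 f) (n p : ℕ)
    (τ : SymForms k (𝒴.X.presheaf.stalk (f (genericPoint 𝒳.X))) p) (c : 𝒳.Chart) (w : c.W)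
    (hτ : ∀ y, y ⤳ f (c.g w) → symFormsMap p
      (stalkSpecAlgHom k 𝒴.X ((genericPoint_spec 𝒴.X).specializes trivial)) τ ∈
      𝒴.stalkForms n p y) :
    c.pull p (symFormsMap p (stalkMapAlgHom k f (genericPoint 𝒳.X)) τ) ∈ c.localModule n p w := by
  have hx := c.hasEtaleCoordinates w
  have hxη := c.hasEtaleCoordinates (genericPoint c.W)
  have := hx.isNoetherianRing
  have := hx.isDomain_and_isIntegrallyClosed.2
  have hx0 : ∀ i, c.coordK i ≠ 0 := hxη.ne_zero
  obtain ⟨b, hb⟩ := hxη.exists_basis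
  obtain ⟨ε, hε⟩ := exists_log_basis (x := c.coordK) b hb hx0
  refine mem_span_logGenerator (localSubring c.W w) c.coordK (c.coordMult w) n p ε hε _ fun μ ↦
    ⟨fun hμ ↦ c.coeff_pull_eq_zero h𝒴 hf n p τ ε hε (hτ _ ?_) μ hμ, ?_⟩
  · exact ((genericPoint_spec 𝒳.X).specializes (Set.mem_univ _)).map f.continuous
  set v := (symCoord ε p (c.pull p
    (symFormsMap p (stalkMapAlgHom k f (genericPoint 𝒳.X)) τ))).coeff μ with hv
  set e := ∏ i, c.coordK i ^ ceilQuot (occ i μ) (c.coordMult w i) with he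
  have he0 : e ≠ 0 := Finset.prod_ne_zero_iff.2 fun i _ ↦ pow_ne_zero _ (hx0 i)
  suffices h : ∃ r, algebraMap (c.W.presheaf.stalk w) c.W.functionField r = v / e by
    obtain ⟨r, hr⟩ := h
    refine ⟨⟨v / e, r, hr⟩, ?_⟩
    exact (div_mul_cancel₀ _ he0).symm
  -- The quotient of the coefficient by the required power of the coordinates is tested at the
  -- height one primes of the normal ring `𝒪_{W,w}`.
  refine exists_algebraMap_eq_of_forall_dvr _ fun P hP _ hdvr ↦ ?_
  obtain ⟨D, hD, rfl⟩ := exists_generizationIdeal_eq P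
  let _ := (c.W.presheaf.stalkSpecializes hD).hom.toAlgebra
  have hloc := isLocalization_generizationIdeal hD
  have hdvr' : IsDiscreteValuationRing (c.W.presheaf.stalk D) :=
    IsDiscreteValuationRing.RingEquivClass.isDiscreteValuationRing (IsLocalization.algEquiv
      (generizationIdeal hD).primeCompl (Localization.AtPrime (generizationIdeal hD))
      (c.W.presheaf.stalk D))
  obtain ⟨r, hr⟩ := (c.coeffLattice_pull_of_coheight h𝒴 hf n p τ ε hε hD hdvr'
    (hτ _ ((hD.map c.g.continuous).map f.continuous)) μ).2
  obtain ⟨⟨a, s⟩, has⟩ := IsLocalization.surj (generizationIdeal hD).primeCompl r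
  have hK : ∀ z, algebraMap (c.W.presheaf.stalk w) c.W.functionField z =
      algebraMap (c.W.presheaf.stalk D) c.W.functionField
        (algebraMap (c.W.presheaf.stalk w) (c.W.presheaf.stalk D) z) := fun z ↦
    (stalkSpecAlgHom_stalkSpecAlgHom k ((genericPoint_spec c.W).specializes (Set.mem_univ D))
      hD z).symm
  refine ⟨a, s, s.2, ?_⟩
  have h1 : v = algebraMap (c.W.presheaf.stalk D) c.W.functionField r * e := by
    refine hr.trans ?_
    simp only [he, map_prod, map_pow, c.algebraMap_coordAt]
  rw [h1, mul_div_cancel_right₀ _ he0, hK, hK, ← map_mul, has]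

end ChartPullback

end Orbifold

/-! ### Regularity outside the support -/

section Regularity

/-- Inside `L` one has `K ∩ B = A`: if `a / s ∈ B`, then `a ∈ sB ∩ A = sA`. -/
lemma mem_range_of_faithfullyFlat {A B K L : Type*} [CommRing A] [IsDomain A] [CommRing B]
    [Algebra A B] [Module.FaithfullyFlat A B] [Field K] [Algebra A K] [IsFractionRing A K] [Field L]
    (j : B →+* L) (hj : Function.Injective j) (ψ : K →+* L)
    (hcomm : ∀ a, ψ (algebraMap A K a) = j (algebraMap A B a)) {c : K} {r : B} (h : ψ c = j r) :
    c ∈ Set.range (algebraMap A K) := by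
  obtain ⟨a, s, hs, rfl⟩ := IsFractionRing.div_surjective (A := A) c
  have hs0 : algebraMap A K s ≠ 0 :=
    (map_ne_zero_iff _ (IsFractionRing.injective A K)).2 (nonZeroDivisors.ne_zero hs)
  rw [map_div₀, div_eq_iff ((map_ne_zero ψ).2 hs0), hcomm, hcomm, ← map_mul] at h
  have h3 : a ∈ Ideal.span {s} := by
    rw [← Ideal.comap_map_eq_self_of_faithfullyFlat (B := B) (Ideal.span {s}), Ideal.mem_comap,
      Ideal.map_span, Set.image_singleton, hj h]
    exact Ideal.mul_mem_left _ _ (Ideal.mem_span_singleton_self _)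
  obtain ⟨t, rfl⟩ := Ideal.mem_span_singleton'.1 h3
  exact ⟨t, by rw [map_mul, mul_div_cancel_right₀ _ hs0]⟩

namespace Orbifold

variable {k : Type u} [Field k] {𝒴 : Orbifold k}

theorem exists_basis_stalk_functionField (h𝒴 : 𝒴.IsSmooth) (y : 𝒴.X) :
    ∃ (d : ℕ) (b : Module.Basis (Fin d) (𝒴.X.presheaf.stalk y) (Ω[𝒴.X.presheaf.stalk y⁄k]))
      (bK : Module.Basis (Fin d) 𝒴.X.functionField (Ω[𝒴.X.functionField⁄k])),
      ∀ l, bK l = diffMap (stalkSpecAlgHom k 𝒴.X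
        ((genericPoint_spec 𝒴.X).specializes (Set.mem_univ y))) (b l) := by
  have := h𝒴.smooth
  obtain ⟨d, ⟨b⟩⟩ := exists_basis_stalk k y
  obtain ⟨bK, hK⟩ := exists_basis_of_formallyEtale (stalkSpecAlgHom k 𝒴.X
    ((genericPoint_spec 𝒴.X).specializes (Set.mem_univ y)))
    (RingHom.formallyEtale_algebraMap.2
      (Algebra.FormallyEtale.of_isLocalization (Rₘ := 𝒴.X.functionField)
        (nonZeroDivisors (𝒴.X.presheaf.stalk y)))) b
  exact ⟨d, b, bK, hK⟩

/-- All coordinate multiplicities at a point off the support are `1`, so the cancelled generators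
are regular forms on the chart. A coefficient that lies in `k(Y)` and in `𝒪_{W,w}` lies in
`𝒪_{Y,y}`. -/
theorem exists_symFormsMap_eq_of_notMem_supp (h𝒴 : 𝒴.IsSmooth) {y : 𝒴.X} (hy : y ∉ 𝒴.supp)
    {n p : ℕ} {ω : SymForms k 𝒴.X.functionField p} (hω : ω ∈ 𝒴.stalkForms n p y) :
    ∃ τ, symFormsMap p (stalkSpecAlgHom k 𝒴.X
      ((genericPoint_spec 𝒴.X).specializes (Set.mem_univ y))) τ = ω := by
  obtain ⟨c, w, hw⟩ := h𝒴.exists_chart y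
  have hm : ∀ l, c.coordMult w l = 1 := by
    intro l
    by_contra hl
    obtain ⟨D, hD, -, -, h0⟩ := c.exists_of_coordMult_ne_one hl
    exact hy ⟨c.g D, h0, hw ▸ hD.map c.g.continuous⟩
  let A := 𝒴.X.presheaf.stalk y
  let B := c.W.presheaf.stalk w
  let φ : A →ₐ[k] B := stalkMapAt k c.g hw
  let _ : Algebra A B := φ.toRingHom.toAlgebra
  obtain ⟨h1, h2, -, h4⟩ := stalkMapAt_etale k c.g hw
  have : Module.Flat A B := h1
  have : IsLocalHom (algebraMap A B) := h4
  have : Module.FaithfullyFlat A B := Module.FaithfullyFlat.of_flat_of_isLocalHom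
  let j : B →ₐ[k] c.W.functionField :=
    stalkSpecAlgHom k c.W ((genericPoint_spec c.W).specializes (Set.mem_univ w))
  have hj : Function.Injective j := IsFractionRing.injective B c.W.functionField
  have hB := c.hasEtaleCoordinates w
  have hpull := hω c w hw
  rw [c.localModule_eq] at hpull
  have hgen : logGenerator (k := k) (fun l ↦ algebraMap (c.W.presheaf.stalk w) c.W.functionField
      (c.coordAt w l)) (c.coordMult w) n p =
      orbGenerator (fun l ↦ j (AlgHom.id k B (c.coordAt w l))) (c.coordMult w) n p :=
    funext fun J ↦ logGenerator_eq_orbGenerator _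
      (fun l ↦ (map_ne_zero_iff _ hj).2 (hB.ne_zero l)) _ n p J
  rw [hgen] at hpull
  obtain ⟨G, hG, -⟩ := exists_symFormsMap_eq_of_mem_span (AlgHom.id k B) j (c.coordAt w)
    (c.coordMult w) (fun l hl ↦ (hl (hm l)).elim) n p hpull
  obtain ⟨d, b, bK, hbK⟩ := exists_basis_stalk_functionField h𝒴 y
  obtain ⟨bB, hbB⟩ := exists_basis_of_formallyEtale φ h2 b
  obtain ⟨bL, hbL⟩ := exists_basis_of_formallyEtale j
    (RingHom.formallyEtale_algebraMap.2
      (Algebra.FormallyEtale.of_isLocalization (Rₘ := c.W.functionField) (nonZeroDivisors B))) bB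
  exact mem_range_symFormsMap_of_descent p φ _ j (functionFieldMap k c.g)
    (functionFieldMap_algebraMap k c.g hw)
    (fun z r h ↦ mem_range_of_faithfullyFlat (A := A) (c := z) (r := r) j.toRingHom hj
      (functionFieldMap k c.g).toRingHom (functionFieldMap_algebraMap k c.g hw) h) b bK bB bL hbK hbB hbL ω G hG.symm

theorem symFormsMap_stalkSpecAlgHom_injective (h𝒴 : 𝒴.IsSmooth) (y : 𝒴.X) (p : ℕ) :
    Function.Injective (symFormsMap p (stalkSpecAlgHom k 𝒴.X
      ((genericPoint_spec 𝒴.X).specializes (Set.mem_univ y)))) := by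
  obtain ⟨d, b, bK, hbK⟩ := exists_basis_stalk_functionField h𝒴 y
  exact symFormsMap_injective p _ b bK hbK
    (IsFractionRing.injective (𝒴.X.presheaf.stalk y) 𝒴.X.functionField)

variable {𝒳 : Orbifold k} {f : 𝒳.X ⟶ 𝒴.X} [f.IsOver (Spec (.of k))]

theorem IsMorphism.genericPoint_notMem_supp (hf : IsMorphism 𝒳 𝒴 f) :
    f (genericPoint 𝒳.X) ∉ 𝒴.supp := by
  rintro ⟨E, hE0, hE⟩
  refine hf.not_subset ?_
  rintro _ ⟨x, rfl⟩
  exact ⟨E, hE0, hE.trans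
    (((genericPoint_spec 𝒳.X).specializes (Set.mem_univ x)).map f.continuous)⟩

theorem IsPullback.unique (h𝒴 : 𝒴.IsSmooth) {p : ℕ} {ω : SymForms k 𝒴.X.functionField p}
    {ω₁ ω₂ : SymForms k 𝒳.X.functionField p} (h₁ : IsPullback k f p ω ω₁)
    (h₂ : IsPullback k f p ω ω₂) : ω₁ = ω₂ := by
  obtain ⟨τ₁, h₁, rfl⟩ := h₁
  obtain ⟨τ₂, h₂, rfl⟩ := h₂
  rw [symFormsMap_stalkSpecAlgHom_injective h𝒴 _ p (h₁.trans h₂.symm)]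

theorem IsPullback.add {p : ℕ} {ω₁ ω₂ : SymForms k 𝒴.X.functionField p}
    {ω₁' ω₂' : SymForms k 𝒳.X.functionField p} (h₁ : IsPullback k f p ω₁ ω₁')
    (h₂ : IsPullback k f p ω₂ ω₂') : IsPullback k f p (ω₁ + ω₂) (ω₁' + ω₂') := by
  obtain ⟨τ₁, rfl, rfl⟩ := h₁
  obtain ⟨τ₂, rfl, rfl⟩ := h₂
  exact ⟨τ₁ + τ₂, map_add _ _ _, map_add _ _ _⟩

theorem IsPullback.zero (p : ℕ) : IsPullback k f p 0 0 :=
  ⟨0, map_zero _, map_zero _⟩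

theorem IsPullback.smul {p : ℕ} {ω : SymForms k 𝒴.X.functionField p}
    {ω' : SymForms k 𝒳.X.functionField p} (h : IsPullback k f p ω ω') (x : 𝒳.X)
    (a : 𝒴.X.presheaf.stalk (f x)) :
    IsPullback k f p (algebraMap (𝒴.X.presheaf.stalk (f x)) 𝒴.X.functionField a • ω)
      (algebraMap (𝒳.X.presheaf.stalk x) 𝒳.X.functionField (stalkMapAlgHom k f x a) • ω') := by
  obtain ⟨τ, rfl, rfl⟩ := h
  have hη := (genericPoint_spec 𝒳.X).specializes (Set.mem_univ x)
  refine ⟨stalkSpecAlgHom k 𝒴.X (hη.map f.continuous) a • τ, ?_, ?_⟩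
  · rw [symFormsMap_smul, stalkSpecAlgHom_stalkSpecAlgHom]
    rfl
  · rw [symFormsMap_smul, ← stalkSpecAlgHom_stalkMapAlgHom k f hη]
    rfl

theorem IsMorphism.exists_isPullback (h𝒴 : 𝒴.IsSmooth) (hf : IsMorphism 𝒳 𝒴 f) {n p : ℕ}
    {ω : SymForms k 𝒴.X.functionField p} (hω : ω ∈ 𝒴.stalkForms n p (f (genericPoint 𝒳.X))) :
    ∃ ω', IsPullback k f p ω ω' := by
  obtain ⟨τ, hτ⟩ := exists_symFormsMap_eq_of_notMem_supp h𝒴 hf.genericPoint_notMem_supp hω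
  exact ⟨_, τ, hτ, rfl⟩

theorem IsPullback.mem_stalkForms (h𝒴 : 𝒴.IsSmooth) (hf : IsMorphism 𝒳 𝒴 f) {n p : ℕ}
    {ω : SymForms k 𝒴.X.functionField p} {ω' : SymForms k 𝒳.X.functionField p}
    (h : IsPullback k f p ω ω') {x : 𝒳.X} (hω : ∀ y, y ⤳ f x → ω ∈ 𝒴.stalkForms n p y) :
    ω' ∈ 𝒳.stalkForms n p x := by
  obtain ⟨τ, rfl, rfl⟩ := h
  rintro c w rfl
  exact c.pull_mem_localModule h𝒴 hf n p τ w hω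

end Orbifold

end Regularity

/-! ### The pullback morphism -/

namespace Orbifold

section PullbackMorphism

variable {k : Type u} [Field k] {𝒳 𝒴 : Orbifold k} {f : 𝒳.X ⟶ 𝒴.X} [f.IsOver (Spec (.of k))]

theorem IsMorphism.exists_isPullback_of_section (h𝒴 : 𝒴.IsSmooth) (hf : IsMorphism 𝒳 𝒴 f)
    {n p : ℕ} {V : 𝒴.X.Opens} (s : 𝒴.formsSections n p V) (x : (f ⁻¹ᵁ V : 𝒳.X.Opens)) :
    ∃ ω', IsPullback k f p (s.1 ⟨f x, x.2⟩) ω' := by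
  have hη : genericPoint 𝒳.X ∈ f ⁻¹ᵁ V :=
    ((genericPoint_spec 𝒳.X).specializes (Set.mem_univ x.1)).mem_open (f ⁻¹ᵁ V).2 x.2
  -- Sections are constant families, so the value at `f x` is also the value at the image of the
  -- generic point, where the form is regular.
  rw [s.2.1 ⟨f x, x.2⟩ ⟨f (genericPoint 𝒳.X), hη⟩]
  exact hf.exists_isPullback h𝒴 (s.2.2 ⟨f (genericPoint 𝒳.X), hη⟩)

/-- The pullback of sections of `S^n Ω^p` along a morphism of orbifolds. -/
def pullbackSections (h𝒴 : 𝒴.IsSmooth) (hf : IsMorphism 𝒳 𝒴 f) (n p : ℕ) (V : 𝒴.X.Opens)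
    (s : 𝒴.formsSections n p V) : 𝒳.formsSections n p (f ⁻¹ᵁ V) :=
  ⟨fun x ↦ (hf.exists_isPullback_of_section h𝒴 s x).choose, fun x y ↦ by
    have hx := (hf.exists_isPullback_of_section h𝒴 s x).choose_spec
    exact ((congr_arg (IsPullback k f p · _) (s.2.1 ⟨f x, x.2⟩ ⟨f y, y.2⟩)).mp hx).unique h𝒴
      (hf.exists_isPullback_of_section h𝒴 s y).choose_spec, fun x ↦ by
    refine (hf.exists_isPullback_of_section h𝒴 s x).choose_spec.mem_stalkForms h𝒴 hf
      fun y hy ↦ ?_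
    rw [s.2.1 ⟨f x, x.2⟩ ⟨y, hy.mem_open V.2 x.2⟩]
    exact s.2.2 ⟨y, hy.mem_open V.2 x.2⟩⟩

theorem isPullback_pullbackSections (h𝒴 : 𝒴.IsSmooth) (hf : IsMorphism 𝒳 𝒴 f) {n p : ℕ}
    {V : 𝒴.X.Opens} (s : 𝒴.formsSections n p V) (x : (f ⁻¹ᵁ V : 𝒳.X.Opens)) :
    IsPullback k f p (s.1 ⟨f x, x.2⟩) ((pullbackSections h𝒴 hf n p V s).1 x) :=
  (hf.exists_isPullback_of_section h𝒴 s x).choose_spec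

theorem pullbackSections_eq (h𝒴 : 𝒴.IsSmooth) (hf : IsMorphism 𝒳 𝒴 f) {n p : ℕ}
    {V : 𝒴.X.Opens} (s : 𝒴.formsSections n p V) (t : 𝒳.formsSections n p (f ⁻¹ᵁ V))
    (h : ∀ x : (f ⁻¹ᵁ V : 𝒳.X.Opens), IsPullback k f p (s.1 ⟨f x, x.2⟩) (t.1 x)) :
    pullbackSections h𝒴 hf n p V s = t :=
  Subtype.ext <| funext fun x ↦ (isPullback_pullbackSections h𝒴 hf s x).unique h𝒴 (h x)

theorem pullbackSections_smul (h𝒴 : 𝒴.IsSmooth) (hf : IsMorphism 𝒳 𝒴 f) {n p : ℕ}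
    {V : 𝒴.X.Opens} (r : Γ(𝒴.X, V)) (s : 𝒴.formsSections n p V) :
    pullbackSections h𝒴 hf n p V (r • s) = (f.app V).hom r • pullbackSections h𝒴 hf n p V s := by
  refine pullbackSections_eq h𝒴 hf _ _ fun x ↦ ?_
  rw [formsSections_smul_apply, formsSections_smul_apply]
  have h1 : (𝒳.X.presheaf.germ (f ⁻¹ᵁ V) x.1 x.2).hom ((f.app V).hom r) =
      stalkMapAlgHom k f x.1 ((𝒴.X.presheaf.germ V (f x.1) x.2).hom r) :=
    congr($(Scheme.Hom.germ_stalkMap f V x.1 x.2).hom r).symm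
  rw [h1]
  exact (isPullback_pullbackSections h𝒴 hf s x).smul x.1 _

/-- The morphism `S^n Ω^p_{(Y,Δ_Y)} → f_* S^n Ω^p_{(X,Δ_X)}`. -/
def pushforwardHom (h𝒴 : 𝒴.IsSmooth) (hf : IsMorphism 𝒳 𝒴 f) (n p : ℕ) :
    𝒴.symDiff n p ⟶ (Scheme.Modules.pushforward f).obj (𝒳.symDiff n p) where
  val := PresheafOfModules.homMk
    { app := fun V ↦ AddCommGrpCat.ofHom
        { toFun := pullbackSections h𝒴 hf n p V.unop
          map_zero' := pullbackSections_eq h𝒴 hf _ _ fun _ ↦ IsPullback.zero p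
          map_add' := fun s t ↦ pullbackSections_eq h𝒴 hf _ _ fun x ↦
            (isPullback_pullbackSections h𝒴 hf s x).add (isPullback_pullbackSections h𝒴 hf t x) }
      naturality := fun V V' i ↦ by
        ext s
        exact pullbackSections_eq h𝒴 hf _ _ fun x ↦
          isPullback_pullbackSections h𝒴 hf s ⟨x.1, i.unop.le x.2⟩ }
    fun V r s ↦ pullbackSections_smul h𝒴 hf r s

end PullbackMorphism

end Orbifold

end

theorem lemma4p3 {k : Type u} [Field k] [IsAlgClosed k] (𝒳 𝒴 : Orbifold k) (h𝒳 : 𝒳.IsSmooth)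
    (h𝒴 : 𝒴.IsSmooth) (f : 𝒳.X ⟶ 𝒴.X) [f.IsOver (Spec (.of k))]
    (hf : Orbifold.IsMorphism 𝒳 𝒴 f) (n p : ℕ) :
    ∃! φ : (Scheme.Modules.pullback f).obj (𝒴.symDiff n p) ⟶ 𝒳.symDiff n p,
      Orbifold.IsInducedByPullback f n p φ := by
  let e := (Scheme.Modules.pullbackPushforwardAdjunction f).homEquiv (𝒴.symDiff n p)
    (𝒳.symDiff n p)
  refine ⟨e.symm (Orbifold.pushforwardHom h𝒴 hf n p), fun V ω x ↦ ?_, fun φ hφ ↦ ?_⟩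
  · change Orbifold.IsPullback k f p _ (𝒳.evalForm (((e (e.symm _)).app V).hom ω) x)
    rw [Equiv.apply_symm_apply]
    exact Orbifold.isPullback_pullbackSections h𝒴 hf ω x
  -- The adjoint of `φ` is determined by its values on sections of `S^n Ω^p_Y`, and these are
  -- pullbacks of rational forms, hence unique.
  · refine e.injective ?_
    rw [Equiv.apply_symm_apply]
    refine Scheme.Modules.hom_ext _ _ fun V ↦ ?_
    ext ω
    exact (Orbifold.pullbackSections_eq h𝒴 hf ω _ fun x ↦ hφ V ω x).symm
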